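/- Let $k$ be a commutative ring. For a group $G$ and a subgroup $H\subseteq G$ of finite index, say that $(G,H,k)$ satisfies Moore's condition if for every $g\in G\setminus H$ either (i) $\langle g\rangle\cap H$ is non-trivial, or (ii) $g$ has finite order and this order is invertible in $k$. Let $\mathfrak{M}_{inj}=\mathfrak{M}_{inj}(k)$ be the class of all groups $G$ such that, for every subgroup $H\subseteq G$ of finite index for which $(G,H,k)$ satisfies Moore's condition, every $kG$-module $M$ whose restriction $\mathrm{res}_H^GM$ is an injective $kH$-module is itself an injective $kG$-module. For a class $\mathfrak{C}$ of groups: * Put ${\bf H}_0\mathfrak{C}=\mathfrak{C}$ and, for an ordinal $\alpha>0$, let ${\bf H}_\alpha\mathfrak{C}$ be the class of groups which admit a cellular action on a finite-dimensional contractible CW-complex (the group permutes the cells, and an element mapping a cell to itself fixes it pointwise) such that each isotropy subgroup belongs to ${\bf H}_\beta\mathfrak{C}$ for some $\beta<\alpha$ (which may depend on the cell). Let ${\bf H}\mathfrak{C}=\bigcup_\alpha{\bf H}_\alpha\mathfrak{C}$, and let ${\bf LH}\mathfrak{C}$ be the class of groups all of whose finitely generated subgroups are contained in some ${\bf H}\mathfrak{C}$-subgroup.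 * Let $\Phi_{inj}\mathfrak{C}$ be the class of groups $G$ such that, for every $kG$-module $M$, the following are equivalent: $\mathrm{id}_{kG}M<\infty$; there is an integer $n$ with $\mathrm{id}_{kH}\,\mathrm{res}_H^GM\le n$ for every $\mathfrak{C}$-subgroup $H\subseteq G$. **Theorem 5.5.** Let $G$ be a group and $H\subseteq G$ a subgroup of finite index such that $(G,H,k)$ satisfies Moore's condition. If $M$ is a $kG$-module such that $\mathrm{res}_H^GM$ is an injective $kH$-module, then: (i) $\mathrm{res}_S^GM$ is an injective $kS$-module for every ${\bf LH}\mathfrak{M}_{inj}$-subgroup $S\subseteq G$; (ii) $\mathrm{res}_S^GM$ is an injective $kS$-module for every $\Phi_{inj}\mathfrak{M}_{inj}$-subgroup $S\subseteq G$. -/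

import Mathlib

universe u

namespace GroupMod

/-- A class of groups (in a fixed universe), given by its membership predicate. -/
abbrev GroupClass : Type (u + 1) := (G : Type u) → [Group G] → Prop

/-! ### Modules over group algebras, restriction, injectivity -/

/-- The inclusion `kH → kG` of group algebras induced by a subgroup `H ≤ G`. -/
noncomputable def inclHom (k : Type u) [CommRing k] {G : Type u} [Group G] (H : Subgroup G) :
    MonoidAlgebra k H →+* MonoidAlgebra k G :=
  MonoidAlgebra.mapDomainRingHom k H.subtype

/-- The restriction `res_H^G M` of a `kG`-module `M` to a subgroup `H ≤ G`. -/
noncomputable def res {k : Type u} [CommRing k] {G : Type u} [Group G] (H : Subgroup G)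
    (M : ModuleCat.{u} (MonoidAlgebra k G)) : ModuleCat.{u} (MonoidAlgebra k H) :=
  (ModuleCat.restrictScalars (inclHom k H)).obj M

/-! ### Moore's condition and the injective version of Moore's conjecture -/

/-- Moore's condition for a triple `(G, H, k)`: for every `g ∈ G \ H`, either
`⟨g⟩ ∩ H` is non-trivial, or `g` has finite order and that order is invertible in `k`.
(The finiteness of the index of `H` is stated separately.) -/
def MooreCondition (k : Type u) [CommRing k] {G : Type u} [Group G] (H : Subgroup G) : Prop :=
  ∀ g : G, g ∉ H →
    Subgroup.zpowers g ⊓ H ≠ ⊥ ∨ (IsOfFinOrder g ∧ IsUnit (orderOf g : k))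

/-- The class of groups that satisfy the injective version of Moore's conjecture over `k`. -/
def MooreInj (k : Type u) [CommRing k] : GroupClass.{u} := fun G _ =>
  ∀ H : Subgroup G, H.FiniteIndex → MooreCondition k H →
    ∀ M : ModuleCat.{u} (MonoidAlgebra k G),
      CategoryTheory.Injective (res H M) → CategoryTheory.Injective M

/-! ### Kropholler's operation `LH` -/

/-- A cellular action of a (discrete) group on a CW-complex: the group acts by homeomorphisms,
it permutes the open cells of each dimension, and an element which maps a cell to itself fixes
that cell pointwise (that is, `X` is a `G`-CW-complex). -/
structure IsCellularAction (G : Type u) [Group G] (X : Type u) [TopologicalSpace X]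
    [Topology.CWComplex (Set.univ : Set X)] [MulAction G X] : Prop where
  continuous_smul : ∀ g : G, Continuous (fun x : X => g • x)
  permutes : ∀ (g : G) (n : ℕ) (i : Topology.RelCWComplex.cell (Set.univ : Set X) n),
    ∃ j : Topology.RelCWComplex.cell (Set.univ : Set X) n,
      (fun x : X => g • x) '' Topology.RelCWComplex.openCell (C := Set.univ) n i =
        Topology.RelCWComplex.openCell (C := Set.univ) n j
  fixes : ∀ (g : G) (n : ℕ) (i : Topology.RelCWComplex.cell (Set.univ : Set X) n),
    (fun x : X => g • x) '' Topology.RelCWComplex.openCell (C := Set.univ) n i =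
        Topology.RelCWComplex.openCell (C := Set.univ) n i →
      ∀ x ∈ Topology.RelCWComplex.openCell (C := Set.univ) n i, g • x = x

/-- `G` admits a cellular action on a finite-dimensional contractible (Hausdorff) CW-complex,
all of whose isotropy subgroups satisfy `P`. -/
def ActsWithIsotropy (G : Type u) [Group G] (P : Subgroup G → Prop) : Prop :=
  ∃ (X : Type u) (_ : TopologicalSpace X) (_ : T2Space X) (_ : ContractibleSpace X)
    (_ : Topology.CWComplex (Set.univ : Set X))
    (_ : Topology.RelCWComplex.FiniteDimensional (Set.univ : Set X))
    (_ : MulAction G X),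
    IsCellularAction G X ∧ ∀ x : X, P (MulAction.stabilizer G x)

/-- The classes `H_α C`, by transfinite recursion: `H_0 C = C`, and for `α > 0` the class `H_α C`
consists of the groups acting cellularly on a finite-dimensional contractible CW-complex with each
isotropy subgroup in `H_β C` for some `β < α`, which may depend on the isotropy subgroup. -/
def HStage (C : GroupClass.{u}) (α : Ordinal.{u}) : GroupClass.{u} := fun G _ =>
  (α = 0 ∧ C G) ∨
    (0 < α ∧ ActsWithIsotropy G (fun K => ∃ β : Ordinal.{u}, ∃ _ : β < α, HStage C β K))
termination_by α

/-- The class `H C`, the union of the classes `H_α C` over all ordinals `α`. -/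
def HClosure (C : GroupClass.{u}) : GroupClass.{u} := fun G _ =>
  ∃ α : Ordinal.{u}, HStage C α G

/-- The class `LH C` of those groups all of whose finitely generated subgroups are contained in
some subgroup that belongs to `H C`. -/
def LH (C : GroupClass.{u}) : GroupClass.{u} := fun G _ =>
  ∀ F : Subgroup G, F.FG → ∃ K : Subgroup G, F ≤ K ∧ HClosure C K

/-! ### The injective version of Talelli's operation `Φ` -/

/-- The class `Φ_inj C` of those groups `G` for which every `kG`-module `M` has finite injective
dimension if and only if the injective dimensions of its restrictions to the subgroups of `G` that
belong to `C` are bounded. -/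
def PhiInj (k : Type u) [CommRing k] (C : GroupClass.{u}) : GroupClass.{u} := fun G _ =>
  ∀ M : ModuleCat.{u} (MonoidAlgebra k G),
    (∃ n : ℕ, CategoryTheory.HasInjectiveDimensionLE M n) ↔
      ∃ n : ℕ, ∀ H : Subgroup G, C H → CategoryTheory.HasInjectiveDimensionLE (res H M) n

end GroupMod

/-! Both classes in the theorem are contained in the class of groups satisfying Moore's conjecture
(`MooreInj.of_LH`, `MooreInj.of_phiInj`). Since Moore's condition and injectivity pass from `H ≤ G`
to `H ∩ S ≤ S`, the conjecture for `S` itself then gives injectivity over `kS`.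

Injectivity over `kG` is split into injectivity over `k` and the existence of a mean: an equivariant
retraction of the functions `G → V` onto the constants. Injectivity over a subgroup yields a mean
over that subgroup, and injectivity over `k` is already known from `H`, so everything becomes a
question about means. The cokernel of `V → (G → V)` is the cosyzygy. Higman's criterion
(`HasMean.of_cosyzygy`) is the engine: if `V` has a mean over a subgroup of finite index and its
cosyzygy has a mean over `G`, then so has `V`. Thus it suffices to find a mean after finitely many
cosyzygies, that is, to bound a cohomological dimension. For finite injective dimension this is
immediate, and it settles `Φ_inj`.

For actions on spaces the bound is expressed by cocycles on tuples (`CocyclesBound`,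
`hasMean_of_cocyclesBound`). Given an equivariant chain map from tuples in `G` to tuples in a
`G`-set `E` whose stabilizers have means, it is enough that cocycles on `E` vanishing in low degrees
become coboundaries on `G`. For a `d`-dimensional contractible `G`-CW-complex no cellular homology
is needed: tuples of group elements span simplices by a contraction, equivariant subdivision makes
them small, and vertices are moved to centers of nearby cells. Locally such a center is determined
by the dimension of its cell, so a small tuple can be sorted by dimension into tuples of at most `d
+ 1` centers, on which the cocycle vanishes (`exists_small_chains`,
`IsCellularAction.exists_coloring`, `hasMean_of_coloring`). Transfinite induction then treats all of
`H`.

The passage from `H` to `LH` is an induction on the cardinality of a generating set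
(`hasMean_of_fg`). A group that is not finitely generated is the union of a continuous chain of
subgroups with fewer generators, and over such a union cohomology in degrees at least two vanishes,
by Zorn's lemma and correction of partial solutions. Higman's criterion removes the remaining
degree. -/

namespace GroupMod

/-! ### Equivariant means -/

section Means

variable {k : Type*} [CommRing k] {G : Type*} [Group G] {V W : Type*}
  [AddCommGroup V] [Module k V] [AddCommGroup W] [Module k W]

/-- The diagonal action on the functions from a `G`-set to a representation. -/
def funRep (ρ : Representation k G V) (Y : Type*) [MulAction G Y] :
    Representation k G (Y → V) where
  toFun g :=
    { toFun := fun f y => ρ g (f (g⁻¹ • y))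
      map_add' := fun f f' => by ext y; simp
      map_smul' := fun c f => by ext y; simp }
  map_one' := by ext; simp
  map_mul' g h := by
    refine LinearMap.ext fun f => funext fun y => ?_
    simp [mul_smul]

@[simp]
lemma funRep_apply (ρ : Representation k G V) {Y : Type*} [MulAction G Y] (g : G) (f : Y → V)
    (y : Y) : funRep ρ Y g f y = ρ g (f (g⁻¹ • y)) := rfl

/-- A representation `V` of `G` has a mean over the subgroup `K` if the embedding of `V` into
the functions `G → V` as the constant functions has a `K`-equivariant linear retraction. -/
def HasMean (ρ : Representation k G V) (K : Subgroup G) : Prop :=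
  ∃ r : (G → V) →ₗ[k] V, (∀ v, r (fun _ => v) = v) ∧
    ∀ g ∈ K, ∀ f, r (funRep ρ G g f) = ρ g (r f)

lemma HasMean.mono {ρ : Representation k G V} {K L : Subgroup G} (h : HasMean ρ L) (hKL : K ≤ L) :
    HasMean ρ K := by
  obtain ⟨r, h1, h2⟩ := h
  exact ⟨r, h1, fun g hg => h2 g (hKL hg)⟩

lemma hasMean_bot (ρ : Representation k G V) : HasMean ρ ⊥ := by
  refine ⟨LinearMap.proj 1, fun v => rfl, fun g hg f => ?_⟩
  rw [Subgroup.mem_bot] at hg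
  simp [hg]

/-- Restriction to the diagonal of `G × G` is equivariant. The representations `G → V` thus play the
role of relatively injective objects. -/
lemma hasMean_funRep (ρ : Representation k G V) : HasMean (funRep ρ G) ⊤ := by
  refine ⟨LinearMap.pi fun y => LinearMap.proj y ∘ₗ LinearMap.proj y, fun v => rfl,
    fun g _ f => ?_⟩
  ext y
  simp

lemma HasMean.retract {ρ : Representation k G V} {τ : Representation k G W} {K : Subgroup G}
    (h : HasMean τ K) (i : V →ₗ[k] W) (p : W →ₗ[k] V) (hpi : ∀ v, p (i v) = v)
    (hi : ∀ g ∈ K, ∀ v, i (ρ g v) = τ g (i v)) (hp : ∀ g ∈ K, ∀ w, p (τ g w) = ρ g (p w)) :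
    HasMean ρ K := by
  obtain ⟨r, h1, h2⟩ := h
  refine ⟨p ∘ₗ r ∘ₗ i.compLeft G, fun v => ?_, fun g hg f => ?_⟩
  · have : i.compLeft G (fun _ => v) = fun _ => i v := rfl
    simp [this, h1, hpi]
  · have : i.compLeft G (funRep ρ G g f) = funRep τ G g (i.compLeft G f) := by
      ext y; simp [hi g hg]
    simp [this, h2 g hg, hp g hg]

variable (k G V) in
/-- The submodule of constant functions. -/
def constFun : Submodule k (G → V) := LinearMap.range (LinearMap.pi fun _ : G => LinearMap.id)

variable (k G V) in
/-- The cokernel of the embedding of `V` into `G → V` as the constant functions. -/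
abbrev Cosyzygy : Type _ := (G → V) ⧸ constFun k G V

/-- The action of `G` on the cokernel of the embedding of `V` into `G → V`. -/
def cosyzygyRep (ρ : Representation k G V) : Representation k G (Cosyzygy k G V) :=
  (funRep ρ G).quotient (constFun k G V) (by
    rintro g _ ⟨v, rfl⟩
    exact ⟨ρ g v, rfl⟩)

@[simp]
lemma cosyzygyRep_mk (ρ : Representation k G V) (g : G) (f : G → V) :
    cosyzygyRep ρ g ((constFun k G V).mkQ f) = (constFun k G V).mkQ (funRep ρ G g f) := rfl

/-- A `K`-equivariant linear section of the projection of `G → V` onto the cosyzygy. -/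
def HasSection (ρ : Representation k G V) (K : Subgroup G) : Prop :=
  ∃ σ : Cosyzygy k G V →ₗ[k] (G → V), (∀ w, (constFun k G V).mkQ (σ w) = w) ∧
    ∀ g ∈ K, ∀ w, σ (cosyzygyRep ρ g w) = funRep ρ G g (σ w)

/-- A retraction of the inclusion of constants splits the sequence: `f - r f` depends only on the
class of `f`. -/
lemma HasMean.hasSection {ρ : Representation k G V} {K : Subgroup G} (h : HasMean ρ K) :
    HasSection ρ K := by
  obtain ⟨r, h1, h2⟩ := h
  let q : (G → V) →ₗ[k] (G → V) := LinearMap.id - (LinearMap.pi fun _ : G => LinearMap.id) ∘ₗ r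
  have hq : ∀ f, q f = f - fun _ => r f := fun f => rfl
  have hle : constFun k G V ≤ LinearMap.ker q := by
    rintro _ ⟨v, rfl⟩
    have : (LinearMap.pi fun _ : G => (LinearMap.id : V →ₗ[k] V)) v = fun _ => v := rfl
    rw [LinearMap.mem_ker, this, hq, h1, sub_self]
  have h3 : ∀ f, (constFun k G V).liftQ q hle ((constFun k G V).mkQ f) = q f :=
    fun f => Submodule.liftQ_apply _ _ _
  refine ⟨(constFun k G V).liftQ q hle, fun w => ?_, fun g hg w => ?_⟩
  · obtain ⟨f, rfl⟩ := (constFun k G V).mkQ_surjective w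
    have h0 : (constFun k G V).mkQ (fun _ => r f) = 0 :=
      (Submodule.Quotient.mk_eq_zero _).2 ⟨r f, rfl⟩
    rw [h3, hq, map_sub, h0, sub_zero]
  · obtain ⟨f, rfl⟩ := (constFun k G V).mkQ_surjective w
    rw [cosyzygyRep_mk]
    rw [h3, h3, hq, hq, h2 g hg, map_sub]
    rfl

lemma HasSection.hasMean {ρ : Representation k G V} {K : Subgroup G} (h : HasSection ρ K) :
    HasMean ρ K := by
  obtain ⟨σ, h1, h2⟩ := h
  have key : ∀ f, ∃ v : V, (fun _ => v) = f - σ ((constFun k G V).mkQ f) := fun f => by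
    change f - σ ((constFun k G V).mkQ f) ∈ constFun k G V
    rw [← Submodule.Quotient.mk_eq_zero]
    change (constFun k G V).mkQ _ = 0
    rw [map_sub, h1, sub_self]
  let q : (G → V) →ₗ[k] (G → V) := LinearMap.id - σ ∘ₗ (constFun k G V).mkQ
  have hq : ∀ f, q f = f - σ ((constFun k G V).mkQ f) := fun f => rfl
  refine ⟨LinearMap.proj 1 ∘ₗ q, fun v => ?_, fun g hg f => ?_⟩
  · have : (constFun k G V).mkQ (fun _ => v) = 0 := (Submodule.Quotient.mk_eq_zero _).2 ⟨v, rfl⟩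
    rw [LinearMap.comp_apply, hq, this, map_zero, sub_zero]
    rfl
  -- Evaluation at `1` is not equivariant in general, but it is on constant functions, and `q` takes
  -- only such values.
  · obtain ⟨v, hv⟩ := key f
    have e : q (funRep ρ G g f) = funRep ρ G g (q f) := by
      rw [hq, hq, map_sub, ← h2 g hg, cosyzygyRep_mk]
    rw [LinearMap.comp_apply, LinearMap.comp_apply, e, hq f, ← hv]
    rfl

/-- The section makes the cosyzygy a `K`-equivariant direct summand of `G → V`, which has a mean
over `G`. -/
lemma HasMean.cosyzygy {ρ : Representation k G V} {K : Subgroup G} (h : HasMean ρ K) :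
    HasMean (cosyzygyRep ρ) K := by
  obtain ⟨σ, h1, h2⟩ := h.hasSection
  exact ((hasMean_funRep ρ).mono le_top).retract σ (constFun k G V).mkQ h1 h2 fun g _ w => rfl

/-- Higman's criterion: a representation with means over a subgroup of finite index has a mean as
soon as its cosyzygy has one. -/
lemma HasMean.of_cosyzygy {ρ : Representation k G V} (H : Subgroup G) [H.FiniteIndex]
    (hH : HasMean ρ H) (h : HasMean (cosyzygyRep ρ) ⊤) : HasMean ρ ⊤ := by
  classical
  obtain ⟨σ, hσ1, hσ2⟩ := hH.hasSection
  obtain ⟨R, hR1, hR2⟩ := h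
  let τ := cosyzygyRep ρ
  -- `ind g w` is `w` on the coset `gH` and zero elsewhere. By equivariance of `R`, `term g` is the
  -- translate by `g` of the `H`-map `σ ∘ R ∘ ind 1`, so it depends only on `gH`. The sum over the
  -- cosets is an equivariant section, because the indicators add up to the constant function `w`,
  -- which `R` sends to `w`.
  let ind : G → Cosyzygy k G V →ₗ[k] (G → Cosyzygy k G V) := fun g =>
    LinearMap.pi fun x => if g⁻¹ * x ∈ H then LinearMap.id else 0
  have hind : ∀ g w x, ind g w x = if g⁻¹ * x ∈ H then w else 0 := fun g w x => by
    by_cases hx : g⁻¹ * x ∈ H <;> simp [ind, hx]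
  let term : G → Cosyzygy k G V →ₗ[k] (G → V) := fun g =>
    funRep ρ G g ∘ₗ σ ∘ₗ τ g⁻¹ ∘ₗ R ∘ₗ ind g
  have hterm : ∀ g w, term g w = funRep ρ G g (σ (τ g⁻¹ (R (ind g w)))) := fun _ _ => rfl
  have hcongr : ∀ a b, a⁻¹ * b ∈ H → term a = term b := by
    intro a b hab
    have h1 : ind a = ind b := by
      refine LinearMap.ext fun w => funext fun x => ?_
      rw [hind, hind]
      have : a⁻¹ * x = (a⁻¹ * b) * (b⁻¹ * x) := by group
      rw [this, H.mul_mem_cancel_left hab]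
    refine LinearMap.ext fun w => ?_
    have h2 : a⁻¹ = (a⁻¹ * b) * b⁻¹ := by group
    have h3 : τ a⁻¹ (R (ind b w)) = τ (a⁻¹ * b) (τ b⁻¹ (R (ind b w))) := by
      rw [← Module.End.mul_apply, ← map_mul, ← h2]
    rw [hterm, hterm, h1, h3]
    have := hσ2 _ hab (τ b⁻¹ (R (ind b w)))
    change σ (τ (a⁻¹ * b) _) = _ at this
    rw [this, ← Module.End.mul_apply, ← map_mul]
    congr 3
    group
  have hequiv : ∀ g a w, term (g * a) (τ g w) = funRep ρ G g (term a w) := by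
    intro g a w
    have h1 : ind (g * a) (τ g w) = funRep τ G g (ind a w) := by
      ext1 x
      rw [funRep_apply, hind, hind]
      simp only [mul_inv_rev, mul_assoc, smul_eq_mul]
      split_ifs <;> simp
    have h2 : R (funRep τ G g (ind a w)) = τ g (R (ind a w)) := hR2 g trivial _
    rw [hterm, hterm, h1, h2, map_mul, Module.End.mul_apply]
    congr 3
    rw [← Module.End.mul_apply, ← map_mul]
    congr 2
    group
  have : Fintype (G ⧸ H) := Fintype.ofFinite _
  refine HasSection.hasMean ⟨∑ q : G ⧸ H, term q.out, fun w => ?_, fun g _ w => ?_⟩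
  · have h1 : ∀ a, (constFun k G V).mkQ (term a w) = R (ind a w) := by
      intro a
      rw [hterm, ← cosyzygyRep_mk, hσ1]
      change τ a (τ a⁻¹ _) = _
      rw [← Module.End.mul_apply, ← map_mul]
      simp
    rw [LinearMap.sum_apply, map_sum]
    simp only [h1]
    rw [← map_sum]
    have h2 : ∑ q : G ⧸ H, ind q.out w = fun _ => w := by
      ext1 x
      rw [Finset.sum_apply, Finset.sum_eq_single (x : G ⧸ H)]
      · rw [hind, if_pos]
        rw [← QuotientGroup.eq]
        exact Quotient.out_eq _
      · intro q _ hq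
        rw [hind, if_neg]
        rw [← QuotientGroup.eq]
        intro h
        exact hq ((Quotient.out_eq q).symm.trans h)
      · simp
    rw [h2, hR1]
  · rw [LinearMap.sum_apply, LinearMap.sum_apply, map_sum]
    rw [← Equiv.sum_comp (MulAction.toPerm g)]
    refine Finset.sum_congr rfl fun q _ => ?_
    rw [← hequiv]
    have : term (MulAction.toPerm g q).out = term (g * q.out) := by
      apply hcongr
      rw [← QuotientGroup.eq]
      refine (Quotient.out_eq _).trans ?_
      conv_lhs => rw [← Quotient.out_eq q]
      rfl
    rw [this]

end Means

/-! ### Injectivity over group algebras in terms of means -/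

section Injectivity

variable {k : Type u} [CommRing k] {K : Type u} [Group K]

/-- An additive map that commutes with the multiples of group elements is linear over the group
algebra. -/
def linearOfSingle {P Q : Type*} [AddCommGroup P] [Module (MonoidAlgebra k K) P]
    [AddCommGroup Q] [Module (MonoidAlgebra k K) Q] (f : P →+ Q)
    (hf : ∀ (g : K) (c : k) p, f (MonoidAlgebra.single g c • p) = MonoidAlgebra.single g c • f p) :
    P →ₗ[MonoidAlgebra k K] Q where
  toFun := f
  map_add' := map_add f
  map_smul' r p := by
    induction r using MonoidAlgebra.induction_linear with
    | zero => simp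
    | add x y hx hy =>
      simp only [RingHom.id_apply] at hx hy ⊢
      rw [add_smul, map_add, hx, hy, add_smul]
    | single g c => exact hf g c p

/-- The additive equivalence `e` identifies a module over the group algebra with a
representation. -/
def Realizes {P V : Type*} [AddCommGroup P] [Module (MonoidAlgebra k K) P] [AddCommGroup V]
    [Module k V] (ρ : Representation k K V) (e : P ≃+ V) : Prop :=
  ∀ (g : K) (c : k) (p : P), e (MonoidAlgebra.single g c • p) = c • ρ g (e p)

section

variable {P V : Type u} [AddCommGroup P] [Module (MonoidAlgebra k K) P] [AddCommGroup V]
    [Module k V] {ρ : Representation k K V} {e : P ≃+ V}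

lemma realizes_asModule (ρ : Representation k K V) :
    Realizes ρ ρ.asModuleEquiv.toAddEquiv := fun g c p => by
  change ρ.asModuleEquiv _ = _
  rw [Representation.single_smul]
  rfl

lemma Realizes.symm_apply (he : Realizes ρ e) (g : K) (c : k) (v : V) :
    e.symm (c • ρ g v) = MonoidAlgebra.single g c • e.symm v := by
  rw [e.symm_apply_eq, he, e.apply_symm_apply]

lemma Realizes.map_smul {Q : Type*} [AddCommGroup Q] [Module (MonoidAlgebra k K) Q]
    (_ : Realizes ρ e) (F : Q →ₗ[MonoidAlgebra k K] P) (g : K) (c : k) (q : Q) :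
    e (F (MonoidAlgebra.single g c • q)) = c • ρ g (e (F q)) := by
  rw [LinearMap.map_smul, ‹Realizes ρ e›]

/-- The constants embed `P` into the functions on `Y`, and an injective module is a retract of every
module containing it. -/
lemma exists_mean_of_injective (he : Realizes ρ e) (hP : Module.Injective (MonoidAlgebra k K) P)
    (Y : Type u) [MulAction K Y] [Nonempty Y] :
    ∃ r : (Y → V) →ₗ[k] V, (∀ v, r (fun _ => v) = v) ∧
      ∀ g f, r (funRep ρ Y g f) = ρ g (r f) := by
  let τ := funRep ρ Y
  let i : P →ₗ[MonoidAlgebra k K] τ.asModule := linearOfSingle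
    (τ.asModuleEquiv.symm.toAddEquiv.toAddMonoidHom.comp
      ((LinearMap.pi fun _ : Y => (LinearMap.id : V →ₗ[k] V)).toAddMonoidHom.comp
        e.toAddMonoidHom)) (by
    intro g c p
    change τ.asModuleEquiv.symm (fun _ => e _) =
      MonoidAlgebra.single g c • τ.asModuleEquiv.symm (fun _ => e p)
    rw [Representation.single_smul, he]
    rfl)
  have hi : ∀ p, i p = τ.asModuleEquiv.symm (fun _ => e p) := fun _ => rfl
  have hinj : Function.Injective i := by
    intro p q hpq
    rw [hi, hi] at hpq
    exact e.injective (congrFun (τ.asModuleEquiv.symm.injective hpq) (Classical.arbitrary Y))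
  obtain ⟨F, hF⟩ := hP.out i hinj LinearMap.id
  have key : ∀ g (c : k) f, e (F (τ.asModuleEquiv.symm (c • τ g f))) =
      c • ρ g (e (F (τ.asModuleEquiv.symm f))) := by
    intro g c f
    rw [← he.map_smul, Representation.single_smul]
    rfl
  refine ⟨{ toFun := fun f => e (F (τ.asModuleEquiv.symm f))
            map_add' := fun f f' => by simp
            map_smul' := fun c f => by simpa using key 1 c f }, fun v => ?_, fun g f => ?_⟩
  · have := hF (e.symm v)
    rw [hi, e.apply_symm_apply] at this
    simp [this]
  · have := key g 1 f
    rwa [one_smul, one_smul] at this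

/-- Restriction to `k` is right adjoint to induction `X ↦ (K →₀ X)`, which preserves injections.
Extend the map `g ⊗ x ↦ g q(x)` over the induced module and restrict to the summand at `1`. -/
lemma injective_base_of_injective (he : Realizes ρ e)
    (hP : Module.Injective (MonoidAlgebra k K) P) : Module.Injective k V where
  out X Y _ _ _ _ f hf q := by
    have ind : ∀ (Z : Type u) [AddCommGroup Z] [Module k Z],
        ∃ τ : Representation k K (K →₀ Z), ∀ g h z,
          τ g (Finsupp.single h z) = Finsupp.single (g * h) z := by
      intro Z _ _
      refine ⟨{ toFun := fun g => Finsupp.lmapDomain Z k (g * ·), map_one' := ?_,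
                map_mul' := ?_ }, ?_⟩
      · ext; simp
      · intro g h; ext; simp [mul_assoc]
      · intro g h z; simp
    obtain ⟨τX, hX⟩ := ind X
    obtain ⟨τY, hY⟩ := ind Y
    let m : (K →₀ X) →ₗ[k] (K →₀ Y) := Finsupp.mapRange.linearMap f
    have hm : ∀ g x, m (Finsupp.single g x) = Finsupp.single g (f x) := by simp [m]
    have hmτ : ∀ g z, m (τX g z) = τY g (m z) := by
      intro g z
      induction z using Finsupp.induction_linear with
      | zero => simp
      | add x y hx hy => simp only [map_add, hx, hy]
      | single h x => rw [hX, hm, hm, hY]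
    let i : τX.asModule →ₗ[MonoidAlgebra k K] τY.asModule := linearOfSingle
      (τY.asModuleEquiv.symm.toAddEquiv.toAddMonoidHom.comp
        (m.toAddMonoidHom.comp τX.asModuleEquiv.toAddEquiv.toAddMonoidHom)) (by
      intro g c p
      change τY.asModuleEquiv.symm (m (τX.asModuleEquiv _)) =
        MonoidAlgebra.single g c • τY.asModuleEquiv.symm (m (τX.asModuleEquiv p))
      rw [Representation.single_smul, Representation.single_smul]
      change m (c • τX g _) = c • τY g (m _)
      rw [_root_.map_smul, hmτ])
    have hi : ∀ z, i (τX.asModuleEquiv.symm z) = τY.asModuleEquiv.symm (m z) := fun _ => rfl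
    have hinj : Function.Injective i := by
      intro z w hzw
      have : Function.Injective m := Finsupp.mapRange_injective f (map_zero f) hf
      exact this hzw
    let s : (K →₀ X) →ₗ[k] V := Finsupp.lsum k fun g => ρ g ∘ₗ q
    have hs : ∀ g x, s (Finsupp.single g x) = ρ g (q x) := by simp [s]
    have hsτ : ∀ g z, s (τX g z) = ρ g (s z) := by
      intro g z
      induction z using Finsupp.induction_linear with
      | zero => simp
      | add x y hx hy => simp only [map_add, hx, hy]
      | single h x => rw [hX, hs, hs, map_mul]; rfl
    let j : τX.asModule →ₗ[MonoidAlgebra k K] P := linearOfSingle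
      (e.symm.toAddMonoidHom.comp
        (s.toAddMonoidHom.comp τX.asModuleEquiv.toAddEquiv.toAddMonoidHom)) (by
      intro g c p
      change e.symm (s (τX.asModuleEquiv _)) =
        MonoidAlgebra.single g c • e.symm (s (τX.asModuleEquiv p))
      rw [← he.symm_apply, Representation.single_smul, ← hsτ, ← _root_.map_smul s]
      rfl)
    have hj : ∀ z, j (τX.asModuleEquiv.symm z) = e.symm (s z) := fun _ => rfl
    obtain ⟨F, hF⟩ := hP.out i hinj j
    refine ⟨{ toFun := fun y => e (F (τY.asModuleEquiv.symm (Finsupp.single 1 y)))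
              map_add' := fun y y' => by simp
              map_smul' := fun c y => ?_ }, fun x => ?_⟩
    · have h1 : τY.asModuleEquiv.symm (Finsupp.single 1 (c • y)) =
          MonoidAlgebra.single (1 : K) c • τY.asModuleEquiv.symm (Finsupp.single 1 y) := by
        rw [Representation.single_smul, map_one, ← Finsupp.smul_single]
        rfl
      rw [h1, he.map_smul]
      simp
    · have := hF (τX.asModuleEquiv.symm (Finsupp.single 1 x))
      rw [hi, hj, hm, hs] at this
      simp [this]

/-- Extend over `k` to `t`, then apply the mean to the function `x ↦ x t(x⁻¹ y)`. For `y` in the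
image of `f` this function is constant, so the mean does not spoil the extension. -/
lemma injective_of_hasMean (he : Realizes ρ e) (hV : Module.Injective k V)
    (h : HasMean ρ ⊤) : Module.Injective (MonoidAlgebra k K) P where
  out X Y _ _ _ _ f hf q := by
    obtain ⟨r, hr1, hr2⟩ := h
    let : Module k X := Module.compHom X (algebraMap k (MonoidAlgebra k K))
    let : Module k Y := Module.compHom Y (algebraMap k (MonoidAlgebra k K))
    have hX : ∀ (c : k) (x : X), c • x = MonoidAlgebra.single (1 : K) c • x := fun c x => rfl
    have hY : ∀ (c : k) (y : Y), c • y = MonoidAlgebra.single (1 : K) c • y := fun c y => rfl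
    let f' : X →ₗ[k] Y :=
      { toFun := f
        map_add' := map_add f
        map_smul' := fun c x => by rw [hX, LinearMap.map_smul]; rfl }
    let q' : X →ₗ[k] V :=
      { toFun := fun x => e (q x)
        map_add' := fun x y => by simp
        map_smul' := fun c x => by rw [hX, he.map_smul]; simp }
    obtain ⟨t, ht⟩ := hV.out f' hf q'
    have ht' : ∀ x, t (f x) = e (q x) := ht
    have tsmul : ∀ (c : k) (y : Y), t (MonoidAlgebra.single (1 : K) c • y) = c • t y :=
      fun c y => by rw [← hY, _root_.map_smul]
    let w : Y → K → V := fun y x => ρ x (t (MonoidAlgebra.single x⁻¹ (1 : k) • y))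
    have hw : ∀ (g : K) (c : k) (y : Y), w (MonoidAlgebra.single g c • y) = c • funRep ρ K g (w y) := by
      intro g c y
      ext x
      simp only [w, Pi.smul_apply, funRep_apply, smul_eq_mul]
      rw [← mul_smul, MonoidAlgebra.single_mul_single, one_mul, ← Module.End.mul_apply, ← map_mul,
        mul_inv_cancel_left, ← _root_.map_smul, ← tsmul, ← mul_smul,
        MonoidAlgebra.single_mul_single]
      simp
    refine ⟨linearOfSingle
      { toFun := fun y => e.symm (r (w y)), map_zero' := ?_, map_add' := ?_ } ?_, fun x => ?_⟩
    · have : w 0 = 0 := by ext x; simp [w]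
      simp [this]
    · intro y y'
      have : w (y + y') = w y + w y' := by ext x; simp [w]
      simp [this]
    · intro g c y
      change e.symm (r (w _)) = _ • e.symm (r (w y))
      rw [hw, _root_.map_smul, hr2 g trivial, he.symm_apply]
    · change e.symm (r (w (f x))) = q x
      have : w (f x) = fun _ => e (q x) := by
        ext y
        simp only [w]
        rw [← LinearMap.map_smul, ht', he.map_smul, one_smul, ← Module.End.mul_apply, ← map_mul]
        simp
      rw [this, hr1, e.symm_apply_apply]

end

/-- The restriction of a mean to a subgroup, as a mean for the restricted representation. -/
lemma HasMean.comp_subtype {V : Type*} [AddCommGroup V] [Module k V] {ρ : Representation k K V}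
    {L : Subgroup K} (h : HasMean ρ L) (S : Subgroup K) :
    HasMean (ρ.comp S.subtype) (L.subgroupOf S) := by
  obtain ⟨r, h1, h2⟩ := h
  -- Representatives of the right cosets `Sx` give an `S`-equivariant map `π : K → S`, along which
  -- functions on `S` are pulled back to functions on `K`.
  let rep : K → K := fun x => (Quotient.mk (QuotientGroup.rightRel S) x).out
  have hrep : ∀ x, x * (rep x)⁻¹ ∈ S := fun x => by
    rw [← QuotientGroup.rightRel_apply]
    exact Quotient.exact (Quotient.out_eq _)
  have hrep' : ∀ (s : S) x, rep (s * x) = rep x := fun s x => by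
    have : Quotient.mk (QuotientGroup.rightRel S) (s * x) = Quotient.mk _ x := by
      apply Quotient.sound
      change QuotientGroup.rightRel S _ _
      rw [QuotientGroup.rightRel_apply]
      simp
    simp only [rep, this]
  let π : K → S := fun x => ⟨x * (rep x)⁻¹, hrep x⟩
  have hπ : ∀ (s : S) x, π (s * x) = s * π x := fun s x => by
    ext
    simp [π, hrep', mul_assoc]
  refine ⟨r ∘ₗ LinearMap.funLeft k V π, fun v => ?_, fun g hg f => ?_⟩
  · exact h1 v
  · have : LinearMap.funLeft k V π (funRep (ρ.comp S.subtype) S g f) =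
        funRep ρ K (g : K) (LinearMap.funLeft k V π f) := by
      ext x
      simp [LinearMap.funLeft_apply, ← hπ]
    simp only [LinearMap.comp_apply, this]
    exact h2 _ hg _

end Injectivity

/-! ### Means for modules over group algebras -/

section ModuleCat

open CategoryTheory

variable {k : Type u} [CommRing k] {G : Type u} [Group G]

/-- The `k`-module underlying a module over the group algebra. -/
def Base (M : ModuleCat.{u} (MonoidAlgebra k G)) : Type u := M

noncomputable instance (M : ModuleCat.{u} (MonoidAlgebra k G)) : AddCommGroup (Base M) :=
  inferInstanceAs (AddCommGroup M)

noncomputable instance (M : ModuleCat.{u} (MonoidAlgebra k G)) : Module k (Base M) :=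
  Module.compHom M (algebraMap k (MonoidAlgebra k G))

/-- The identity map from a module over the group algebra to the underlying `k`-module. -/
def toBase (M : ModuleCat.{u} (MonoidAlgebra k G)) : M ≃+ Base M := AddEquiv.refl M

lemma smul_toBase (M : ModuleCat.{u} (MonoidAlgebra k G)) (c : k) (m : M) :
    c • toBase M m = toBase M (MonoidAlgebra.single (1 : G) c • m) := rfl

/-- The representation underlying a module over the group algebra. -/
noncomputable def repOf (M : ModuleCat.{u} (MonoidAlgebra k G)) :
    Representation k G (Base M) where
  toFun g :=
    { toFun := fun m => toBase M (MonoidAlgebra.single g (1 : k) • (toBase M).symm m)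
      map_add' := fun m m' => by simp
      map_smul' := fun c m => by
        obtain ⟨m, rfl⟩ := (toBase M).surjective m
        simp [smul_toBase, ← mul_smul, MonoidAlgebra.single_mul_single] }
  map_one' := by
    ext m
    change toBase M ((1 : MonoidAlgebra k G) • (toBase M).symm m) = m
    simp
  map_mul' g h := by
    ext m
    simp [← mul_smul, MonoidAlgebra.single_mul_single]

lemma realizes_repOf (M : ModuleCat.{u} (MonoidAlgebra k G)) :
    Realizes (repOf M) (toBase M) := by
  intro g c p
  have : repOf M g (toBase M p) = toBase M (MonoidAlgebra.single g (1 : k) • p) := rfl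
  rw [this, smul_toBase, ← mul_smul, MonoidAlgebra.single_mul_single, one_mul, mul_one]

lemma realizes_res (M : ModuleCat.{u} (MonoidAlgebra k G)) (K : Subgroup G) :
    Realizes (P := res K M) ((repOf M).comp K.subtype)
      (toBase M) := by
  intro g c p
  have h : (MonoidAlgebra.single g c • p : res K M) =
      (MonoidAlgebra.single (g : G) c • (show M from p) : M) := by
    change inclHom k K (MonoidAlgebra.single g c) • (show M from p) = _
    congr 1
    simp [inclHom]
  exact (congrArg _ h).trans (realizes_repOf M g c p)

lemma moduleInjective_iff {R : Type u} [Ring R] (M : ModuleCat.{u} R) :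
    Injective M ↔ Module.Injective R M :=
  (Module.injective_iff_injective_object R M).symm

lemma hasMean_of_injective_res {M : ModuleCat.{u} (MonoidAlgebra k G)} {K : Subgroup G}
    (h : Injective (res K M)) : HasMean (repOf M) K := by
  obtain ⟨r, h1, h2⟩ := exists_mean_of_injective (realizes_res M K)
    ((moduleInjective_iff _).1 h) G
  exact ⟨r, h1, fun g hg f => h2 ⟨g, hg⟩ f⟩

lemma injective_base_of_injective_res {M : ModuleCat.{u} (MonoidAlgebra k G)} {K : Subgroup G}
    (h : Injective (res K M)) :
    Module.Injective k (Base M) :=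
  injective_base_of_injective (realizes_res M K) ((moduleInjective_iff _).1 h)

lemma injective_of_hasMean_repOf {M : ModuleCat.{u} (MonoidAlgebra k G)}
    (hk : Module.Injective k (Base M))
    (h : HasMean (repOf M) ⊤) : Injective M :=
  (moduleInjective_iff _).2 (injective_of_hasMean (realizes_repOf M) hk h)

/-- Restriction in stages. -/
lemma injective_res_res {M : ModuleCat.{u} (MonoidAlgebra k G)} {K S : Subgroup G}
    (h : Injective (res K M)) : Injective (res (K.subgroupOf S) (res S M)) := by
  have h1 := ((hasMean_of_injective_res h).mono (inf_le_left : K ⊓ S ≤ K)).comp_subtype S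
  rw [Subgroup.inf_subgroupOf_right] at h1
  have hk := injective_base_of_injective_res h
  have h2 : Realizes (P := res (K.subgroupOf S) (res S M))
      (((repOf M).comp S.subtype).comp (K.subgroupOf S).subtype)
      (toBase M) := by
    intro g c p
    have h : (MonoidAlgebra.single g c • p : res (K.subgroupOf S) (res S M)) =
        (MonoidAlgebra.single (g : S) c • (show res S M from p) : res S M) := by
      change inclHom k (K.subgroupOf S) (MonoidAlgebra.single g c) • (show res S M from p) = _
      congr 1
      simp [inclHom]
    exact (congrArg _ h).trans (realizes_res M S g c p)
  refine (moduleInjective_iff _).2 (injective_of_hasMean h2 hk ?_)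
  have := h1.comp_subtype (K.subgroupOf S)
  rwa [Subgroup.subgroupOf_self] at this

end ModuleCat

/-! ### The augmented chain complex of tuples -/

section Chains

variable {E F : Type*}

/-- Formal combinations of the tuples of elements of a set. -/
abbrev Chains (E : Type*) : Type _ := List E →₀ ℤ

lemma chains_hom_ext {B : Type*} [AddCommGroup B] {f g : Chains E →ₗ[ℤ] B}
    (h : ∀ l, f (Finsupp.single l 1) = g (Finsupp.single l 1)) : f = g :=
  Finsupp.lhom_ext' fun l => LinearMap.ext_ring (h l)

/-- The linear map on chains with given values on tuples. -/
noncomputable def chainLift {B : Type*} [AddCommGroup B] (f : List E → B) : Chains E →ₗ[ℤ] B :=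
  Finsupp.linearCombination ℤ f

@[simp]
lemma chainLift_single {B : Type*} [AddCommGroup B] (f : List E → B) (l : List E) :
    chainLift f (Finsupp.single l 1) = f l := by
  simp [chainLift]

/-- Prepending a vertex to all tuples of a chain. -/
noncomputable def cone (y : E) : Chains E →ₗ[ℤ] Chains E := Finsupp.lmapDomain ℤ ℤ (List.cons y)

@[simp]
lemma cone_single (y : E) (l : List E) (c : ℤ) :
    cone y (Finsupp.single l c) = Finsupp.single (y :: l) c := by
  simp [cone]

/-- The boundary of a tuple. -/
noncomputable def bdTuple : List E → Chains E
  | [] => 0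
  | y :: l => Finsupp.single l 1 - cone y (bdTuple l)

/-- The boundary map of the augmented complex of tuples. -/
noncomputable def bd : Chains E →ₗ[ℤ] Chains E := chainLift bdTuple

@[simp]
lemma bd_nil : bd (Finsupp.single ([] : List E) 1) = 0 := by simp [bd, bdTuple]

@[simp]
-- Coning with any vertex is a contracting homotopy. The empty tuple carries the augmentation, so
-- tuples of length `n + 1` sit in degree `n`.
lemma bd_cone (y : E) (z : Chains E) : bd (cone y z) = z - cone y (bd z) := by
  suffices bd ∘ₗ cone y = LinearMap.id - cone y ∘ₗ bd from LinearMap.congr_fun this z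
  refine chains_hom_ext fun l => ?_
  simp [bd, bdTuple]

lemma bd_cons (y : E) (l : List E) : bd (Finsupp.single (y :: l) 1) =
    Finsupp.single l 1 - cone y (bd (Finsupp.single l 1)) := by
  rw [← bd_cone, cone_single]

@[simp]
lemma bd_bd (z : Chains E) : bd (bd z) = 0 := by
  suffices bd ∘ₗ bd = (0 : Chains E →ₗ[ℤ] Chains E) from LinearMap.congr_fun this z
  refine chains_hom_ext fun l => ?_
  induction l with
  | nil => simp
  | cons y l ih =>
    simp only [LinearMap.comp_apply, LinearMap.zero_apply] at ih ⊢
    rw [bd_cons, map_sub, bd_cone, ih]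
    simp

/-- The map on chains induced by a map of vertices. -/
noncomputable def mapChains (f : E → F) : Chains E →ₗ[ℤ] Chains F :=
  Finsupp.lmapDomain ℤ ℤ (List.map f)

@[simp]
lemma mapChains_single (f : E → F) (l : List E) (c : ℤ) :
    mapChains f (Finsupp.single l c) = Finsupp.single (l.map f) c := by
  simp [mapChains]

@[simp]
lemma mapChains_cone (f : E → F) (y : E) (z : Chains E) :
    mapChains f (cone y z) = cone (f y) (mapChains f z) := by
  suffices mapChains f ∘ₗ cone y = cone (f y) ∘ₗ mapChains f from LinearMap.congr_fun this z
  exact chains_hom_ext fun l => by simp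

lemma bd_mapChains (f : E → F) (z : Chains E) : bd (mapChains f z) = mapChains f (bd z) := by
  suffices bd ∘ₗ mapChains f = mapChains f ∘ₗ bd from LinearMap.congr_fun this z
  refine chains_hom_ext fun l => ?_
  induction l with
  | nil => simp
  | cons y l ih =>
    simp only [LinearMap.comp_apply, mapChains_single] at ih ⊢
    rw [List.map_cons, bd_cons, bd_cons, ih, map_sub, mapChains_cone, mapChains_single]

/-- The chains all of whose tuples satisfy a predicate. -/
def chainsOf (p : List E → Prop) : Submodule ℤ (Chains E) := Finsupp.supported ℤ ℤ {l | p l}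

lemma single_mem_chainsOf {p : List E → Prop} {l : List E} (h : p l) (c : ℤ) :
    Finsupp.single l c ∈ chainsOf p :=
  Finsupp.single_mem_supported ℤ c h

lemma chainsOf_mono {p q : List E → Prop} (h : ∀ l, p l → q l) : chainsOf p ≤ chainsOf q :=
  Finsupp.supported_mono h

lemma chainsOf_le {p : List E → Prop} {S : Submodule ℤ (Chains E)}
    (h : ∀ l, p l → Finsupp.single l 1 ∈ S) : chainsOf p ≤ S := by
  rw [chainsOf, Finsupp.supported_eq_span_single, Submodule.span_le]
  rintro _ ⟨l, hl, rfl⟩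
  exact h l hl

lemma map_mem_of_mem_chainsOf {B : Type*} [AddCommGroup B] {p : List E → Prop}
    {S : Submodule ℤ B} (f : Chains E →ₗ[ℤ] B) (h : ∀ l, p l → f (Finsupp.single l 1) ∈ S)
    {z : Chains E} (hz : z ∈ chainsOf p) : f z ∈ S :=
  chainsOf_le (S := S.comap f) h hz

lemma eq_of_mem_chainsOf {B : Type*} [AddCommGroup B] {p : List E → Prop}
    {f g : Chains E →ₗ[ℤ] B} (h : ∀ l, p l → f (Finsupp.single l 1) = g (Finsupp.single l 1))
    {z : Chains E} (hz : z ∈ chainsOf p) : f z = g z :=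
  chainsOf_le (S := LinearMap.eqLocus f g) h hz

lemma bd_single_mem (l : List E) :
    bd (Finsupp.single l 1) ∈ chainsOf fun l' => l'.Sublist l ∧ l'.length + 1 = l.length := by
  induction l with
  | nil => simp
  | cons y l ih =>
    rw [bd_cons]
    refine sub_mem (single_mem_chainsOf (by simp) _) ?_
    refine map_mem_of_mem_chainsOf (cone y) (fun l' hl' => ?_) ih
    rw [cone_single]
    exact single_mem_chainsOf ⟨hl'.1.cons_cons y, by simpa using hl'.2⟩ _

end Chains

/-! ### Equivariant cochains -/

section Cochains

variable {k : Type u} [CommRing k] {G : Type u} [Group G] {N V W : Type u}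
  [AddCommGroup N] [Module k N] [AddCommGroup V] [Module k V] [AddCommGroup W] [Module k W]
  {E : Type*} [MulAction G E]

/-- Equivariance of a cochain with coefficients in the linear maps between two
representations. -/
def IsEquivariant (ρN : Representation k G N) (ρ : Representation k G V)
    (f : Chains E →ₗ[ℤ] (N →ₗ[k] V)) : Prop :=
  ∀ (g : G) (z : Chains E) (n : N), f (mapChains (g • ·) z) (ρN g n) = ρ g (f z n)

lemma isEquivariant_of_single {ρN : Representation k G N} {ρ : Representation k G V}
    {f : Chains E →ₗ[ℤ] (N →ₗ[k] V)}
    (h : ∀ (g : G) (l : List E) (n : N), f (Finsupp.single (l.map (g • ·)) 1) (ρN g n) =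
      ρ g (f (Finsupp.single l 1) n)) : IsEquivariant ρN ρ f := by
  intro g z n
  induction z using Finsupp.induction_linear with
  | zero => simp
  | add x y hx hy => simp only [map_add, LinearMap.add_apply, hx, hy]
  | single l c =>
    have h1 : (Finsupp.single l c : Chains E) = c • Finsupp.single l 1 := by simp
    rw [h1]
    simp only [map_smul, LinearMap.smul_apply, mapChains_single, h]
    rw [map_zsmul]

lemma IsEquivariant.sub {ρN : Representation k G N} {ρ : Representation k G V}
    {f f' : Chains E →ₗ[ℤ] (N →ₗ[k] V)} (hf : IsEquivariant ρN ρ f)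
    (hf' : IsEquivariant ρN ρ f') : IsEquivariant ρN ρ (f - f') := fun g z n => by
  simp only [LinearMap.sub_apply, hf g, hf' g, map_sub]

lemma IsEquivariant.comp_bd {ρN : Representation k G N} {ρ : Representation k G V}
    {f : Chains E →ₗ[ℤ] (N →ₗ[k] V)} (hf : IsEquivariant ρN ρ f) :
    IsEquivariant ρN ρ (f ∘ₗ bd) := fun g z n => by
  simp only [LinearMap.comp_apply, bd_mapChains, hf g]

/-- Composition of a cochain with a linear map of the coefficients. -/
noncomputable def pushCochain {E : Type*} (p : V →ₗ[k] W) (f : Chains E →ₗ[ℤ] (N →ₗ[k] V)) :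
    Chains E →ₗ[ℤ] (N →ₗ[k] W) where
  toFun z := p ∘ₗ f z
  map_add' := by intros; ext; simp
  map_smul' := by intros; ext; simp

@[simp]
lemma pushCochain_apply {E : Type*} (p : V →ₗ[k] W) (f : Chains E →ₗ[ℤ] (N →ₗ[k] V))
    (z : Chains E) (n : N) : pushCochain p f z n = p (f z n) := rfl

lemma IsEquivariant.push {ρN : Representation k G N} {ρ : Representation k G V}
    {τ : Representation k G W} {f : Chains E →ₗ[ℤ] (N →ₗ[k] V)} (hf : IsEquivariant ρN ρ f)
    {p : V →ₗ[k] W} (hp : ∀ g v, p (ρ g v) = τ g (p v)) :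
    IsEquivariant ρN τ (pushCochain p f) := fun g z n => by
  rw [pushCochain_apply, pushCochain_apply, hf, hp]

lemma mapChains_smul_cone (g : G) (x : E) (z : Chains E) :
    mapChains (g • ·) (cone x z) = cone (g • x) (mapChains (g • ·) z) := mapChains_cone _ _ _

/-- Cocycles with coefficients in a representation with a mean are coboundaries. -/
lemma exists_coboundary_of_mean {ρN : Representation k G N} {ρ : Representation k G V}
    {F : Chains E →ₗ[ℤ] (N →ₗ[k] V)} (hF : IsEquivariant ρN ρ F) (hbd : ∀ z, F (bd z) = 0)
    (r : (E → V) →ₗ[k] V) (hr1 : ∀ v, r (fun _ => v) = v)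
    (hr2 : ∀ g f, r (funRep ρ E g f) = ρ g (r f)) :
    ∃ D : Chains E →ₗ[ℤ] (N →ₗ[k] V), IsEquivariant ρN ρ D ∧ (∀ z, F z = D (bd z)) ∧
      ∀ z n, D z n = r fun x => F (cone x z) n := by
  -- A cocycle satisfies `F z = F (cone x (bd z))` for every `x`. No single `x` is an equivariant
  -- choice, so the mean over all `x` is taken.
  let D : Chains E →ₗ[ℤ] (N →ₗ[k] V) :=
    { toFun := fun z => r ∘ₗ LinearMap.pi fun x => F (cone x z)
      map_add' := by
        intro z w
        refine LinearMap.ext fun n => ?_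
        change r (fun x => F (cone x (z + w)) n) =
          r (fun x => F (cone x z) n) + r (fun x => F (cone x w) n)
        rw [← map_add]
        congr 1
        ext x
        simp
      map_smul' := by
        intro c z
        refine LinearMap.ext fun n => ?_
        change r (fun x => F (cone x (c • z)) n) = c • r (fun x => F (cone x z) n)
        rw [← map_zsmul]
        congr 1
        ext x
        simp }
  have hD : ∀ z n, D z n = r fun x => F (cone x z) n := fun _ _ => rfl
  refine ⟨D, fun g z n => ?_, fun z => ?_, hD⟩
  · rw [hD, hD, ← hr2]
    congr 1
    ext x
    rw [funRep_apply, ← hF, mapChains_smul_cone, smul_inv_smul]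
  · ext n
    rw [hD]
    have : (fun x => F (cone x (bd z)) n) = fun _ => F z n := by
      ext x
      have := hbd (cone x z)
      rw [bd_cone, map_sub, sub_eq_zero] at this
      rw [this]
    rw [this, hr1]

/-- Cochains with coefficients in the cosyzygy lift equivariantly to cochains with coefficients
in the functions `G → V`. -/
lemma exists_lift_cochain {ρN : Representation k G N} {ρ : Representation k G V}
    (hE : ∀ x : E, HasMean ρ (MulAction.stabilizer G x))
    {f : Chains E →ₗ[ℤ] (N →ₗ[k] Cosyzygy k G V)} (hf : IsEquivariant ρN (cosyzygyRep ρ) f)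
    (h0 : f (Finsupp.single [] 1) = 0) :
    ∃ F : Chains E →ₗ[ℤ] (N →ₗ[k] (G → V)), IsEquivariant ρN (funRep ρ G) F ∧
      (∀ z, (constFun k G V).mkQ ∘ₗ F z = f z) ∧
      ∀ l, f (Finsupp.single l 1) = 0 → F (Finsupp.single l 1) = 0 := by
  classical
  choose σ hσ1 hσ2 using fun x : E => (hE x).hasSection
  let rep : E → E := fun x => (Quotient.mk (MulAction.orbitRel G E) x).out
  have hrep : ∀ x, ∃ g : G, g • rep x = x := fun x => by
    have h : MulAction.orbitRel G E (rep x) x := Quotient.exact (Quotient.out_eq _)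
    exact (MulAction.orbitRel G E).iseqv.symm h
  have hrep' : ∀ (g : G) x, rep (g • x) = rep x := fun g x => by
    have : Quotient.mk (MulAction.orbitRel G E) (g • x) = Quotient.mk _ x :=
      Quotient.sound ⟨g, rfl⟩
    simp only [rep, this]
  choose a ha using hrep
  -- The section at the orbit representative is transported to `x`. Its equivariance under the
  -- stabilizer makes the result independent of the choice of `a x`, whence `hs2`.
  let s : E → Cosyzygy k G V →ₗ[k] (G → V) := fun x =>
    funRep ρ G (a x) ∘ₗ σ (rep x) ∘ₗ cosyzygyRep ρ (a x)⁻¹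
  have hs : ∀ x w, s x w = funRep ρ G (a x) (σ (rep x) (cosyzygyRep ρ (a x)⁻¹ w)) :=
    fun _ _ => rfl
  have hs1 : ∀ x w, (constFun k G V).mkQ (s x w) = w := fun x w => by
    rw [hs, ← cosyzygyRep_mk, hσ1, ← Module.End.mul_apply, ← map_mul]
    simp
  have hs2 : ∀ (g : G) x w, s (g • x) (cosyzygyRep ρ g w) = funRep ρ G g (s x w) := by
    intro g x w
    obtain ⟨t, ht⟩ : ∃ t, t = (a x)⁻¹ * g⁻¹ * a (g • x) := ⟨_, rfl⟩
    have htm : t ∈ MulAction.stabilizer G (rep x) := by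
      rw [MulAction.mem_stabilizer_iff, ht, mul_smul, mul_smul, inv_smul_eq_iff, inv_smul_eq_iff,
        ha x]
      conv_lhs => rw [← hrep' g x, ha]
    have hag : a (g • x) = g * a x * t := by rw [ht]; group
    have h1 := hσ2 (rep x) t htm (cosyzygyRep ρ t⁻¹ (cosyzygyRep ρ (a x)⁻¹ w))
    rw [← Module.End.mul_apply (cosyzygyRep ρ t), ← map_mul, mul_inv_cancel, map_one,
      Module.End.one_apply] at h1
    rw [hs, hs, hrep', hag, h1, map_mul, map_mul, Module.End.mul_apply, Module.End.mul_apply]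
    congr 4
    simp only [← Module.End.mul_apply, ← map_mul]
    congr 2
    group
  -- A tuple is lifted with the section at its first vertex. The empty tuple has no vertex, which is
  -- why `f` must vanish on it.
  let F : Chains E →ₗ[ℤ] (N →ₗ[k] (G → V)) := chainLift fun
    | [] => 0
    | x :: l => s x ∘ₗ f (Finsupp.single (x :: l) 1)
  have hF0 : F (Finsupp.single [] 1) = 0 := by simp [F]
  have hF : ∀ x l, F (Finsupp.single (x :: l) 1) = s x ∘ₗ f (Finsupp.single (x :: l) 1) := by
    simp [F]
  refine ⟨F, isEquivariant_of_single fun g l n => ?_, fun z => ?_, fun l hl => ?_⟩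
  · cases l with
    | nil => simp [hF0]
    | cons x l =>
      rw [List.map_cons, hF, hF]
      change s (g • x) _ = funRep ρ G g (s x _)
      rw [← hs2, ← hf, mapChains_single, List.map_cons]
  · suffices pushCochain (constFun k G V).mkQ F = f from LinearMap.congr_fun this z
    refine chains_hom_ext fun l => LinearMap.ext fun n => ?_
    cases l with
    | nil => rw [pushCochain_apply, hF0, h0]; simp
    | cons x l => rw [pushCochain_apply, hF, LinearMap.comp_apply, hs1]
  · cases l with
    | nil => exact hF0
    | cons x l => rw [hF, hl, LinearMap.comp_zero]

/-- The equivariant cocycles on the tuples of elements of `E` that vanish on tuples of length at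
most `n` become coboundaries on the tuples of elements of `G`. -/
def CocyclesBound (φ : Chains G →ₗ[ℤ] Chains E) (n : ℕ) (ρ : Representation k G V) : Prop :=
  ∀ (N : Type u) [AddCommGroup N] [Module k N] (ρN : Representation k G N)
    (f : Chains E →ₗ[ℤ] (N →ₗ[k] V)), IsEquivariant ρN ρ f → (∀ z, f (bd z) = 0) →
    (∀ l, l.length ≤ n → f (Finsupp.single l 1) = 0) →
    ∃ g : Chains G →ₗ[ℤ] (N →ₗ[k] V), IsEquivariant ρN ρ g ∧ ∀ z, f (φ z) = g (bd z)

/-- The connecting homomorphism of `0 → V → (G → V) → Cosyzygy → 0`. A lift `F` of `f` has its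
coboundary in the constants, which gives a cocycle `e` in `V` one degree higher. If `e ∘ φ = g ∘
bd`, then `F ∘ φ` minus the constants `g` is a cocycle with values in `G → V`, hence a coboundary.
-/
lemma CocyclesBound.lift {φ : Chains G →ₗ[ℤ] Chains E} (hφ1 : ∀ z, bd (φ z) = φ (bd z))
    (hφ2 : ∀ (g : G) z, φ (mapChains (g • ·) z) = mapChains (g • ·) (φ z))
    {ρ : Representation k G V} (hE : ∀ x : E, HasMean ρ (MulAction.stabilizer G x)) {n : ℕ}
    (h : CocyclesBound φ (n + 1) ρ) {ρN : Representation k G N}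
    {f : Chains E →ₗ[ℤ] (N →ₗ[k] Cosyzygy k G V)} (hf : IsEquivariant ρN (cosyzygyRep ρ) f)
    (hbd : ∀ z, f (bd z) = 0) (h0 : ∀ l, l.length ≤ n → f (Finsupp.single l 1) = 0) :
    ∃ D : Chains G →ₗ[ℤ] (N →ₗ[k] (G → V)), IsEquivariant ρN (funRep ρ G) D ∧
      ∀ z, (constFun k G V).mkQ ∘ₗ D (bd z) = f (φ z) := by
  obtain ⟨F, hF1, hF2, hF3⟩ := exists_lift_cochain hE hf (h0 [] (Nat.zero_le n))
  let c : V →ₗ[k] (G → V) := LinearMap.pi fun _ => LinearMap.id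
  have hc : ∀ v, c v = fun _ => v := fun v => rfl
  have hmc : ∀ v, (constFun k G V).mkQ (c v) = 0 := fun v =>
    (Submodule.Quotient.mk_eq_zero _).2 ⟨v, rfl⟩
  let e : Chains E →ₗ[ℤ] (N →ₗ[k] V) := pushCochain (LinearMap.proj 1) (F ∘ₗ bd)
  have he : ∀ z m, c (e z m) = F (bd z) m := by
    intro z m
    have h1 : (constFun k G V).mkQ (F (bd z) m) = 0 := by
      rw [← LinearMap.comp_apply, hF2, hbd, LinearMap.zero_apply]
    obtain ⟨v, hv⟩ := (Submodule.Quotient.mk_eq_zero _).1 h1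
    have h2 : e z m = F (bd z) m 1 := rfl
    have h3 : F (bd z) m = fun _ => v := hv.symm
    rw [h2, h3]
    rfl
  have hcinj : Function.Injective c := fun v w hvw => congrFun hvw 1
  obtain ⟨g, hg1, hg2⟩ := h N ρN e (fun g z m => hcinj (by
      rw [he, bd_mapChains, hF1, ← he]
      rfl)) (fun z => LinearMap.ext fun m => hcinj (by rw [he]; simp))
    -- Faces are one entry shorter, so `e` vanishes on tuples one longer than `f` does.
    (fun l hl => LinearMap.ext fun m => hcinj (by
      rw [he]
      have : F (bd (Finsupp.single l 1)) ∈ (⊥ : Submodule ℤ _) := by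
        refine map_mem_of_mem_chainsOf F (fun l' hl' => ?_) (bd_single_mem l)
        rw [hF3 l' (h0 l' (by lia))]
        exact zero_mem _
      rw [Submodule.mem_bot] at this
      rw [this]
      simp))
  let P : Chains G →ₗ[ℤ] (N →ₗ[k] (G → V)) := F ∘ₗ φ - pushCochain c g
  have hP : ∀ z m, P z m = F (φ z) m - c (g z m) := fun _ _ => rfl
  obtain ⟨r, hr1, hr2⟩ := hasMean_funRep ρ
  obtain ⟨D, hD1, hD2, -⟩ := exists_coboundary_of_mean (F := P) (ρN := ρN) (ρ := funRep ρ G)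
    (fun a z m => by
      rw [hP, hP, hφ2, hF1, hg1, map_sub]
      rfl)
    (fun z => LinearMap.ext fun m => by
      rw [hP, ← hφ1, ← he, hg2, sub_self]
      rfl) r hr1 (fun a => hr2 a trivial)
  refine ⟨D, hD1, fun z => LinearMap.ext fun m => ?_⟩
  rw [← hD2, LinearMap.comp_apply, hP, map_sub, hmc, sub_zero, ← LinearMap.comp_apply, hF2]

/-- A representation has a mean if it has means over a subgroup of finite index and over the
stabilizers, and if all cocycles in high degrees are coboundaries. -/
theorem hasMean_of_cocyclesBound {φ : Chains G →ₗ[ℤ] Chains E} (hφ1 : ∀ z, bd (φ z) = φ (bd z))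
    (hφ2 : ∀ (g : G) z, φ (mapChains (g • ·) z) = mapChains (g • ·) (φ z))
    (hφ3 : φ (Finsupp.single [] 1) = Finsupp.single [] 1) (H : Subgroup G) [H.FiniteIndex]
    (n : ℕ) : ∀ {V : Type u} [AddCommGroup V] [Module k V] (ρ : Representation k G V),
      HasMean ρ H → (∀ x : E, HasMean ρ (MulAction.stabilizer G x)) →
      CocyclesBound φ (n + 1) ρ → HasMean ρ ⊤ := by
  induction n with
  | zero =>
    intro V _ _ ρ _ hE h
    classical
    -- The universal class: the identity of the cosyzygy placed on the empty tuple. Lifting its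
    -- coboundary gives a `D` whose value on the empty tuple, the boundary of `[1]`, is an
    -- equivariant section.
    let η : Chains E →ₗ[ℤ] (Cosyzygy k G V →ₗ[k] Cosyzygy k G V) :=
      chainLift fun l => if l = [] then LinearMap.id else 0
    have hη : IsEquivariant (cosyzygyRep ρ) (cosyzygyRep ρ) η :=
      isEquivariant_of_single fun g l n => by
        by_cases hl : l = [] <;> simp [η, hl]
    obtain ⟨D, hD1, hD2⟩ := h.lift hφ1 hφ2 hE (ρN := cosyzygyRep ρ) (f := η ∘ₗ bd)
      hη.comp_bd
      (fun z => by simp)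
      (fun l hl => by
        rw [Nat.le_zero, List.length_eq_zero_iff] at hl
        simp [hl])
    refine HasSection.hasMean ⟨D (Finsupp.single [] 1), fun w => ?_, fun g _ w => ?_⟩
    · have h1 := LinearMap.congr_fun (hD2 (Finsupp.single [1] 1)) w
      have h2 : bd (Finsupp.single [(1 : G)] 1) = Finsupp.single [] 1 := by simp [bd_cons]
      rw [LinearMap.comp_apply, LinearMap.comp_apply, hφ1, h2, hφ3] at h1
      rw [h1]
      simp [η]
    · have := hD1 g (Finsupp.single [] 1) w
      rwa [mapChains_single, List.map_nil] at this
  | succ n ih =>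
    intro V _ _ ρ hH hE h
    refine HasMean.of_cosyzygy H hH (ih _ hH.cosyzygy (fun x => (hE x).cosyzygy) ?_)
    intro N _ _ ρN f hf hbd h0
    obtain ⟨D, hD1, hD2⟩ := h.lift hφ1 hφ2 hE hf hbd h0
    exact ⟨pushCochain (constFun k G V).mkQ D, hD1.push fun g v => rfl, fun z => (hD2 z).symm⟩

end Cochains

/-! ### Continuous filtrations by subgroups -/

section Filtration

variable {k : Type u} [CommRing k] {G : Type u} [Group G] {N V : Type u}
  [AddCommGroup N] [Module k N] [AddCommGroup V] [Module k V]

lemma HasMean.of_comp_subtype {ρ : Representation k G V} {S : Subgroup G}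
    (h : HasMean (ρ.comp S.subtype) ⊤) : HasMean ρ S := by
  obtain ⟨r, h1, h2⟩ := h
  refine ⟨r ∘ₗ LinearMap.funLeft k V S.subtype, fun v => h1 v, fun g hg f => ?_⟩
  exact h2 ⟨g, hg⟩ trivial (LinearMap.funLeft k V S.subtype f)

/-- All vertices of the tuple lie in a single left coset of `T`. -/
def Near (T : Subgroup G) (l : List G) : Prop := ∀ x ∈ l, ∀ y ∈ l, x⁻¹ * y ∈ T

lemma Near.sublist {T : Subgroup G} {l l' : List G} (h : Near T l) (hl : l'.Sublist l) :
    Near T l' := fun x hx y hy => h x (hl.subset hx) y (hl.subset hy)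

lemma Near.mono {T T' : Subgroup G} {l : List G} (h : Near T l) (hT : T ≤ T') : Near T' l :=
  fun x hx y hy => hT (h x hx y hy)

lemma near_map {T : Subgroup G} {l : List G} (g : G) : Near T (l.map (g • ·)) ↔ Near T l := by
  simp [Near, mul_assoc]

lemma near_top (l : List G) : Near ⊤ l := fun _ _ _ _ => trivial

lemma cochain_bd_eq {B : Type*} [AddCommGroup B] {T : Subgroup G} {f g : Chains G →ₗ[ℤ] B}
    (h : ∀ l, Near T l → f (Finsupp.single l 1) = g (Finsupp.single l 1)) {l : List G}
    (hl : Near T l) : f (bd (Finsupp.single l 1)) = g (bd (Finsupp.single l 1)) :=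
  eq_of_mem_chainsOf (fun l' hl' => h l' (hl.sublist hl'.1)) (bd_single_mem l)

/-- A cochain that is a cocycle on the tuples in the cosets of a subgroup with a mean is a
coboundary on these tuples. -/
lemma exists_coboundary_near {ρN : Representation k G N} {ρ : Representation k G V}
    {T : Subgroup G} (hT : HasMean ρ T) {F : Chains G →ₗ[ℤ] (N →ₗ[k] V)}
    (hF : IsEquivariant ρN ρ F) (hbd : ∀ l, Near T l → F (bd (Finsupp.single l 1)) = 0) (m : ℕ)
    (h0 : ∀ l, l.length ≤ m + 1 → F (Finsupp.single l 1) = 0) :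
    ∃ D : Chains G →ₗ[ℤ] (N →ₗ[k] V), IsEquivariant ρN ρ D ∧
      (∀ l, Near T l → F (Finsupp.single l 1) = D (bd (Finsupp.single l 1))) ∧
      ∀ l, l.length ≤ m → D (Finsupp.single l 1) = 0 := by
  have hT' := hT.comp_subtype T
  rw [Subgroup.subgroupOf_self] at hT'
  obtain ⟨r, hr1, hr2⟩ := hT'
  -- `M x` averages a function over the coset `xT`, by transport of the mean of `T`. It depends only
  -- on that coset (`hMt`).
  let M : G → (G → V) →ₗ[k] V := fun x =>
    ρ x ∘ₗ r ∘ₗ LinearMap.pi fun t : T => ρ x⁻¹ ∘ₗ LinearMap.proj (x * t)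
  have hM : ∀ x h, M x h = ρ x (r fun t => ρ x⁻¹ (h (x * t))) := fun _ _ => rfl
  have hMc : ∀ x h v, (∀ t ∈ T, h (x * t) = v) → M x h = v := by
    intro x h v hv
    have : (fun t : T => ρ x⁻¹ (h (x * t))) = fun _ => ρ x⁻¹ v := by
      ext t
      rw [hv t t.2]
    rw [hM, this, hr1, ← Module.End.mul_apply, ← map_mul]
    simp
  have hMg : ∀ g x h, M (g * x) (funRep ρ G g h) = ρ g (M x h) := by
    intro g x h
    rw [hM, hM, map_mul, Module.End.mul_apply]
    congr 3
    ext t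
    rw [funRep_apply, ← Module.End.mul_apply, ← map_mul]
    simp [mul_assoc]
  have hMt : ∀ x, ∀ t ∈ T, M (x * t) = M x := by
    intro x t ht
    refine LinearMap.ext fun h => ?_
    have h1 := hr2 ⟨t, ht⟩ trivial fun s => ρ (x * t)⁻¹ (h (x * t * s))
    rw [hM, hM, map_mul, Module.End.mul_apply]
    congr 1
    refine (Eq.trans ?_ h1).symm
    congr 1
    ext s
    change _ = ρ t (ρ (x * t)⁻¹ _)
    rw [← Module.End.mul_apply, ← map_mul]
    simp [mul_assoc]
  let P : Chains G → N →ₗ[k] (G → V) := fun z => LinearMap.pi fun y => F (cone y z)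
  have hP : ∀ z n y, P z n y = F (cone y z) n := fun _ _ _ => rfl
  let D : Chains G →ₗ[ℤ] (N →ₗ[k] V) := chainLift fun
    | [] => 0
    | x :: l => M x ∘ₗ P (Finsupp.single (x :: l) 1)
  have hD0 : D (Finsupp.single [] 1) = 0 := by simp [D]
  have hD : ∀ x l, D (Finsupp.single (x :: l) 1) = M x ∘ₗ P (Finsupp.single (x :: l) 1) := by
    simp [D]
  refine ⟨D, isEquivariant_of_single fun g l n => ?_, fun l hl => ?_, fun l hl => ?_⟩
  · cases l with
    | nil => simp [hD0]
    | cons x l =>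
      rw [List.map_cons, hD, hD]
      change M (g * x) _ = ρ g (M x _)
      rw [← hMg]
      congr 1
      ext y
      rw [hP, funRep_apply, hP, ← hF, mapChains_smul_cone, mapChains_single, smul_inv_smul,
        List.map_cons]
  · cases l with
    | nil => rw [bd_nil, map_zero, h0 [] (by simp)]
    | cons x l =>
      -- The first vertices of the nonempty faces of a near tuple lie in one coset, so `M x` can be
      -- kept fixed and the coning argument applies. On an empty face both sides vanish, as `F` is
      -- zero on tuples of length one.
      let Q : Chains G →ₗ[ℤ] (N →ₗ[k] V) :=
        { toFun := fun z => M x ∘ₗ P z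
          map_add' := fun z w => LinearMap.ext fun n => by
            have : P (z + w) n = P z n + P w n := by ext y; simp [hP]
            simp [this]
          map_smul' := fun c z => LinearMap.ext fun n => by
            have : P (c • z) n = c • P z n := by
              ext y
              simp only [hP, map_smul, Pi.smul_apply, LinearMap.smul_apply]
            simp only [LinearMap.comp_apply, this, map_zsmul]
            rfl }
      have hQ : ∀ z n, Q z n = M x (P z n) := fun _ _ => rfl
      have hDQ : D (bd (Finsupp.single (x :: l) 1)) = Q (bd (Finsupp.single (x :: l) 1)) := by
        refine eq_of_mem_chainsOf (fun l' hl' => ?_) (bd_single_mem (x :: l))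
        cases l' with
        | nil =>
          rw [hD0]
          refine LinearMap.ext fun n => ?_
          have : P (Finsupp.single [] 1) n = 0 := by
            ext y
            rw [hP, cone_single, h0 _ (by simp)]
            simp
          rw [hQ, this, map_zero, LinearMap.zero_apply]
        | cons y l' =>
          rw [hD]
          refine LinearMap.ext fun n => ?_
          have hy : x⁻¹ * y ∈ T := hl x (by simp) y (hl'.1.subset (by simp))
          rw [hQ, LinearMap.comp_apply, ← hMt x _ hy, mul_inv_cancel_left]
      rw [hDQ]
      refine LinearMap.ext fun n => ?_
      rw [hQ, hMc]
      intro t ht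
      have hnear : Near T (x * t :: x :: l) := by
        have h1 : ∀ y ∈ x :: l, x⁻¹ * y ∈ T := hl x (by simp)
        have h2 : ∀ y ∈ x * t :: x :: l, x⁻¹ * y ∈ T := by
          intro y hy
          rcases List.mem_cons.1 hy with rfl | hy
          · simpa using ht
          · exact h1 y hy
        intro y hy z hz
        have := T.mul_mem (T.inv_mem (h2 y hy)) (h2 z hz)
        simpa using this
      have h3 := hbd _ hnear
      rw [bd_cons, map_sub, sub_eq_zero] at h3
      rw [hP, ← h3]
  · cases l with
    | nil => exact hD0
    | cons x l =>
      rw [hD]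
      refine LinearMap.ext fun n => ?_
      have : P (Finsupp.single (x :: l) 1) n = 0 := by
        ext y
        rw [hP, cone_single, h0 _ (by simpa using hl)]
        simp
      rw [LinearMap.comp_apply, this, map_zero, LinearMap.zero_apply]

/-- Vanishing of the cohomology in degrees at least two passes to the union of a continuous chain
of subgroups with means. -/
lemma cocyclesBound_of_filtration (ρ : Representation k G V) {I : Type u} [LinearOrder I]
    [WellFoundedLT I] (ι : I → G) (hι : Subgroup.closure (Set.range ι) = ⊤)
    (hI : ∀ i, HasMean ρ (Subgroup.closure (ι '' Set.Iic i))) :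
    CocyclesBound (LinearMap.id : Chains G →ₗ[ℤ] Chains G) 2 ρ := by
  classical
  intro N _ _ ρN f hf hbd h0
  let T : Set I → Subgroup G := fun L => Subgroup.closure (ι '' L)
  have hTmono : ∀ {L L'}, L ⊆ L' → T L ≤ T L' := fun h =>
    Subgroup.closure_mono (Set.image_mono h)
  -- Partial solutions: `f` is bounded on tuples lying in a coset of `T p.1`. Vanishing on tuples of
  -- length at most one is imposed so that differences of solutions can themselves be bounded.
  let S := {p : Set I × (Chains G →ₗ[ℤ] (N →ₗ[k] V)) // IsLowerSet p.1 ∧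
    IsEquivariant ρN ρ p.2 ∧
    (∀ l, Near (T p.1) l → f (Finsupp.single l 1) = p.2 (bd (Finsupp.single l 1))) ∧
    ∀ l, l.length ≤ 1 → p.2 (Finsupp.single l 1) = 0}
  let R : S → S → Prop := fun p q => p.1.1 ⊆ q.1.1 ∧
    ∀ l, Near (T p.1.1) l → p.1.2 (Finsupp.single l 1) = q.1.2 (Finsupp.single l 1)
  have hsol : ∀ L, IsLowerSet L → HasMean ρ (T L) → ∃ p : S, p.1.1 = L := by
    intro L hL hT
    obtain ⟨D, hD1, hD2, hD3⟩ := exists_coboundary_near hT hf (fun l _ => hbd _) 1 h0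
    exact ⟨⟨(L, D), hL, hD1, hD2, hD3⟩, rfl⟩
  obtain ⟨p, hp⟩ : ∃ p : S, ∀ q, R p q → R q p := by
    refine exists_maximal_of_chains_bounded (fun c hc => ?_) fun {a b d} hab hbd =>
      ⟨hab.1.trans hbd.1, fun l hl => (hab.2 l hl).trans (hbd.2 l (hl.mono (hTmono hab.1)))⟩
    rcases c.eq_empty_or_nonempty with rfl | ⟨p₀, hp₀⟩
    · obtain ⟨p, -⟩ := hsol ∅ isLowerSet_empty (by simpa [T] using hasMean_bot ρ)
      exact ⟨p, by simp⟩
    have hagree : ∀ p ∈ c, ∀ q ∈ c, ∀ l, Near (T p.1.1) l → Near (T q.1.1) l →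
        p.1.2 (Finsupp.single l 1) = q.1.2 (Finsupp.single l 1) := by
      intro p hp q hq l hlp hlq
      by_cases hpq : p = q
      · rw [hpq]
      rcases hc hp hq hpq with h | h
      · exact h.2 l hlp
      · exact (h.2 l hlq).symm
    let L : Set I := ⋃ p ∈ c, p.1.1
    -- Continuity at limits: finitely many elements of a directed union of subgroups lie in one of
    -- them, so the solutions of a chain glue.
    have hmem : ∀ l : List G, (∀ x ∈ l, x ∈ T L) → ∃ p ∈ c, ∀ x ∈ l, x ∈ T p.1.1 := by
      intro l
      induction l with
      | nil => intro _; exact ⟨p₀, hp₀, by simp⟩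
      | cons x l ih =>
        intro h
        obtain ⟨p, hpc, hp⟩ := ih fun y hy => h y (by simp [hy])
        have hx : x ∈ T L := h x (by simp)
        have hTL : T L = ⨆ q : c, T q.1.1.1 := by
          simp only [T, L, Set.image_iUnion₂, Subgroup.closure_iUnion]
          exact iSup_subtype' (p := (· ∈ c)) (f := fun p _ => Subgroup.closure (ι '' p.1.1))
        have hdir : Directed (· ≤ ·) fun q : c => T q.1.1.1 := by
          intro a b
          by_cases hab : a = b
          · exact ⟨a, le_rfl, hab ▸ le_rfl⟩
          rcases hc a.2 b.2 (fun h => hab (Subtype.ext h)) with h | h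
          · exact ⟨b, hTmono h.1, le_rfl⟩
          · exact ⟨a, le_rfl, hTmono h.1⟩
        have : Nonempty c := ⟨⟨p₀, hp₀⟩⟩
        rw [hTL, Subgroup.mem_iSup_of_directed hdir] at hx
        obtain ⟨q, hq⟩ := hx
        obtain ⟨s, hs1, hs2⟩ := hdir ⟨p, hpc⟩ q
        refine ⟨s, s.2, fun y hy => ?_⟩
        rcases List.mem_cons.1 hy with rfl | hy
        · exact hs2 hq
        · exact hs1 (hp y hy)
    have hnear : ∀ l, Near (T L) l → ∃ p ∈ c, Near (T p.1.1) l := by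
      intro l hl
      cases l with
      | nil => exact ⟨p₀, hp₀, by simp [Near]⟩
      | cons x l =>
        obtain ⟨p, hpc, hp⟩ := hmem ((x :: l).map (x⁻¹ * ·)) (by
          intro z hz
          obtain ⟨y, hy, rfl⟩ := List.mem_map.1 hz
          exact hl x (by simp) y hy)
        refine ⟨p, hpc, fun y hy z hz => ?_⟩
        have h1 := hp _ (List.mem_map.2 ⟨y, hy, rfl⟩)
        have h2 := hp _ (List.mem_map.2 ⟨z, hz, rfl⟩)
        have := (T p.1.1).mul_mem ((T p.1.1).inv_mem h1) h2
        simpa using this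
    let g : Chains G →ₗ[ℤ] (N →ₗ[k] V) := chainLift fun l =>
      if h : ∃ p ∈ c, Near (T p.1.1) l then h.choose.1.2 (Finsupp.single l 1) else 0
    have hg : ∀ p ∈ c, ∀ l, Near (T p.1.1) l →
        g (Finsupp.single l 1) = p.1.2 (Finsupp.single l 1) := by
      intro p hp l hl
      have h : ∃ p ∈ c, Near (T p.1.1) l := ⟨p, hp, hl⟩
      simp only [g, chainLift_single, dif_pos h]
      exact hagree _ h.choose_spec.1 _ hp l h.choose_spec.2 hl
    have hg' : ∀ l, (¬ ∃ p ∈ c, Near (T p.1.1) l) → g (Finsupp.single l 1) = 0 := by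
      intro l h
      simp only [g, chainLift_single, dif_neg h]
    refine ⟨⟨(L, g), ?_, ?_, fun l hl => ?_, fun l hl => ?_⟩, fun p hp => ⟨?_, fun l hl => ?_⟩⟩
    · exact isLowerSet_iUnion₂ fun p _ => p.2.1
    · refine isEquivariant_of_single fun a l n => ?_
      by_cases h : ∃ p ∈ c, Near (T p.1.1) l
      · obtain ⟨p, hp, hl⟩ := h
        rw [hg p hp l hl, hg p hp _ ((near_map a).2 hl), ← p.2.2.1, mapChains_single]
      · rw [hg' l h, hg' _ (by simpa only [near_map] using h)]
        simp
    · obtain ⟨p, hpc, hp⟩ := hnear l hl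
      rw [p.2.2.2.1 l hp]
      exact (cochain_bd_eq (hg p hpc) hp).symm
    · by_cases h : ∃ p ∈ c, Near (T p.1.1) l
      · obtain ⟨p, hp, hl'⟩ := h
        exact (hg p hp l hl').trans (p.2.2.2.2 l hl)
      · exact hg' l h
    · exact Set.subset_biUnion_of_mem (u := fun p : S => p.1.1) hp
    · exact (hg p hp l hl).symm
  by_cases huniv : p.1.1 = Set.univ
  · refine ⟨p.1.2, p.2.2.1, fun z => ?_⟩
    have hT : T p.1.1 = ⊤ := by simp only [T, huniv, Set.image_univ, hι]
    suffices f = p.1.2 ∘ₗ bd from LinearMap.congr_fun this z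
    exact chains_hom_ext fun l => p.2.2.2.1 l (hT ▸ near_top l)
  exfalso
  obtain ⟨i, hi, hmin⟩ := WellFounded.has_min (wellFounded_lt (α := I)) (p.1.1)ᶜ
    (Set.nonempty_compl.2 huniv)
  have hsub : p.1.1 ⊆ Set.Iic i := by
    intro j hj
    by_contra hij
    exact hi (p.2.1 (not_le.1 hij).le hj)
  obtain ⟨q, hq⟩ := hsol (Set.Iic i) (isLowerSet_Iic i) (hI i)
  have hqT : T p.1.1 ≤ T q.1.1 := hTmono (hq ▸ hsub)
  -- Two solutions differ by a cocycle on tuples near `T p.1.1`, bounded there by `e`. Since `e ∘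
  -- bd` is an equivariant cochain on all tuples and has zero coboundary, subtracting it from `q`
  -- gives a solution that extends `p`.
  obtain ⟨e, he1, he2, he3⟩ := exists_coboundary_near (ρN := ρN) (F := q.1.2 - p.1.2)
    (((hI i).mono (hTmono hsub)))
    (q.2.2.1.sub p.2.2.1)
    (fun l hl => by
      rw [LinearMap.sub_apply, ← p.2.2.2.1 l hl, ← q.2.2.2.1 l (hl.mono hqT), sub_self]) 0
    (fun l hl => by
      rw [LinearMap.sub_apply, p.2.2.2.2 l hl, q.2.2.2.2 l hl, sub_self])
  have := (hp ⟨(q.1.1, q.1.2 - e ∘ₗ bd), q.2.1, q.2.2.1.sub he1.comp_bd, fun l hl => by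
      simp [q.2.2.2.1 l hl], fun l hl => by
      have h1 : e (bd (Finsupp.single l 1)) ∈ (⊥ : Submodule ℤ _) := by
        refine map_mem_of_mem_chainsOf e (fun l' hl' => ?_) (bd_single_mem l)
        rw [he3 l' (by lia)]
        exact zero_mem _
      rw [Submodule.mem_bot] at h1
      simp [q.2.2.2.2 l hl, h1]⟩ ⟨hq ▸ hsub, fun l hl => by
        simp [← he2 l hl]⟩).1
  exact hi (this (by rw [hq]; exact Set.self_mem_Iic))

/-- A representation with a mean over a subgroup of finite index and over all finitely generated
subgroups has a mean over all subgroups. -/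
theorem hasMean_of_fg (ρ : Representation k G V) (H : Subgroup G) [H.FiniteIndex]
    (hH : HasMean ρ H) (hfg : ∀ F : Subgroup G, F.FG → HasMean ρ F) : HasMean ρ ⊤ := by
  suffices ∀ (c : Cardinal.{u}) (A : Set G), Cardinal.mk A = c →
      HasMean ρ (Subgroup.closure A) by
    simpa using this _ Set.univ rfl
  intro c
  induction c using WellFoundedLT.induction with
  | ind c ih =>
    intro A hA
    rcases A.finite_or_infinite with hfin | hinf
    · exact hfg _ ((Subgroup.fg_iff _).2 ⟨A, rfl, hfin⟩)
    let T := Subgroup.closure A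
    have hc : Cardinal.aleph0 ≤ c := by
      rw [← hA]
      exact Cardinal.aleph0_le_mk_iff.2 hinf.to_subtype
    -- Indexing by the initial ordinal of `c` makes every initial segment of generators smaller than
    -- `c`, so the induction hypothesis covers it.
    obtain ⟨φ⟩ : Nonempty (c.ord.ToType ≃ A) := Cardinal.eq.1 (by rw [Cardinal.mk_ord_toType, hA])
    let ι : c.ord.ToType → T := fun i => ⟨φ i, Subgroup.subset_closure (φ i).2⟩
    have hι : Subgroup.closure (Set.range ι) = ⊤ := by
      have : Set.range ι = (fun x : T => (x : G)) ⁻¹' A := by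
        ext x
        constructor
        · rintro ⟨i, rfl⟩
          exact (φ i).2
        · intro hx
          exact ⟨φ.symm ⟨x, hx⟩, by simp [ι]⟩
      rw [this]
      exact Subgroup.closure_closure_coe_preimage
    refine HasMean.of_comp_subtype (S := T) ?_
    refine hasMean_of_cocyclesBound (E := T) (φ := LinearMap.id) (fun _ => rfl) (fun _ _ => rfl)
      rfl (H.subgroupOf T) 1 _ ?_ (fun x => ?_) ?_
    · exact ((hH.mono (inf_le_left : H ⊓ T ≤ H)).comp_subtype T).mono
        (by rw [Subgroup.inf_subgroupOf_right])
    · have : MulAction.stabilizer T x = ⊥ := by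
        ext g
        simp
      rw [this]
      exact hasMean_bot _
    · refine cocyclesBound_of_filtration _ ι hι fun i => ?_
      have h1 : Cardinal.mk ((fun j => (φ j : G)) '' Set.Iic i) < c := by
        refine Cardinal.mk_image_le.trans_lt ?_
        have h2 : Set.Iic i = insert i (Set.Iio i) := by
          ext j
          simp [le_iff_lt_or_eq, or_comm]
        rw [h2]
        exact (Cardinal.mk_insert_le).trans_lt (Cardinal.add_lt_of_lt hc
          ((Cardinal.mk_Iio_lt i (by simp)).trans_eq (Cardinal.mk_ord_toType _)) (Cardinal.one_lt_aleph0.trans_le hc))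
      refine ((ih _ h1 _ rfl).comp_subtype T).mono ?_
      rw [Subgroup.closure_le]
      rintro _ ⟨j, hj, rfl⟩
      exact Subgroup.subset_closure ⟨j, hj, rfl⟩

end Filtration

/-! ### Barycentric subdivision of tuples of points -/

section Subdivision

/-- To compare two maps on chains it suffices to compare them on tuples on whose boundaries
they agree. -/
lemma chains_hom_ext_bd {E B : Type*} [AddCommGroup B] {f g : Chains E →ₗ[ℤ] B}
    (h0 : f (Finsupp.single [] 1) = g (Finsupp.single [] 1))
    (h : ∀ y l, f (bd (Finsupp.single (y :: l) 1)) = g (bd (Finsupp.single (y :: l) 1)) →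
      f (Finsupp.single (y :: l) 1) = g (Finsupp.single (y :: l) 1)) : f = g := by
  suffices ∀ n (l : List E), l.length = n → f (Finsupp.single l 1) = g (Finsupp.single l 1) from
    chains_hom_ext fun l => this _ l rfl
  intro n
  induction n with
  | zero =>
    intro l hl
    rw [List.length_eq_zero_iff.1 hl, h0]
  | succ n ih =>
    intro l hl
    cases l with
    | nil => exact h0
    | cons y l =>
      exact h y l (eq_of_mem_chainsOf (fun l' hl' => ih l' (by lia)) (bd_single_mem _))

/-! ### Recursive definition of maps on chains through the boundary -/

section Recursion

variable {E A : Type*} [AddCommGroup A]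

/-- Auxiliary stages of `chainRec`. -/
noncomputable def chainRecAux (a : A) (step : List E → A → A) : ℕ → Chains E →ₗ[ℤ] A
  | 0 => chainLift fun _ => a
  | n + 1 => chainLift fun l => step l (chainRecAux a step n (bd (Finsupp.single l 1)))

/-- A linear map on chains defined on a tuple by its value on the boundary of the tuple. -/
noncomputable def chainRec (a : A) (step : List E → A → A) : Chains E →ₗ[ℤ] A :=
  chainLift fun l => chainRecAux a step l.length (Finsupp.single l 1)

@[simp]
lemma chainRec_nil (a : A) (step : List E → A → A) :
    chainRec a step (Finsupp.single [] 1) = a := by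
  simp [chainRec, chainRecAux]

/-- All faces of `y :: l` have the length of `l`, so a single stage of the recursion computes
`chainRec` on the whole boundary. -/
lemma chainRec_cons (a : A) (step : List E → A → A) (y : E) (l : List E) :
    chainRec a step (Finsupp.single (y :: l) 1) =
      step (y :: l) (chainRec a step (bd (Finsupp.single (y :: l) 1))) := by
  have : chainRec a step (bd (Finsupp.single (y :: l) 1)) =
      chainRecAux a step l.length (bd (Finsupp.single (y :: l) 1)) := by
    refine eq_of_mem_chainsOf (fun l' hl' => ?_) (bd_single_mem _)
    have : l'.length = l.length := by simpa using hl'.2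
    simp [chainRec, this]
  rw [this]
  simp [chainRec, chainRecAux]

end Recursion

/-! ### Barycentric subdivision and its chain homotopy -/

section Barycentric

variable {E F : Type*} [AddCommGroup E] [Module ℝ E] [AddCommGroup F] [Module ℝ F]

/-- The barycenter of a tuple of points. -/
noncomputable def bary (l : List E) : E := (l.length : ℝ)⁻¹ • l.sum

lemma bary_map (f : E →ₗ[ℝ] F) (l : List E) : bary (l.map f) = f (bary l) := by
  simp [bary, map_list_sum]

/-- Barycentric subdivision. -/
noncomputable def sd : Chains E →ₗ[ℤ] Chains E :=
  chainRec (Finsupp.single [] 1) fun l a => cone (bary l) a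

/-- The chain homotopy between the identity and the barycentric subdivision. -/
noncomputable def sdHomotopy : Chains E →ₗ[ℤ] Chains E :=
  chainRec 0 fun l a => cone (bary l) (Finsupp.single l 1 - a)

@[simp] lemma sd_nil : sd (Finsupp.single ([] : List E) 1) = Finsupp.single [] 1 := by simp [sd]

lemma sd_cons (y : E) (l : List E) : sd (Finsupp.single (y :: l) 1) =
    cone (bary (y :: l)) (sd (bd (Finsupp.single (y :: l) 1))) := chainRec_cons _ _ y l

@[simp] lemma sdHomotopy_nil : sdHomotopy (Finsupp.single ([] : List E) 1) = 0 := by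
  simp [sdHomotopy]

lemma sdHomotopy_cons (y : E) (l : List E) : sdHomotopy (Finsupp.single (y :: l) 1) =
    cone (bary (y :: l)) (Finsupp.single (y :: l) 1 -
      sdHomotopy (bd (Finsupp.single (y :: l) 1))) := chainRec_cons _ _ y l

lemma bd_sd (z : Chains E) : bd (sd z) = sd (bd z) := by
  suffices bd ∘ₗ sd = sd ∘ₗ (bd : Chains E →ₗ[ℤ] Chains E) from LinearMap.congr_fun this z
  refine chains_hom_ext_bd (by simp) fun y l h => ?_
  simp only [LinearMap.comp_apply, bd_bd, map_zero] at h ⊢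
  rw [sd_cons, bd_cone, h, map_zero, sub_zero]

lemma bd_sdHomotopy (z : Chains E) :
    bd (sdHomotopy z) + sdHomotopy (bd z) = z - sd z := by
  suffices bd ∘ₗ sdHomotopy + sdHomotopy ∘ₗ bd = (LinearMap.id - sd : Chains E →ₗ[ℤ] Chains E) from
    LinearMap.congr_fun this z
  refine chains_hom_ext_bd (by simp) fun y l h => ?_
  simp only [LinearMap.comp_apply, LinearMap.add_apply, LinearMap.sub_apply, LinearMap.id_apply,
    bd_bd, map_zero, add_zero] at h ⊢
  rw [sdHomotopy_cons, bd_cone, map_sub, h, sd_cons]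
  simp only [sub_sub_cancel]
  abel

lemma mapChains_sd (f : E →ₗ[ℝ] F) (z : Chains E) :
    mapChains f (sd z) = sd (mapChains f z) := by
  suffices mapChains f ∘ₗ sd = sd ∘ₗ mapChains f from LinearMap.congr_fun this z
  refine chains_hom_ext_bd (by simp) fun y l h => ?_
  simp only [LinearMap.comp_apply] at h ⊢
  rw [sd_cons, mapChains_cone, h, mapChains_single, List.map_cons, sd_cons, ← List.map_cons,
    bary_map, ← bd_mapChains, mapChains_single]

lemma mapChains_sdHomotopy (f : E →ₗ[ℝ] F) (z : Chains E) :
    mapChains f (sdHomotopy z) = sdHomotopy (mapChains f z) := by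
  suffices mapChains f ∘ₗ sdHomotopy = sdHomotopy ∘ₗ mapChains f from LinearMap.congr_fun this z
  refine chains_hom_ext_bd (by simp) fun y l h => ?_
  simp only [LinearMap.comp_apply] at h ⊢
  rw [sdHomotopy_cons, mapChains_cone, map_sub, h, mapChains_single, List.map_cons,
    sdHomotopy_cons, ← List.map_cons, bary_map, ← bd_mapChains, mapChains_single]

/-- The chain homotopy between the identity and the `m`-fold barycentric subdivision. -/
noncomputable def sdHomotopyIter (m : ℕ) : Chains E →ₗ[ℤ] Chains E :=
  ∑ j ∈ Finset.range m, sdHomotopy ∘ₗ (sd ^ j)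

lemma bd_sd_pow (j : ℕ) (z : Chains E) : bd ((sd ^ j) z) = (sd ^ j) (bd z) := by
  induction j generalizing z with
  | zero => rfl
  | succ j ih => rw [pow_succ, Module.End.mul_apply, Module.End.mul_apply, ih, bd_sd]

lemma mapChains_sd_pow (f : E →ₗ[ℝ] F) (j : ℕ) (z : Chains E) :
    mapChains f ((sd ^ j) z) = (sd ^ j) (mapChains f z) := by
  induction j generalizing z with
  | zero => rfl
  | succ j ih => rw [pow_succ, pow_succ, Module.End.mul_apply, Module.End.mul_apply, ih,
      mapChains_sd]

lemma bd_sdHomotopyIter (m : ℕ) (z : Chains E) :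
    bd (sdHomotopyIter m z) = z - (sd ^ m) z - sdHomotopyIter m (bd z) := by
  rw [eq_sub_iff_add_eq]
  induction m with
  | zero => simp [sdHomotopyIter]
  | succ m ih =>
    simp only [sdHomotopyIter, Finset.sum_range_succ, LinearMap.add_apply, LinearMap.comp_apply,
      map_add] at ih ⊢
    have := bd_sdHomotopy ((sd ^ m) z)
    rw [bd_sd_pow] at this
    rw [add_add_add_comm, ih, this, pow_succ', Module.End.mul_apply]
    abel

lemma mapChains_sdHomotopyIter (f : E →ₗ[ℝ] F) (m : ℕ) (z : Chains E) :
    mapChains f (sdHomotopyIter m z) = sdHomotopyIter m (mapChains f z) := by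
  simp [sdHomotopyIter, LinearMap.sum_apply, map_sum, mapChains_sdHomotopy, mapChains_sd_pow]

lemma sdHomotopyIter_nil (m : ℕ) : sdHomotopyIter m (Finsupp.single ([] : List E) 1) = 0 := by
  have : ∀ j, (sd ^ j) (Finsupp.single ([] : List E) 1) = Finsupp.single [] 1 := by
    intro j
    induction j with
    | zero => rfl
    | succ j ih => rw [pow_succ, Module.End.mul_apply, sd_nil, ih]
  simp [sdHomotopyIter, LinearMap.sum_apply, this]

lemma bary_mem {C : Set E} (hC : Convex ℝ C) {l : List E} (hl : l ≠ []) (h : ∀ x ∈ l, x ∈ C) :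
    bary l ∈ C := by
  have h1 : bary l = ∑ i : Fin l.length, (l.length : ℝ)⁻¹ • l[(i : ℕ)] := by
    rw [← Finset.smul_sum, Fin.sum_univ_getElem, bary]
  rw [h1]
  refine hC.sum_mem (fun _ _ => by positivity) ?_ fun i _ => h _ (List.getElem_mem _)
  have : (l.length : ℝ) ≠ 0 := by simpa using hl
  simp [this]

end Barycentric

/-- All coordinates of the points of the tuple differ by at most `ε`. -/
def Close (ε : ℝ) (l : List (ℕ → ℝ)) : Prop := ∀ x ∈ l, ∀ y ∈ l, ∀ i, |x i - y i| ≤ ε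

lemma Close.sublist {ε : ℝ} {l l' : List (ℕ → ℝ)} (h : Close ε l) (hl : l'.Sublist l) :
    Close ε l' := fun x hx y hy => h x (hl.subset hx) y (hl.subset hy)

/-- Among the `m` differences averaged, the one of `x` with itself is zero, which leaves the factor
`(m - 1) / m ≤ n / (n + 1)`. -/
lemma abs_sub_bary_le {ε : ℝ} {l : List (ℕ → ℝ)} (h : Close ε l) {n : ℕ}
    (hn : l.length ≤ n + 1) {x : ℕ → ℝ} (hx : x ∈ l) (i : ℕ) :
    |x i - bary l i| ≤ n / (n + 1) * ε := by
  obtain ⟨j, hj, rfl⟩ := List.getElem_of_mem hx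
  have hε : 0 ≤ ε := (abs_nonneg _).trans (h _ hx _ hx i)
  have hm : 0 < (l.length : ℝ) := by
    have : 0 < l.length := by lia
    exact_mod_cast this
  have h1 : bary l i = (l.length : ℝ)⁻¹ * ∑ a : Fin l.length, l[(a : ℕ)] i := by
    rw [bary, ← Fin.sum_univ_getElem, Pi.smul_apply, smul_eq_mul, Finset.sum_apply]
  have h2 : l[j] i - bary l i = (l.length : ℝ)⁻¹ * ∑ a : Fin l.length, (l[j] i - l[(a : ℕ)] i) := by
    rw [h1, Finset.sum_sub_distrib]
    simp only [Finset.sum_const, Finset.card_univ, Fintype.card_fin, nsmul_eq_mul]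
    field_simp
  have h3 : |∑ a : Fin l.length, (l[j] i - l[(a : ℕ)] i)| ≤ (l.length - 1) * ε := by
    rw [← Finset.sum_erase (a := ⟨j, hj⟩) _ (by simp)]
    refine (Finset.abs_sum_le_sum_abs _ _).trans ?_
    refine (Finset.sum_le_card_nsmul _ _ ε fun a _ =>
      h _ hx _ (List.getElem_mem _) i).trans (le_of_eq ?_)
    rw [Finset.card_erase_of_mem (Finset.mem_univ _), nsmul_eq_mul]
    simp only [Finset.card_univ, Fintype.card_fin]
    rw [Nat.cast_sub (by lia)]
    simp
  rw [h2, abs_mul, abs_of_pos (inv_pos.2 hm)]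
  refine (mul_le_mul_of_nonneg_left h3 (inv_pos.2 hm).le).trans ?_
  rw [← mul_assoc]
  refine mul_le_mul_of_nonneg_right ?_ hε
  have hn' : (l.length : ℝ) ≤ n + 1 := by exact_mod_cast hn
  rw [inv_mul_le_iff₀ hm, mul_div_assoc', le_div_iff₀ (by positivity)]
  nlinarith

lemma convex_close {C : Set (ℕ → ℝ)} (hC : Convex ℝ C) (b : ℕ → ℝ) (ε : ℝ) :
    Convex ℝ (C ∩ {x | ∀ i, |x i - b i| ≤ ε}) := by
  refine hC.inter ?_
  intro x hx y hy s t hs ht hst i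
  have h1 := hx i
  have h2 := hy i
  have : (s • x + t • y) i - b i = s * (x i - b i) + t * (y i - b i) := by
    simp only [Pi.add_apply, Pi.smul_apply, smul_eq_mul]
    linear_combination (b i) * hst
  rw [this]
  refine (abs_add_le _ _).trans ?_
  rw [abs_mul, abs_mul, abs_of_nonneg hs, abs_of_nonneg ht]
  calc s * |x i - b i| + t * |y i - b i| ≤ s * ε + t * ε := by gcongr
    _ = ε := by rw [← add_mul, hst, one_mul]

lemma close_cons {ε : ℝ} {b : ℕ → ℝ} {l : List (ℕ → ℝ)} (hε : 0 ≤ ε) (h : Close ε l)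
    (hb : ∀ x ∈ l, ∀ i, |x i - b i| ≤ ε) : Close ε (b :: l) := by
  intro x hx y hy i
  rcases List.mem_cons.1 hx with hx' | hx' <;> rcases List.mem_cons.1 hy with hy' | hy'
  · simpa [hx', hy'] using hε
  · rw [hx', abs_sub_comm]
    exact hb y hy' i
  · rw [hy']
    exact hb x hx' i
  · exact h x hx' y hy' i

/-- The tuples of at most `n` points of `C` that are `ε`-close. -/
def IsSmall (C : Set (ℕ → ℝ)) (ε : ℝ) (n : ℕ) (l : List (ℕ → ℝ)) : Prop :=
  l.length ≤ n ∧ (∀ x ∈ l, x ∈ C) ∧ Close ε l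

/-- The convex set is left variable so that the induction can be run inside a box around the
barycenter. That box contains all vertices, so the subdivided faces stay close to the new cone
point. -/
lemma sd_single_mem {ε : ℝ} (hε : 0 ≤ ε) (n : ℕ) : ∀ (C : Set (ℕ → ℝ)), Convex ℝ C →
    ∀ l, IsSmall C ε (n + 1) l →
      sd (Finsupp.single l 1) ∈ chainsOf (IsSmall C (n / (n + 1) * ε) l.length) := by
  suffices ∀ m, ∀ (C : Set (ℕ → ℝ)), Convex ℝ C → ∀ l, l.length = m → IsSmall C ε (n + 1) l →
      sd (Finsupp.single l 1) ∈ chainsOf (IsSmall C (n / (n + 1) * ε) m) from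
    fun C hC l hl => this _ C hC l rfl hl
  intro m
  have hr : 0 ≤ (n / (n + 1) * ε : ℝ) := by positivity
  induction m with
  | zero =>
    intro C hC l hl _
    rw [List.length_eq_zero_iff.1 hl, sd_nil]
    exact single_mem_chainsOf ⟨le_rfl, by simp, by simp [Close]⟩ _
  | succ m ih =>
    intro C hC l hl hs
    cases l with
    | nil => simp at hl
    | cons y l =>
      rw [sd_cons]
      set L := y :: l with hL
      let C' := C ∩ {x | ∀ i, |x i - bary L i| ≤ n / (n + 1) * ε}
      have hC' : Convex ℝ C' := convex_close hC _ _
      have hLC : ∀ x ∈ L, x ∈ C' := fun x hx => ⟨hs.2.1 x hx, abs_sub_bary_le hs.2.2 hs.1 hx⟩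
      have h1 : sd (bd (Finsupp.single L 1)) ∈
          chainsOf (IsSmall C' (n / (n + 1) * ε) m) :=
        map_mem_of_mem_chainsOf sd (fun l' hl' => ih C' hC' l' (by lia)
          ⟨hl'.1.length_le.trans hs.1, fun x hx => hLC x (hl'.1.subset hx),
            hs.2.2.sublist hl'.1⟩) (bd_single_mem L)
      refine map_mem_of_mem_chainsOf (cone (bary L)) (fun l' hl' => ?_) h1
      rw [cone_single]
      refine single_mem_chainsOf ⟨by simpa using hl'.1, ?_, ?_⟩ _
      · intro x hx
        rcases List.mem_cons.1 hx with rfl | hx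
        · exact bary_mem hC (by simp [hL]) hs.2.1
        · exact (hl'.2.1 x hx).1
      · exact close_cons hr hl'.2.2 fun x hx => (hl'.2.1 x hx).2

/-- The homotopy also involves the undivided tuple, so closeness is preserved but not improved. -/
lemma sdHomotopy_single_mem {ε : ℝ} (hε : 0 ≤ ε) : ∀ (C : Set (ℕ → ℝ)), Convex ℝ C →
    ∀ l, (∀ x ∈ l, x ∈ C) → Close ε l →
      sdHomotopy (Finsupp.single l 1) ∈ chainsOf (fun l => (∀ x ∈ l, x ∈ C) ∧ Close ε l) := by
  suffices ∀ m, ∀ (C : Set (ℕ → ℝ)), Convex ℝ C → ∀ l, l.length = m → (∀ x ∈ l, x ∈ C) →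
      Close ε l → sdHomotopy (Finsupp.single l 1) ∈
        chainsOf (fun l => (∀ x ∈ l, x ∈ C) ∧ Close ε l) from
    fun C hC l => this _ C hC l rfl
  intro m
  induction m with
  | zero =>
    intro C hC l hl _ _
    rw [List.length_eq_zero_iff.1 hl, sdHomotopy_nil]
    exact zero_mem _
  | succ m ih =>
    intro C hC l hl hlC hs
    cases l with
    | nil => simp at hl
    | cons y l =>
      rw [sdHomotopy_cons]
      set L := y :: l with hL
      let C' := C ∩ {x | ∀ i, |x i - bary L i| ≤ ε}
      have hC' : Convex ℝ C' := convex_close hC _ _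
      have hLC : ∀ x ∈ L, x ∈ C' := fun x hx => ⟨hlC x hx, fun i =>
        (abs_sub_bary_le hs (n := L.length) (by lia) hx i).trans (mul_le_of_le_one_left hε
          (div_le_one_of_le₀ (by linarith) (by positivity)))⟩
      have h1 : Finsupp.single L 1 - sdHomotopy (bd (Finsupp.single L 1)) ∈
          chainsOf (fun l => (∀ x ∈ l, x ∈ C') ∧ Close ε l) :=
        sub_mem (single_mem_chainsOf ⟨hLC, hs⟩ _)
          (map_mem_of_mem_chainsOf sdHomotopy (fun l' hl' => ih C' hC' l' (by lia)
            (fun x hx => hLC x (hl'.1.subset hx)) (hs.sublist hl'.1)) (bd_single_mem L))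
      refine map_mem_of_mem_chainsOf (cone (bary L)) (fun l' hl' => ?_) h1
      rw [cone_single]
      refine single_mem_chainsOf ⟨?_, ?_⟩ _
      · intro x hx
        rcases List.mem_cons.1 hx with rfl | hx
        · exact bary_mem hC (by simp [hL]) hlC
        · exact (hl'.1 x hx).1
      · exact close_cons hε hl'.2 fun x hx => (hl'.1 x hx).2

lemma sd_pow_mem {ε : ℝ} (hε : 0 ≤ ε) (n j : ℕ) {C : Set (ℕ → ℝ)} (hC : Convex ℝ C)
    {z : Chains (ℕ → ℝ)} (hz : z ∈ chainsOf (IsSmall C ε (n + 1))) :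
    (sd ^ j) z ∈ chainsOf (IsSmall C ((n / (n + 1)) ^ j * ε) (n + 1)) := by
  induction j with
  | zero => simpa using hz
  | succ j ih =>
    rw [pow_succ' sd, Module.End.mul_apply]
    refine map_mem_of_mem_chainsOf sd (fun l hl => ?_) ih
    have h1 := sd_single_mem (by positivity) n C hC l hl
    rw [← mul_assoc, ← pow_succ'] at h1
    exact chainsOf_mono (fun l' hl' => ⟨hl'.1.trans hl.1, hl'.2⟩) h1

lemma sdHomotopy_sd_pow_mem {ε : ℝ} (hε : 0 ≤ ε) (n j : ℕ) {C : Set (ℕ → ℝ)} (hC : Convex ℝ C)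
    {z : Chains (ℕ → ℝ)} (hz : z ∈ chainsOf (IsSmall C ε (n + 1))) :
    sdHomotopy ((sd ^ j) z) ∈
      chainsOf (fun l => (∀ x ∈ l, x ∈ C) ∧ Close ((n / (n + 1)) ^ j * ε) l) :=
  map_mem_of_mem_chainsOf sdHomotopy
    (fun l hl => sdHomotopy_single_mem (by positivity) C hC l hl.2.1 hl.2.2)
    (sd_pow_mem hε n j hC hz)

end Subdivision

/-! ### Small chains in a contractible space with a group action -/

section Simplices

lemma bd_single_eq_sum {E : Type*} (l : List E) : bd (Finsupp.single l 1) =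
    ∑ i ∈ Finset.range l.length, (-1 : ℤ) ^ i • Finsupp.single (l.eraseIdx i) 1 := by
  induction l with
  | nil => simp
  | cons y l ih =>
    rw [bd_cons, ih, List.length_cons, Finset.sum_range_succ', map_sum]
    simp only [map_smul, cone_single, List.eraseIdx_cons_succ, List.eraseIdx_cons_zero, pow_zero,
      one_smul, pow_succ, mul_neg, mul_one, neg_smul, Finset.sum_neg_distrib]
    abel

/-- The standard simplex with `n` vertices. -/
def simplexPts (n : ℕ) : Set (ℕ → ℝ) :=
  {w | (∀ j, 0 ≤ w j) ∧ (∀ j, n ≤ j → w j = 0) ∧ ∑ j ∈ Finset.range n, w j = 1}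

lemma convex_simplexPts (n : ℕ) : Convex ℝ (simplexPts n) := by
  intro x hx y hy s t hs ht hst
  refine ⟨fun j => ?_, fun j hj => ?_, ?_⟩
  · have := hx.1 j
    have := hy.1 j
    simp only [Pi.add_apply, Pi.smul_apply, smul_eq_mul]
    positivity
  · simp [hx.2.1 j hj, hy.2.1 j hj]
  · simp only [Pi.add_apply, Pi.smul_apply, smul_eq_mul, Finset.sum_add_distrib,
      ← Finset.mul_sum, hx.2.2, hy.2.2, mul_one, hst]

lemma simplexPts_zero : simplexPts 0 = ∅ := by
  ext w
  simp [simplexPts]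

lemma le_one_of_mem_simplexPts {n : ℕ} {w : ℕ → ℝ} (hw : w ∈ simplexPts n) (j : ℕ) : w j ≤ 1 := by
  by_cases hj : n ≤ j
  · rw [hw.2.1 j hj]
    exact zero_le_one
  · rw [← hw.2.2]
    exact Finset.single_le_sum (fun i _ => hw.1 i) (Finset.mem_range.2 (not_le.1 hj))

/-- The tuple of vertices of the standard simplex. -/
noncomputable def vertices (n : ℕ) : List (ℕ → ℝ) :=
  (List.range n).map fun j => Pi.single j 1

lemma isSmall_vertices (n : ℕ) : IsSmall (simplexPts n) 1 n (vertices n) := by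
  have hmem : ∀ x ∈ vertices n, x ∈ simplexPts n := by
    intro x hx
    obtain ⟨j, hj, rfl⟩ := List.mem_map.1 hx
    rw [List.mem_range] at hj
    refine ⟨fun i => ?_, fun i hi => ?_, ?_⟩
    · by_cases hij : i = j
      · subst hij; simp
      · simp [hij]
    · rw [Pi.single_apply, if_neg (by lia)]
    · simp [Pi.single_apply, hj]
  refine ⟨by simp [vertices], hmem, fun x hx y hy i => abs_le.2 ⟨?_, ?_⟩⟩
  · linarith [(hmem x hx).1 i, le_one_of_mem_simplexPts (hmem y hy) i]
  · linarith [(hmem y hy).1 i, le_one_of_mem_simplexPts (hmem x hx) i]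

/-- The inclusion of the `i`-th face. -/
def faceMap (i : ℕ) : (ℕ → ℝ) →ₗ[ℝ] (ℕ → ℝ) where
  toFun w j := if j < i then w j else if j = i then 0 else w (j - 1)
  map_add' x y := by
    ext j
    simp only [Pi.add_apply]
    split_ifs <;> simp
  map_smul' c x := by
    ext j
    simp only [Pi.smul_apply, smul_eq_mul, RingHom.id_apply]
    split_ifs <;> simp

lemma faceMap_apply (i : ℕ) (w : ℕ → ℝ) (j : ℕ) :
    faceMap i w j = if j < i then w j else if j = i then 0 else w (j - 1) := rfl

lemma faceMap_mem {n i : ℕ} (hi : i ≤ n) {w : ℕ → ℝ} (hw : w ∈ simplexPts n) :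
    faceMap i w ∈ simplexPts (n + 1) := by
  refine ⟨fun j => ?_, fun j hj => ?_, ?_⟩
  · rw [faceMap_apply]
    split_ifs
    · exact hw.1 _
    · exact le_rfl
    · exact hw.1 _
  · rw [faceMap_apply, if_neg (by lia), ]
    split_ifs
    · rfl
    · exact hw.2.1 _ (by lia)
  · rw [← hw.2.2]
    have h1 : ∀ (f : ℕ → ℝ), ∑ j ∈ Finset.range (n + 1), f j =
        ∑ j ∈ Finset.range i, f j + f i + ∑ j ∈ Finset.range (n - i), f (i + 1 + j) := by
      intro f
      rw [← Finset.sum_range_succ, ← Finset.sum_range_add]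
      congr 2
      lia
    have h2 : ∑ j ∈ Finset.range n, w j =
        ∑ j ∈ Finset.range i, w j + ∑ j ∈ Finset.range (n - i), w (i + j) := by
      rw [← Finset.sum_range_add]
      congr 2
      lia
    rw [h1, h2]
    have h3 : ∀ j ∈ Finset.range i, faceMap i w j = w j := fun j hj => by
      rw [faceMap_apply, if_pos (Finset.mem_range.1 hj)]
    have h4 : ∀ j ∈ Finset.range (n - i), faceMap i w (i + 1 + j) = w (i + j) := fun j _ => by
      rw [faceMap_apply, if_neg (by lia), if_neg (by lia)]
      congr 1
      lia
    rw [Finset.sum_congr rfl h3, Finset.sum_congr rfl h4]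
    simp [faceMap_apply]

lemma vertices_eraseIdx {n i : ℕ} (hi : i ≤ n) :
    (vertices (n + 1)).eraseIdx i = (vertices n).map (faceMap i) := by
  refine List.ext_getElem ?_ fun j h1 h2 => ?_
  · rw [List.length_eraseIdx_of_lt (by simp [vertices]; lia)]
    simp [vertices]
  · rw [List.getElem_eraseIdx]
    simp only [vertices, List.getElem_map, List.getElem_range]
    ext a
    split_ifs with hj <;> simp only [faceMap_apply, Pi.single_apply] <;> split_ifs <;>
      first | rfl | lia

lemma bd_vertices (n : ℕ) : bd (Finsupp.single (vertices (n + 1)) 1) =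
    ∑ i ∈ Finset.range (n + 1), (-1 : ℤ) ^ i •
      mapChains (faceMap i) (Finsupp.single (vertices n) 1) := by
  rw [bd_single_eq_sum]
  have : (vertices (n + 1)).length = n + 1 := by simp [vertices]
  rw [this]
  refine Finset.sum_congr rfl fun i hi => ?_
  rw [vertices_eraseIdx (Nat.lt_succ_iff.1 (Finset.mem_range.1 hi)), mapChains_single]

/-- A quantitative form of Lebesgue's covering lemma for simplices. -/
lemma exists_close_of_local {X : Type*} [TopologicalSpace X] {R : X → X → Prop}
    (hR : ∀ x, ∃ U, IsOpen U ∧ x ∈ U ∧ ∀ y ∈ U, ∀ z ∈ U, R y z) {n : ℕ} {f : (ℕ → ℝ) → X}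
    (hf : ContinuousOn f (simplexPts n)) :
    ∃ ε > 0, ∀ w ∈ simplexPts n, ∀ w' ∈ simplexPts n, (∀ i, |w i - w' i| ≤ ε) →
      R (f w) (f w') := by
  choose U hU1 hU2 hU3 using hR
  let emb : (Fin n → ℝ) → ℕ → ℝ := fun u j => if h : j < n then u ⟨j, h⟩ else 0
  have hemb : Continuous emb := by
    refine continuous_pi fun j => ?_
    by_cases h : j < n
    · simpa [emb, h] using continuous_apply (⟨j, h⟩ : Fin n)
    · simpa [emb, h] using continuous_const
  let pr : (ℕ → ℝ) → Fin n → ℝ := fun w j => w j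
  have hpr : ∀ w ∈ simplexPts n, emb (pr w) = w := by
    intro w hw
    ext j
    by_cases h : j < n
    · simp [emb, pr, h]
    · simp [emb, h, hw.2.1 j (not_lt.1 h)]
  let K : Set (Fin n → ℝ) := stdSimplex ℝ (Fin n)
  have hK : ∀ w, w ∈ simplexPts n → pr w ∈ K := by
    intro w hw
    refine ⟨fun j => hw.1 j, ?_⟩
    rw [← hw.2.2, Finset.sum_range]
  have hK' : ∀ u ∈ K, emb u ∈ simplexPts n := by
    intro u hu
    refine ⟨fun j => ?_, fun j hj => ?_, ?_⟩
    · by_cases h : j < n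
      · simpa [emb, h] using hu.1 _
      · simp [emb, h]
    · simp [emb, not_lt.2 hj]
    · rw [← hu.2, Finset.sum_range]
      simp [emb]
  have : CompactSpace K := isCompact_iff_compactSpace.1 (isCompact_stdSimplex ℝ (Fin n))
  have hg : Continuous fun u : K => f (emb u) :=
    hf.comp_continuous (hemb.comp continuous_subtype_val) fun u => hK' u u.2
  obtain ⟨δ, hδ, hδ'⟩ := lebesgue_number_lemma_of_metric (s := (Set.univ : Set K))
    (c := fun x => (fun u : K => f (emb u)) ⁻¹' U x) isCompact_univ
    (fun x => (hU1 x).preimage hg) (fun u _ => Set.mem_iUnion.2 ⟨f (emb u), hU2 _⟩)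
  refine ⟨δ / 2, by positivity, fun w hw w' hw' h => ?_⟩
  obtain ⟨x, hx⟩ := hδ' ⟨pr w, hK w hw⟩ trivial
  have h1 : f w ∈ U x := by
    have : f (emb (pr w)) ∈ U x := hx (Metric.mem_ball_self hδ)
    rwa [hpr w hw] at this
  have h2 : f w' ∈ U x := by
    have hd : dist (⟨pr w', hK w' hw'⟩ : K) ⟨pr w, hK w hw⟩ < δ := by
      rw [Subtype.dist_eq]
      refine lt_of_le_of_lt ((dist_pi_le_iff (by positivity)).2 fun j => ?_) (half_lt_self hδ)
      rw [Real.dist_eq, abs_sub_comm]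
      exact h j
    have : f (emb (pr w')) ∈ U x := hx (Metric.mem_ball.2 hd)
    rwa [hpr w' hw'] at this
  exact hU3 x _ h1 _ h2

end Simplices

/-! ### Singular simplices spanned by tuples of group elements -/

section Contraction

variable {G : Type*} [Group G] {X : Type*} [MulAction G X]

/-- The singular simplex spanned by a tuple of group elements, constructed by iterated coning
with a contraction `h` of the space. -/
noncomputable def spanned (h : ℝ × X → X) (x₀ : X) : List G → (ℕ → ℝ) → X
  | [], _ => x₀
  | g :: l, w => g • h (w 0, g⁻¹ • spanned h x₀ l fun j => w (j + 1) / (1 - w 0))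

variable {h : ℝ × X → X} {x₀ : X}

lemma tail_mem {n : ℕ} {w : ℕ → ℝ} (hw : w ∈ simplexPts (n + 1)) (h1 : w 0 ≠ 1) :
    (fun j => w (j + 1) / (1 - w 0)) ∈ simplexPts n := by
  have h2 : 0 < 1 - w 0 := by
    have := le_one_of_mem_simplexPts hw 0
    exact sub_pos.2 (lt_of_le_of_ne this h1)
  refine ⟨fun j => div_nonneg (hw.1 _) h2.le, fun j hj => ?_, ?_⟩
  · change w (j + 1) / (1 - w 0) = 0
    rw [hw.2.1 (j + 1) (by lia), zero_div]
  · have := hw.2.2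
    rw [Finset.sum_range_succ'] at this
    rw [← Finset.sum_div, div_eq_one_iff_eq h2.ne']
    linarith

/-- At `w 0 = 1` the rescaled tail involves a division by zero, but there `h` has the constant value
`x₀` and the tail is irrelevant. -/
lemma spanned_smul (h1 : ∀ x, h (1, x) = x₀) (g : G) : ∀ (l : List G) (w : ℕ → ℝ),
    w ∈ simplexPts l.length →
      spanned h x₀ (l.map (g • ·)) w = g • spanned h x₀ l w := by
  intro l
  induction l with
  | nil =>
    intro w hw
    simp [simplexPts_zero] at hw
  | cons a l ih =>
    intro w hw
    rw [List.map_cons, spanned, spanned]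
    by_cases hw0 : w 0 = 1
    · rw [hw0, h1, h1, smul_eq_mul, mul_smul]
    · rw [ih _ (tail_mem hw hw0), smul_eq_mul, mul_smul, mul_inv_rev, mul_smul, inv_smul_smul]

/-- The face opposite the cone vertex is time zero of the contraction. Every other face is a cone
over a face of the tail. -/
lemma spanned_faceMap (h0 : ∀ x, h (0, x) = x) (h1 : ∀ x, h (1, x) = x₀) :
    ∀ (l : List G) (i : ℕ), i < l.length → ∀ w ∈ simplexPts (l.length - 1),
      spanned h x₀ l (faceMap i w) = spanned h x₀ (l.eraseIdx i) w := by
  intro l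
  induction l with
  | nil => simp
  | cons a l ih =>
    intro i hi w hw
    have hw' : w ∈ simplexPts l.length := by simpa using hw
    rw [spanned]
    cases i with
    | zero =>
      have h2 : faceMap 0 w 0 = 0 := by simp [faceMap_apply]
      have h3 : (fun j => faceMap 0 w (j + 1) / (1 - faceMap 0 w 0)) = w := by
        ext j
        simp [faceMap_apply]
      rw [h3, h2, h0, smul_inv_smul, List.eraseIdx_cons_zero]
    | succ i =>
      have h2 : faceMap (i + 1) w 0 = w 0 := by simp [faceMap_apply]
      have h3 : (fun j => faceMap (i + 1) w (j + 1) / (1 - faceMap (i + 1) w 0)) =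
          faceMap i fun j => w (j + 1) / (1 - w 0) := by
        ext j
        rw [h2]
        simp only [faceMap_apply, add_lt_add_iff_right, add_left_inj, add_tsub_cancel_right]
        split_ifs with h4 h5
        · rfl
        · simp
        · have : j - 1 + 1 = j := by lia
          rw [this]
      rw [h3, h2, List.eraseIdx_cons_succ, spanned]
      by_cases hw0 : w 0 = 1
      · rw [hw0, h1, h1]
      · have hil : i < l.length := by simpa using hi
        have h4 : l.length = l.length - 1 + 1 := by lia
        rw [ih i hil _ (tail_mem (h4 ▸ hw') hw0)]

lemma isClosed_simplexPts (n : ℕ) : IsClosed (simplexPts n) := by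
  have : simplexPts n = (⋂ j, {w | 0 ≤ w j}) ∩ ((⋂ j, ⋂ (_ : n ≤ j), {w | w j = 0}) ∩
      {w | ∑ j ∈ Finset.range n, w j = 1}) := by
    ext w
    simp [simplexPts]
  rw [this]
  refine (isClosed_iInter fun j => isClosed_le continuous_const (continuous_apply j)).inter
    ((isClosed_iInter fun j => isClosed_iInter fun _ =>
      isClosed_eq (continuous_apply j) continuous_const).inter
        (isClosed_eq (continuous_finsetSum _ fun j _ => continuous_apply j) continuous_const))

/-- The rescaling degenerates at the cone vertex. As the contraction is already constant from time
`1 / 2` on, two closed halves can be glued and no limit at the vertex is needed. -/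
lemma continuousOn_spanned [TopologicalSpace X] (hG : ∀ g : G, Continuous fun x : X => g • x)
    (hc : Continuous h) (h1 : ∀ t x, 1 / 2 ≤ t → h (t, x) = x₀) :
    ∀ l : List G, ContinuousOn (spanned h x₀ l) (simplexPts l.length) := by
  intro l
  induction l with
  | nil => exact continuousOn_const
  | cons a l ih =>
    have h2 : simplexPts (a :: l).length =
        (simplexPts (l.length + 1) ∩ {w | w 0 ≤ 1 / 2}) ∪
          (simplexPts (l.length + 1) ∩ {w | 1 / 2 ≤ w 0}) := by
      rw [← Set.inter_union_distrib_left, eq_comm, List.length_cons, Set.inter_eq_left]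
      exact fun w _ => le_total (w 0) (1 / 2)
    rw [h2]
    refine ContinuousOn.union_of_isClosed ?_ ?_
      ((isClosed_simplexPts _).inter (isClosed_le (continuous_apply 0) continuous_const))
      ((isClosed_simplexPts _).inter (isClosed_le continuous_const (continuous_apply 0)))
    · have h3 : ∀ w ∈ simplexPts (l.length + 1) ∩ {w | w 0 ≤ 1 / 2}, 1 - w 0 ≠ 0 := by
        intro w hw
        have := hw.2
        rw [Set.mem_ofPred_eq] at this
        linarith
      have h4 : ContinuousOn (fun w : ℕ → ℝ => fun j => w (j + 1) / (1 - w 0))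
          (simplexPts (l.length + 1) ∩ {w | w 0 ≤ 1 / 2}) :=
        continuousOn_pi.2 fun j => (continuous_apply (j + 1)).continuousOn.div
          (continuous_const.sub (continuous_apply 0)).continuousOn h3
      have h5 := ih.comp h4 fun w hw => tail_mem hw.1 fun h => h3 w hw (by rw [h, sub_self])
      exact (hG a).comp_continuousOn (hc.comp_continuousOn
        ((continuous_apply 0).continuousOn.prodMk ((hG a⁻¹).comp_continuousOn h5)))
    · refine (continuousOn_const (c := a • x₀)).congr fun w hw => ?_
      rw [spanned, h1 _ _ hw.2]

end Contraction

/-! ### Small chains in a contractible space with a group action -/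

section SmallChains

lemma exists_contraction (X : Type*) [TopologicalSpace X] [ContractibleSpace X] :
    ∃ (h : ℝ × X → X) (x₀ : X), Continuous h ∧ (∀ x, h (0, x) = x) ∧
      ∀ t x, 1 / 2 ≤ t → h (t, x) = x₀ := by
  obtain ⟨x₀, ⟨H⟩⟩ := id_nullhomotopic X
  refine ⟨fun p => H (Set.projIcc 0 1 zero_le_one (2 * p.1), p.2), x₀, ?_, fun x => ?_,
    fun t x ht => ?_⟩
  · exact H.continuous.comp ((continuous_projIcc.comp
      (continuous_const.mul continuous_fst)).prodMk continuous_snd)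
  · have : Set.projIcc (0 : ℝ) 1 zero_le_one (2 * 0) = 0 := by
      rw [mul_zero]; exact Set.projIcc_left _
    simp only [this, H.apply_zero]
    rfl
  · have : Set.projIcc (0 : ℝ) 1 zero_le_one (2 * t) = 1 :=
      Set.projIcc_of_right_le _ (by linarith)
    simp only [this, H.apply_one]
    rfl

/-- The tuples of points in the standard simplex with `n` vertices. -/
def InSimplex (n : ℕ) (l : List (ℕ → ℝ)) : Prop := ∀ x ∈ l, x ∈ simplexPts n

variable {G : Type*} [Group G] {X : Type*} [MulAction G X]

lemma mapChains_congr {E F : Type*} {f f' : E → F} {C : Set E} (h : ∀ x ∈ C, f x = f' x)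
    {z : Chains E} (hz : z ∈ chainsOf fun l => ∀ x ∈ l, x ∈ C) :
    mapChains f z = mapChains f' z :=
  eq_of_mem_chainsOf (fun l hl => by
    rw [mapChains_single, mapChains_single, List.map_congr_left fun x hx => h x (hl x hx)]) hz

lemma mapChains_mapChains {E F E' : Type*} (f : E → F) (g : F → E') (z : Chains E) :
    mapChains g (mapChains f z) = mapChains (fun x => g (f x)) z := by
  suffices mapChains g ∘ₗ mapChains f = mapChains fun x => g (f x) from LinearMap.congr_fun this z
  exact chains_hom_ext fun l => by simp [Function.comp_def]

/-- The standard simplex as a chain. -/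
noncomputable def stdChain (n : ℕ) : Chains (ℕ → ℝ) := Finsupp.single (vertices n) 1

lemma stdChain_mem (n : ℕ) : stdChain n ∈ chainsOf (IsSmall (simplexPts n) 1 (n + 1)) :=
  single_mem_chainsOf ⟨(isSmall_vertices n).1.trans n.le_succ, (isSmall_vertices n).2⟩ _

lemma stdChain_zero : stdChain 0 = Finsupp.single [] 1 := rfl

lemma bd_stdChain (n : ℕ) : bd (stdChain (n + 1)) =
    ∑ i ∈ Finset.range (n + 1), (-1 : ℤ) ^ i • mapChains (faceMap i) (stdChain n) :=
  bd_vertices n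

lemma sdHomotopyIter_stdChain_mem (m n : ℕ) :
    sdHomotopyIter m (stdChain n) ∈ chainsOf (InSimplex n) := by
  simp only [sdHomotopyIter, LinearMap.sum_apply]
  exact sum_mem fun j _ => chainsOf_mono (fun l hl => hl.1)
    (sdHomotopy_sd_pow_mem zero_le_one n j (convex_simplexPts n) (stdChain_mem n))

variable {h : ℝ × X → X} {x₀ : X}

/-- The image of an operation on the standard simplex in the simplex spanned by a tuple. -/
noncomputable def spannedChain (h : ℝ × X → X) (x₀ : X)
    (T : Chains (ℕ → ℝ) →ₗ[ℤ] Chains (ℕ → ℝ)) (l : List G) : Chains X :=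
  mapChains (spanned h x₀ l) (T (stdChain l.length))

lemma spannedChain_smul (h1 : ∀ x, h (1, x) = x₀) {T : Chains (ℕ → ℝ) →ₗ[ℤ] Chains (ℕ → ℝ)}
    (hT : ∀ n, T (stdChain n) ∈ chainsOf (InSimplex n)) (g : G) (l : List G) :
    spannedChain h x₀ T (l.map (g • ·)) = mapChains (g • ·) (spannedChain h x₀ T l) := by
  rw [spannedChain, spannedChain, mapChains_mapChains, List.length_map]
  exact mapChains_congr (fun w hw => spanned_smul h1 g l w hw) (hT _)

/-- An operation natural for the face maps can be computed on the faces of a spanned simplex, which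
are again spanned simplices. -/
lemma mapChains_spanned_bd (h0 : ∀ x, h (0, x) = x) (h1 : ∀ x, h (1, x) = x₀)
    {T : Chains (ℕ → ℝ) →ₗ[ℤ] Chains (ℕ → ℝ)}
    (hT : ∀ n, T (stdChain n) ∈ chainsOf (InSimplex n))
    (hT' : ∀ i z, T (mapChains (faceMap i) z) = mapChains (faceMap i) (T z)) (l : List G)
    (hl : l ≠ []) :
    mapChains (spanned h x₀ l) (T (bd (stdChain l.length))) =
      ∑ i ∈ Finset.range l.length, (-1 : ℤ) ^ i • spannedChain h x₀ T (l.eraseIdx i) := by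
  have h2 : l.length = l.length - 1 + 1 := by
    have := List.length_pos_iff.2 hl
    lia
  rw [h2, bd_stdChain, ← h2]
  simp only [map_sum, map_smul, hT', mapChains_mapChains]
  refine Finset.sum_congr rfl fun i hi => ?_
  rw [Finset.mem_range] at hi
  rw [spannedChain, List.length_eraseIdx_of_lt hi]
  congr 1
  exact mapChains_congr (fun w hw => spanned_faceMap h0 h1 l i hi w hw) (hT _)

/-- Points of the standard simplex of distance at most `(n / (n + 1)) ^ m` map to points
related by `R`. -/
def IsFine (R : X → X → Prop) (h : ℝ × X → X) (x₀ : X) (l : List G) (m : ℕ) : Prop :=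
  ∀ w ∈ simplexPts l.length, ∀ w' ∈ simplexPts l.length,
    (∀ i, |w i - w' i| ≤ (l.length / (l.length + 1)) ^ m) →
      R (spanned h x₀ l w) (spanned h x₀ l w')

variable {R : X → X → Prop}

lemma IsFine.mono {l : List G} {m m' : ℕ} (hm : IsFine R h x₀ l m) (hmm : m ≤ m') :
    IsFine R h x₀ l m' := fun w hw w' hw' hww => hm w hw w' hw' fun i => (hww i).trans
  (pow_le_pow_of_le_one (by positivity)
    (div_le_one_of_le₀ (by linarith) (by positivity)) hmm)

lemma IsFine.smul (h1 : ∀ x, h (1, x) = x₀) (hRG : ∀ (g : G) x y, R x y → R (g • x) (g • y))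
    {l : List G} {m : ℕ} (hm : IsFine R h x₀ l m) (g : G) :
    IsFine R h x₀ (l.map (g • ·)) m := by
  intro w hw w' hw' hww
  rw [List.length_map] at hw hw'
  rw [spanned_smul h1 _ _ _ hw, spanned_smul h1 _ _ _ hw']
  exact hRG _ _ _ (hm w hw w' hw' (by simpa using hww))

/-- Since `n / (n + 1)` increases with `n`, the tolerance required on a face is at most the one
granted on the simplex. -/
lemma IsFine.eraseIdx (h0 : ∀ x, h (0, x) = x) (h1 : ∀ x, h (1, x) = x₀)
    {l : List G} {m : ℕ} (hm : IsFine R h x₀ l m) {i : ℕ} (hi : i < l.length) :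
    IsFine R h x₀ (l.eraseIdx i) m := by
  intro w hw w' hw' hww
  rw [List.length_eraseIdx_of_lt hi] at hw hw' hww
  rw [← spanned_faceMap h0 h1 l i hi w hw, ← spanned_faceMap h0 h1 l i hi w' hw']
  obtain ⟨n, hn⟩ : ∃ n, l.length = n + 1 := ⟨l.length - 1, by lia⟩
  simp only [hn, Nat.add_sub_cancel] at hw hw' hww
  have hle : (n / (n + 1) : ℝ) ^ m ≤ ((n + 1) / (n + 1 + 1)) ^ m := by
    refine pow_le_pow_left₀ (by positivity) ?_ m
    rw [div_le_div_iff₀ (by positivity) (by positivity)]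
    nlinarith
  refine hm _ (hn ▸ faceMap_mem (by lia) hw) _ (hn ▸ faceMap_mem (by lia) hw') fun j => ?_
  rw [hn]
  push_cast
  simp only [faceMap_apply]
  split_ifs
  · exact (hww _).trans hle
  · rw [sub_self, abs_zero]
    positivity
  · exact (hww _).trans hle

/-- On a contractible space with a group action there is an equivariant augmented chain map from
the tuples of group elements to the tuples of points with prescribed smallness. -/
theorem exists_small_chains [TopologicalSpace X] [ContractibleSpace X]
    (hG : ∀ g : G, Continuous fun x : X => g • x) {R : X → X → Prop}
    (hRG : ∀ (g : G) x y, R x y → R (g • x) (g • y))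
    (hR : ∀ x, ∃ U, IsOpen U ∧ x ∈ U ∧ ∀ y ∈ U, ∀ z ∈ U, R y z) :
    ∃ φ : Chains G →ₗ[ℤ] Chains X, (∀ z, bd (φ z) = φ (bd z)) ∧
      (∀ (g : G) z, φ (mapChains (g • ·) z) = mapChains (g • ·) (φ z)) ∧
      φ (Finsupp.single [] 1) = Finsupp.single [] 1 ∧
      ∀ z, φ z ∈ chainsOf fun l => ∀ x ∈ l, ∀ y ∈ l, R x y := by
  classical
  obtain ⟨h, x₀, hc, h0, h2⟩ := exists_contraction X
  have h1 : ∀ x, h (1, x) = x₀ := fun x => h2 1 x (by norm_num)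
  have hfine : ∀ l : List G, ∃ m, IsFine R h x₀ l m := by
    intro l
    obtain ⟨ε, hε, hε'⟩ := exists_close_of_local hR (continuousOn_spanned hG hc h2 l)
    obtain ⟨m, hm⟩ := exists_pow_lt_of_lt_one hε
      (show (l.length / (l.length + 1) : ℝ) < 1 by
        rw [div_lt_one (by positivity)]
        linarith)
    exact ⟨m, fun w hw w' hw' hww => hε' w hw w' hw' fun i => (hww i).trans hm.le⟩
  -- Taking the least number of subdivisions makes `m` invariant under `G` and monotone under
  -- passage to faces.
  let m : List G → ℕ := fun l => Nat.find (hfine l)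
  have hm : ∀ l, IsFine R h x₀ l (m l) := fun l => Nat.find_spec (hfine l)
  have hm_le : ∀ l n, IsFine R h x₀ l n → m l ≤ n := fun l n => Nat.find_min' (hfine l)
  have hm_smul : ∀ (g : G) l, m (l.map (g • ·)) = m l := by
    intro g l
    refine le_antisymm (hm_le _ _ ((hm l).smul h1 hRG g)) (hm_le _ _ ?_)
    have := (hm (l.map (g • ·))).smul h1 hRG g⁻¹
    simpa [Function.comp_def] using this
  have hm_face : ∀ l i, i < l.length → m (l.eraseIdx i) ≤ m l := fun l i hi =>
    hm_le _ _ ((hm l).eraseIdx h0 h1 hi)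
  have hTid : ∀ n, (LinearMap.id : _ →ₗ[ℤ] _) (stdChain n) ∈ chainsOf (InSimplex n) := fun n =>
    chainsOf_mono (fun l hl => hl.2.1) (stdChain_mem n)
  let v : Chains G →ₗ[ℤ] Chains X := chainLift (spannedChain h x₀ LinearMap.id)
  let D : Chains G →ₗ[ℤ] Chains X := chainLift fun l => spannedChain h x₀ (sdHomotopyIter (m l)) l
  have hv : ∀ l, v (Finsupp.single l 1) = spannedChain h x₀ LinearMap.id l := fun l => by simp [v]
  have hD : ∀ l, D (Finsupp.single l 1) = spannedChain h x₀ (sdHomotopyIter (m l)) l :=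
    fun l => by simp [D]
  have hv0 : v (Finsupp.single [] 1) = Finsupp.single [] 1 := by
    rw [hv, spannedChain, LinearMap.id_apply, List.length_nil, stdChain_zero, mapChains_single,
      List.map_nil]
  have hD0 : D (Finsupp.single [] 1) = 0 := by
    rw [hD, spannedChain, List.length_nil, stdChain_zero, sdHomotopyIter_nil, map_zero]
  have hvbd : bd ∘ₗ v = v ∘ₗ bd := by
    refine chains_hom_ext fun l => ?_
    rw [LinearMap.comp_apply, LinearMap.comp_apply]
    by_cases hl : l = []
    · rw [hl, hv0, bd_nil, bd_nil, map_zero]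
    · have h3 := mapChains_spanned_bd h0 h1 hTid (fun _ _ => rfl) l hl
      rw [LinearMap.id_apply] at h3
      rw [hv, spannedChain, LinearMap.id_apply, bd_mapChains, h3, bd_single_eq_sum, map_sum]
      refine Finset.sum_congr rfl fun i _ => ?_
      rw [map_smul, hv]
  have hveq : ∀ (g : G) z, v (mapChains (g • ·) z) = mapChains (g • ·) (v z) := by
    intro g z
    suffices v ∘ₗ mapChains (g • ·) = mapChains (g • ·) ∘ₗ v from LinearMap.congr_fun this z
    refine chains_hom_ext fun l => ?_
    simp only [LinearMap.comp_apply, mapChains_single, hv]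
    exact spannedChain_smul h1 hTid g l
  have hDeq : ∀ (g : G) z, D (mapChains (g • ·) z) = mapChains (g • ·) (D z) := by
    intro g z
    suffices D ∘ₗ mapChains (g • ·) = mapChains (g • ·) ∘ₗ D from LinearMap.congr_fun this z
    refine chains_hom_ext fun l => ?_
    simp only [LinearMap.comp_apply, mapChains_single, hD, hm_smul]
    exact spannedChain_smul h1 (sdHomotopyIter_stdChain_mem _) g l
  have hvbd' : ∀ z, bd (v z) = v (bd z) := LinearMap.congr_fun hvbd
  -- Subdividing each simplex `m l` times is not a chain map, as `m` varies with the face. Altering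
  -- `v` by the homotopy `D` is, and supplies the needed correction on faces.
  refine ⟨v - bd ∘ₗ D - D ∘ₗ bd, fun z => ?_, fun g z => ?_, ?_, fun z => ?_⟩
  · simp [hvbd']
  · simp only [LinearMap.sub_apply, LinearMap.comp_apply, map_sub, hveq, hDeq, bd_mapChains]
  · simp [hv0, hD0]
  · refine map_mem_of_mem_chainsOf (p := fun _ => True) _ (fun l _ => ?_)
      (by simp [chainsOf])
    by_cases hl : l = []
    · have : (v - bd ∘ₗ D - D ∘ₗ bd) (Finsupp.single l 1) = Finsupp.single [] 1 := by
        simp [hl, hv0, hD0]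
      rw [this]
      exact single_mem_chainsOf (by simp) _
    have h3 := mapChains_spanned_bd h0 h1 (sdHomotopyIter_stdChain_mem (m l))
      (fun i z => (mapChains_sdHomotopyIter _ _ z).symm) l hl
    -- The correction on a face consists of the homotopies of its `j`-fold subdivisions for `j` from
    -- the number of steps of the face up to `m l`, excluding `m l`. All of these are already fine.
    have h4 : (v - bd ∘ₗ D - D ∘ₗ bd) (Finsupp.single l 1) =
        spannedChain h x₀ (sd ^ m l) l + ∑ i ∈ Finset.range l.length, (-1 : ℤ) ^ i •
          (spannedChain h x₀ (sdHomotopyIter (m l)) (l.eraseIdx i) -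
            spannedChain h x₀ (sdHomotopyIter (m (l.eraseIdx i))) (l.eraseIdx i)) := by
      have h5 : D (bd (Finsupp.single l 1)) = ∑ i ∈ Finset.range l.length, (-1 : ℤ) ^ i •
          spannedChain h x₀ (sdHomotopyIter (m (l.eraseIdx i))) (l.eraseIdx i) := by
        rw [bd_single_eq_sum, map_sum]
        exact Finset.sum_congr rfl fun i _ => by rw [map_smul, hD]
      simp only [smul_sub, Finset.sum_sub_distrib]
      rw [← h3, ← h5, LinearMap.sub_apply, LinearMap.sub_apply, LinearMap.comp_apply,
        LinearMap.comp_apply, hD, hv, spannedChain, spannedChain, spannedChain, bd_mapChains,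
        bd_sdHomotopyIter, map_sub, map_sub, LinearMap.id_apply]
      abel
    have hsmall : ∀ (l : List G) (j : ℕ), m l ≤ j → ∀ z ∈ chainsOf (fun l' =>
        (∀ x ∈ l', x ∈ simplexPts l.length) ∧ Close ((l.length / (l.length + 1)) ^ j * 1) l'),
        mapChains (spanned h x₀ l) z ∈ chainsOf fun l => ∀ x ∈ l, ∀ y ∈ l, R x y := by
      intro l j hj z hz
      refine map_mem_of_mem_chainsOf _ (fun l' hl' => ?_) hz
      rw [mapChains_single]
      refine single_mem_chainsOf (fun x hx y hy => ?_) _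
      obtain ⟨w, hw, rfl⟩ := List.mem_map.1 hx
      obtain ⟨w', hw', rfl⟩ := List.mem_map.1 hy
      exact (hm l).mono hj w (hl'.1 w hw) w' (hl'.1 w' hw') fun i => by
        simpa using hl'.2 w hw w' hw' i
    rw [h4]
    refine add_mem ?_ (sum_mem fun i hi => Submodule.smul_mem _ _ ?_)
    · exact hsmall l (m l) le_rfl _ (chainsOf_mono (fun l' hl' => hl'.2)
        (sd_pow_mem zero_le_one _ _ (convex_simplexPts _) (stdChain_mem _)))
    · rw [spannedChain, spannedChain, ← map_sub, sdHomotopyIter, sdHomotopyIter,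
        ← LinearMap.sub_apply, ← Finset.sum_Ico_eq_sub _ (hm_face l i (Finset.mem_range.1 hi)),
        LinearMap.sum_apply, map_sum]
      refine sum_mem fun j hj => hsmall _ j (Finset.mem_Ico.1 hj).1 _ ?_
      exact sdHomotopy_sd_pow_mem zero_le_one _ _ (convex_simplexPts _) (stdChain_mem _)

end SmallChains

/-! ### Sorting tuples of coloured points -/

section Sorting

variable {E : Type*}

/-- The first element of minimal colour in a nonempty tuple. -/
def firstMin (col : E → ℕ) : E → List E → E
  | y, [] => y
  | y, z :: l => if col (firstMin col z l) < col y then firstMin col z l else y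

lemma firstMin_mem (col : E → ℕ) (y : E) (l : List E) : firstMin col y l ∈ y :: l := by
  induction l generalizing y with
  | nil => simp [firstMin]
  | cons z l ih =>
    rw [firstMin]
    split_ifs
    · exact List.mem_cons_of_mem _ (ih z)
    · exact List.mem_cons_self

lemma col_firstMin_le (col : E → ℕ) (y : E) (l : List E) :
    ∀ x ∈ y :: l, col (firstMin col y l) ≤ col x := by
  induction l generalizing y with
  | nil => simp [firstMin]
  | cons z l ih =>
    intro x hx
    rw [firstMin]
    rcases List.mem_cons.1 hx with rfl | hx
    · split_ifs with h <;> lia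
    · have := ih z x hx
      split_ifs with h <;> lia

lemma firstMin_map {col : E → ℕ} {f : E → E} (hf : ∀ x, col (f x) = col x) (y : E) (l : List E) :
    firstMin col (f y) (l.map f) = f (firstMin col y l) := by
  induction l generalizing y with
  | nil => rfl
  | cons z l ih =>
    rw [List.map_cons, firstMin, firstMin, ih, hf, hf]
    split_ifs <;> rfl

open Classical in
/-- Prepending a vertex to the tuples that do not yet contain it. -/
noncomputable def coneNew (p : E) : Chains E →ₗ[ℤ] Chains E :=
  chainLift fun s => if p ∈ s then 0 else Finsupp.single (p :: s) 1

lemma coneNew_of_mem {p : E} {s : List E} (h : p ∈ s) : coneNew p (Finsupp.single s 1) = 0 := by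
  simp [coneNew, h]

lemma coneNew_of_notMem {p : E} {s : List E} (h : p ∉ s) :
    coneNew p (Finsupp.single s 1) = Finsupp.single (p :: s) 1 := by
  simp [coneNew, h]

lemma coneNew_map {f : E → E} (hf : Function.Injective f) (p : E) (z : Chains E) :
    coneNew (f p) (mapChains f z) = mapChains f (coneNew p z) := by
  suffices coneNew (f p) ∘ₗ mapChains f = mapChains f ∘ₗ coneNew p from LinearMap.congr_fun this z
  refine chains_hom_ext fun s => ?_
  simp only [LinearMap.comp_apply, mapChains_single]
  by_cases h : p ∈ s
  · rw [coneNew_of_mem h, coneNew_of_mem (List.mem_map_of_mem h), map_zero]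
  · rw [coneNew_of_notMem h, coneNew_of_notMem (by rwa [List.mem_map_of_injective hf]),
      mapChains_single, List.map_cons]

/-- The sorting map on chains, by repeatedly coning with the vertex of minimal colour. -/
noncomputable def sortChain (col : E → ℕ) : Chains E →ₗ[ℤ] Chains E :=
  chainRec (Finsupp.single [] 1) fun l a =>
    match l with
    | [] => a
    | y :: l => coneNew (firstMin col y l) a

lemma sortChain_nil (col : E → ℕ) :
    sortChain col (Finsupp.single [] 1) = Finsupp.single [] 1 := chainRec_nil _ _

lemma sortChain_cons (col : E → ℕ) (y : E) (l : List E) :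
    sortChain col (Finsupp.single (y :: l) 1) =
      coneNew (firstMin col y l) (sortChain col (bd (Finsupp.single (y :: l) 1))) :=
  chainRec_cons _ _ y l

lemma sortChain_map {col : E → ℕ} {f : E → E} (hf : Function.Injective f)
    (hcol : ∀ x, col (f x) = col x) (z : Chains E) :
    sortChain col (mapChains f z) = mapChains f (sortChain col z) := by
  suffices sortChain col ∘ₗ mapChains f = mapChains f ∘ₗ sortChain col from
    LinearMap.congr_fun this z
  refine chains_hom_ext_bd (by simp [sortChain_nil]) fun y l h => ?_
  simp only [LinearMap.comp_apply] at h ⊢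
  rw [mapChains_single, List.map_cons, sortChain_cons, sortChain_cons, ← coneNew_map hf, ← h,
    firstMin_map hcol, ← bd_mapChains, mapChains_single, List.map_cons]

/-- A tuple with strictly increasing colours whose entries occur in `t`. -/
def IsSortedIn (col : E → ℕ) (t s : List E) : Prop :=
  s.Pairwise (fun x y => col x < col y) ∧ s ⊆ t

/-- Entries of the tuple of the same colour are equal. -/
def IsRainbow (col : E → ℕ) (t : List E) : Prop :=
  ∀ x ∈ t, ∀ y ∈ t, col x = col y → x = y

variable {col : E → ℕ}

lemma IsSortedIn.eq_cons {t s : List E} {p : E} (hs : IsSortedIn col t s)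
    (hmin : ∀ x ∈ t, col p ≤ col x) (hps : p ∈ s) :
    ∃ s', s = p :: s' ∧ p ∉ s' := by
  cases s with
  | nil => simp at hps
  | cons a s =>
    obtain ⟨h1, h2⟩ := List.pairwise_cons.1 hs.1
    have ha : a ∈ t := hs.2 List.mem_cons_self
    have hps' : p ∉ s := fun h => absurd (h1 p h) (not_lt.2 (hmin a ha))
    rcases List.mem_cons.1 hps with rfl | h
    · exact ⟨s, rfl, hps'⟩
    · exact absurd h hps'

lemma IsSortedIn.cons {t s : List E} {p : E} (hs : IsSortedIn col t s)
    (ht : IsRainbow col t) (hp : p ∈ t) (hmin : ∀ x ∈ t, col p ≤ col x) (hps : p ∉ s) :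
    IsSortedIn col t (p :: s) := by
  refine ⟨List.pairwise_cons.2 ⟨fun x hx => lt_of_le_of_ne (hmin x (hs.2 hx)) fun h => ?_, hs.1⟩,
    List.cons_subset.2 ⟨hp, hs.2⟩⟩
  exact hps (ht p hp x (hs.2 hx) h ▸ hx)

/-- A vertex of minimal colour can occur in a sorted tuple only at its head. Then the coned boundary
returns the tuple itself, matching the zero value of `coneNew`. -/
lemma bd_coneNew {t s : List E} {p : E} (hs : IsSortedIn col t s)
    (hmin : ∀ x ∈ t, col p ≤ col x) :
    bd (coneNew p (Finsupp.single s 1)) =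
      Finsupp.single s 1 - coneNew p (bd (Finsupp.single s 1)) := by
  by_cases hps : p ∈ s
  · obtain ⟨s', rfl, hs'⟩ := hs.eq_cons hmin hps
    have h0 : ∀ z, coneNew p (cone p z) = 0 := by
      intro z
      suffices coneNew p ∘ₗ cone p = (0 : Chains E →ₗ[ℤ] Chains E) from LinearMap.congr_fun this z
      refine chains_hom_ext fun l => ?_
      rw [LinearMap.comp_apply, cone_single, coneNew_of_mem List.mem_cons_self,
        LinearMap.zero_apply]
    rw [coneNew_of_mem hps, bd_cons, map_sub, h0, coneNew_of_notMem hs', map_zero, sub_zero,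
      sub_self]
  · rw [coneNew_of_notMem hps, bd_cons]
    congr 1
    refine eq_of_mem_chainsOf (fun l hl => ?_) (bd_single_mem s)
    rw [cone_single, coneNew_of_notMem fun h => hps (hl.1.subset h)]

/-- An acyclic carrier argument: by induction the sorted boundary is a cycle of sorted tuples, and
coning it from a vertex of minimal colour keeps tuples sorted and fills the cycle. -/
lemma sortChain_single_aux : ∀ (n : ℕ) (t : List E), t.length = n → IsRainbow col t →
    sortChain col (Finsupp.single t 1) ∈ chainsOf (IsSortedIn col t) ∧
      bd (sortChain col (Finsupp.single t 1)) = sortChain col (bd (Finsupp.single t 1)) := by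
  intro n
  induction n with
  | zero =>
    intro t ht _
    rw [List.length_eq_zero_iff.1 ht, sortChain_nil, bd_nil, map_zero]
    exact ⟨single_mem_chainsOf ⟨List.Pairwise.nil, by simp⟩ _, rfl⟩
  | succ n ih =>
    intro t htn ht
    cases t with
    | nil => simp at htn
    | cons y l =>
      rw [sortChain_cons]
      set p := firstMin col y l
      have hp : p ∈ y :: l := firstMin_mem col y l
      have hmin := col_firstMin_le col y l
      have hsub : ∀ l' : List E, l'.Sublist (y :: l) ∧ l'.length + 1 = (y :: l).length →
          sortChain col (Finsupp.single l' 1) ∈ chainsOf (IsSortedIn col (y :: l)) ∧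
          bd (sortChain col (Finsupp.single l' 1)) = sortChain col (bd (Finsupp.single l' 1)) := by
        intro l' hl'
        have := ih l' (by lia) fun x hx z hz => ht x (hl'.1.subset hx) z (hl'.1.subset hz)
        exact ⟨chainsOf_mono (fun s hs => ⟨hs.1, List.Subset.trans hs.2 hl'.1.subset⟩) this.1, this.2⟩
      have h1 : sortChain col (bd (Finsupp.single (y :: l) 1)) ∈
          chainsOf (IsSortedIn col (y :: l)) :=
        map_mem_of_mem_chainsOf _ (fun l' hl' => (hsub l' hl').1) (bd_single_mem _)
      have h2 : bd (sortChain col (bd (Finsupp.single (y :: l) 1))) = 0 := by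
        have : bd (sortChain col (bd (Finsupp.single (y :: l) 1))) =
            sortChain col (bd (bd (Finsupp.single (y :: l) 1))) :=
          eq_of_mem_chainsOf (f := bd ∘ₗ sortChain col) (g := sortChain col ∘ₗ bd)
            (fun l' hl' => (hsub l' hl').2) (bd_single_mem _)
        rw [this, bd_bd, map_zero]
      refine ⟨map_mem_of_mem_chainsOf _ (fun s hs => ?_) h1, ?_⟩
      · by_cases hps : p ∈ s
        · rw [coneNew_of_mem hps]
          exact zero_mem _
        · rw [coneNew_of_notMem hps]
          exact single_mem_chainsOf (hs.cons ht hp hmin hps) _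
      · have := eq_of_mem_chainsOf (f := bd ∘ₗ coneNew p) (g := LinearMap.id - coneNew p ∘ₗ bd)
          (fun s hs => bd_coneNew hs hmin) h1
        simpa [h2] using this

lemma sortChain_mem {t : List E} (ht : IsRainbow col t) :
    sortChain col (Finsupp.single t 1) ∈ chainsOf (IsSortedIn col t) :=
  (sortChain_single_aux _ t rfl ht).1

lemma bd_sortChain {z : Chains E} (hz : z ∈ chainsOf (IsRainbow col)) :
    bd (sortChain col z) = sortChain col (bd z) :=
  eq_of_mem_chainsOf (f := bd ∘ₗ sortChain col) (g := sortChain col ∘ₗ bd)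
    (fun t ht => (sortChain_single_aux _ t rfl ht).2) hz

lemma length_le_of_isSortedIn {d : ℕ} (hd : ∀ x, col x ≤ d) {t s : List E}
    (hs : IsSortedIn col t s) : s.length ≤ d + 1 := by
  have h1 : (s.map col).Nodup :=
    (List.pairwise_map.2 hs.1).imp fun h => ne_of_lt h
  have h2 : s.map col ⊆ List.range (d + 1) := by
    intro x hx
    obtain ⟨y, _, rfl⟩ := List.mem_map.1 hx
    exact List.mem_range.2 (Nat.lt_succ_of_le (hd y))
  simpa using (h1.subperm h2).length_le

end Sorting

/-- A representation has a mean if this holds for the restriction to a subgroup of finite index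
and for the restrictions to the stabilizers of an action on a contractible space with an
equivariant retraction onto coloured centers that locally depend only on their colour. -/
theorem hasMean_of_coloring {k : Type u} [CommRing k] {G : Type u} [Group G] {V : Type u}
    [AddCommGroup V] [Module k V] (ρ : Representation k G V)
    {X : Type*} [TopologicalSpace X] [ContractibleSpace X] [MulAction G X]
    (hG : ∀ g : G, Continuous fun x : X => g • x) (π : X → X)
    (hπ : ∀ (g : G) x, π (g • x) = g • π x) (col : X → ℕ) (hcol : ∀ (g : G) x, col (g • x) = col x)
    (d : ℕ) (hd : ∀ x, col x ≤ d)
    (hloc : ∀ x, ∃ U, IsOpen U ∧ x ∈ U ∧ ∀ y ∈ U, ∀ z ∈ U, col (π y) = col (π z) → π y = π z)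
    (H : Subgroup G) [H.FiniteIndex] (hH : HasMean ρ H)
    (hX : ∀ x : X, HasMean ρ (MulAction.stabilizer G x)) : HasMean ρ ⊤ := by
  obtain ⟨ψ, hψ1, hψ2, hψ3, hψ4⟩ := exists_small_chains hG
    (R := fun y z => col (π y) = col (π z) → π y = π z)
    (fun g x y h h' => by
      rw [hπ, hπ, hcol, hcol] at h'
      rw [hπ, hπ, h h']) hloc
  have hψ5 : ∀ z, mapChains π (ψ z) ∈ chainsOf (IsRainbow col) := fun z =>
    map_mem_of_mem_chainsOf _ (fun l hl => by
      rw [mapChains_single]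
      refine single_mem_chainsOf (fun x hx y hy => ?_) _
      obtain ⟨a, ha, rfl⟩ := List.mem_map.1 hx
      obtain ⟨b, hb, rfl⟩ := List.mem_map.1 hy
      exact hl a ha b hb) (hψ4 z)
  refine hasMean_of_cocyclesBound (φ := sortChain col ∘ₗ mapChains π ∘ₗ ψ) (fun z => ?_)
    (fun g z => ?_) ?_ H d ρ hH hX ?_
  · simp only [LinearMap.comp_apply]
    rw [bd_sortChain (hψ5 z), bd_mapChains, hψ1]
  · simp only [LinearMap.comp_apply]
    rw [hψ2, ← sortChain_map (MulAction.injective g) (hcol g), mapChains_mapChains,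
      mapChains_mapChains]
    simp only [hπ]
  · simp [hψ3, sortChain_nil]
  · intro N _ _ ρN f _ _ h0
    -- Sorted tuples have at most `d + 1` entries, and `f` vanishes on these, so `f ∘ φ` is zero.
    refine ⟨0, fun _ _ _ => by simp, fun z => ?_⟩
    rw [LinearMap.zero_apply]
    have h1 : sortChain col (mapChains π (ψ z)) ∈ chainsOf fun s => s.length ≤ d + 1 :=
      map_mem_of_mem_chainsOf _ (fun t ht => chainsOf_mono
        (fun s hs => length_le_of_isSortedIn hd hs) (sortChain_mem ht)) (hψ5 z)
    exact eq_of_mem_chainsOf (g := 0) (fun s hs => by simpa using h0 s hs) h1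

/-! ### Centers of cells -/

section CellularActions

open Topology RelCWComplex
open scoped Pointwise

variable (X : Type u) [TopologicalSpace X] [CWComplex (Set.univ : Set X)]

/-- The cells of a CW-complex of all dimensions. -/
abbrev AnyCell : Type u := Σ n, cell (Set.univ : Set X) n

variable {X}

/-- The open cell. -/
def interiorOf (c : AnyCell X) : Set X := openCell c.1 c.2

/-- The characteristic map of a cell. -/
noncomputable def charMap (c : AnyCell X) : PartialEquiv (Fin c.1 → ℝ) X := map c.1 c.2

lemma exists_mem_interiorOf (x : X) : ∃ c : AnyCell X, x ∈ interiorOf c := by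
  have h : x ∈ (Set.univ : Set X) := trivial
  rw [← CWComplex.iUnion_openCell_eq_complex (C := (Set.univ : Set X))] at h
  simp only [Set.mem_iUnion] at h
  obtain ⟨n, j, h⟩ := h
  exact ⟨⟨n, j⟩, h⟩

/-- The cell whose interior contains a given point. -/
noncomputable def cellOf (x : X) : AnyCell X := (exists_mem_interiorOf x).choose

lemma mem_interiorOf_cellOf (x : X) : x ∈ interiorOf (cellOf x) :=
  (exists_mem_interiorOf x).choose_spec

lemma cellOf_eq {x : X} {c : AnyCell X} (h : x ∈ interiorOf c) : cellOf x = c := by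
  by_contra hne
  exact Set.disjoint_left.1 (disjoint_openCell_of_ne hne) (mem_interiorOf_cellOf x) h

lemma cellOf_fst_lt {x : X} {c : AnyCell X} (h : x ∈ cellFrontier c.1 c.2) :
    (cellOf x).1 < c.1 := by
  obtain ⟨I, hI⟩ := CWComplex.cellFrontier_subset_finite_openCell c.1 c.2
  have := hI h
  simp only [Set.mem_iUnion] at this
  obtain ⟨m, hm, j, -, hx⟩ := this
  rwa [cellOf_eq (c := ⟨m, j⟩) hx]

lemma cellFrontier_eq (c : AnyCell X) :
    cellFrontier c.1 c.2 = closedCell c.1 c.2 \ interiorOf c := by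
  rw [← cellFrontier_union_openCell_eq_closedCell, interiorOf, Set.union_sdiff_right, eq_comm,
    sdiff_eq_left]
  refine Set.disjoint_left.2 fun x hx hx' => ?_
  have := cellOf_fst_lt hx
  rw [cellOf_eq (c := c) hx'] at this
  exact lt_irrefl _ this

/-! ### Orbits of cells, representatives and shifts -/

variable {G : Type u} [Group G] [MulAction G X]

lemma IsCellularAction.cellOf_smul (h : IsCellularAction G X) (g : G) (x : X) :
    (cellOf (g • x)).1 = (cellOf x).1 ∧ g • interiorOf (cellOf x) = interiorOf (cellOf (g • x)) := by
  obtain ⟨j, hj⟩ := h.permutes g (cellOf x).1 (cellOf x).2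
  have h1 : g • interiorOf (cellOf x) = interiorOf ⟨(cellOf x).1, j⟩ := hj
  have h2 : cellOf (g • x) = ⟨(cellOf x).1, j⟩ :=
    cellOf_eq (h1 ▸ Set.smul_mem_smul_set (mem_interiorOf_cellOf x))
  rw [h2]
  exact ⟨rfl, h1⟩

variable (X G) in
/-- Two cells are related if they are translates. -/
def cellSetoid : Setoid (AnyCell X) where
  r c c' := c.1 = c'.1 ∧ ∃ g : G, g • interiorOf c = interiorOf c'
  iseqv :=
    { refl := fun c => ⟨rfl, 1, one_smul _ _⟩
      symm := fun ⟨h, g, hg⟩ => ⟨h.symm, g⁻¹, by rw [← hg, inv_smul_smul]⟩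
      trans := fun ⟨h, g, hg⟩ ⟨h', g', hg'⟩ => ⟨h.trans h', g' * g, by rw [mul_smul, hg, hg']⟩ }

variable (G) in
/-- A representative of the orbit of a cell. -/
noncomputable def cellRep (c : AnyCell X) : AnyCell X := (Quotient.mk (cellSetoid X G) c).out

variable (G) in
lemma cellRep_spec (c : AnyCell X) :
    (cellRep G c).1 = c.1 ∧ ∃ g : G, g • interiorOf (cellRep G c) = interiorOf c := by
  have h : cellSetoid X G (cellRep G c) c := Quotient.exact (Quotient.out_eq _)
  exact h

variable (G) in
/-- An element that translates the representative of the orbit of a cell to the cell. -/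
noncomputable def cellShift (c : AnyCell X) : G := (cellRep_spec G c).2.choose

variable (G) in
lemma cellShift_smul (c : AnyCell X) :
    cellShift G c • interiorOf (cellRep G c) = interiorOf c := (cellRep_spec G c).2.choose_spec

/-- In a Hausdorff space the fixed points form a closed set, so pointwise fixing extends from the
open cell to its closure. -/
lemma IsCellularAction.smul_eq_of_mem_closedCell [T2Space X] (h : IsCellularAction G X) {t : G}
    {c : AnyCell X} (ht : t • interiorOf c = interiorOf c) {x : X}
    (hx : x ∈ closedCell c.1 c.2) : t • x = x := by
  rw [← closure_openCell_eq_closedCell] at hx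
  have : closure (openCell c.1 c.2) ⊆ {x | t • x = x} :=
    closure_minimal (fun y hy => h.fixes t c.1 c.2 ht y hy)
      (isClosed_eq (h.continuous_smul t) continuous_id)
  exact this hx

/-- The representatives and the shifts of the cell of a point and of the cell of a translate. -/
lemma IsCellularAction.exists_shift (h : IsCellularAction G X) (g : G) (x : X) :
    cellRep G (cellOf (g • x)) = cellRep G (cellOf x) ∧
      ∃ t : G, t • interiorOf (cellRep G (cellOf x)) = interiorOf (cellRep G (cellOf x)) ∧
        cellShift G (cellOf (g • x)) = g * cellShift G (cellOf x) * t := by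
  obtain ⟨h1, h2⟩ := h.cellOf_smul g x
  have h3 : cellRep G (cellOf (g • x)) = cellRep G (cellOf x) := by
    have : Quotient.mk (cellSetoid X G) (cellOf (g • x)) = Quotient.mk _ (cellOf x) :=
      (Quotient.sound (s := cellSetoid X G) ⟨h1.symm, g, h2⟩).symm
    rw [cellRep, cellRep, this]
  refine ⟨h3, (g * cellShift G (cellOf x))⁻¹ * cellShift G (cellOf (g • x)), ?_, by group⟩
  rw [mul_smul, inv_smul_eq_iff, ← h3, cellShift_smul, ← h2, h3, mul_smul, cellShift_smul]

/-! ### Equivariant charts, centers and radial projections -/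

variable (G)

/-- The coordinates of a point in the chart of the representative of its cell. -/
noncomputable def coord (x : X) : Fin (cellRep G (cellOf x)).1 → ℝ :=
  (charMap (cellRep G (cellOf x))).symm ((cellShift G (cellOf x))⁻¹ • x)

/-- An equivariantly chosen chart of a cell. -/
noncomputable def chart (c : AnyCell X) (v : Fin (cellRep G c).1 → ℝ) : X :=
  cellShift G c • charMap (cellRep G c) v

/-- The center of the cell of a point. -/
noncomputable def centerOf (x : X) : X := chart G (cellOf x) 0

/-- The radial projection of a point to the boundary of its cell. -/
noncomputable def pushOf (x : X) : X := chart G (cellOf x) (‖coord G x‖⁻¹ • coord G x)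

lemma normalize_mem {n : ℕ} (v : Fin n → ℝ) : ‖v‖⁻¹ • v ∈ Metric.closedBall (0 : Fin n → ℝ) 1 := by
  rw [mem_closedBall_zero_iff, norm_smul, norm_inv, norm_norm]
  exact inv_mul_le_one

lemma normalize_mem_sphere {n : ℕ} {v : Fin n → ℝ} (hv : 0 < ‖v‖) :
    ‖v‖⁻¹ • v ∈ Metric.sphere (0 : Fin n → ℝ) 1 := by
  rw [mem_sphere_zero_iff_norm, norm_smul, norm_inv, norm_norm, inv_mul_cancel₀ hv.ne']

variable {G}

/-- Two shifts differ by an element preserving the representative cell, which fixes its closure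
pointwise. Hence any construction `P` in coordinates becomes equivariant; it is used for centers and
for radial projections. -/
lemma IsCellularAction.chart_smul [T2Space X] (h : IsCellularAction G X) (g : G) (x : X)
    {P : ∀ c : AnyCell X, X → Fin c.1 → ℝ} (hP : ∀ c y, P c y ∈ Metric.closedBall 0 1) :
    chart G (cellOf (g • x)) (P _ ((cellShift G (cellOf (g • x)))⁻¹ • (g • x))) =
      g • chart G (cellOf x) (P _ ((cellShift G (cellOf x))⁻¹ • x)) := by
  obtain ⟨h1, t, ht, h2⟩ := h.exists_shift g x
  rw [chart, chart, h1, h2]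
  have h3 : (g * cellShift G (cellOf x) * t)⁻¹ • g • x = (cellShift G (cellOf x))⁻¹ • x := by
    have h4 : (cellShift G (cellOf x))⁻¹ • x ∈ interiorOf (cellRep G (cellOf x)) := by
      rw [← Set.mem_smul_set_iff_inv_smul_mem, cellShift_smul]
      exact mem_interiorOf_cellOf x
    have h5 := h.smul_eq_of_mem_closedCell ht (openCell_subset_closedCell _ _ h4)
    rw [inv_smul_eq_iff, mul_smul, h5, mul_smul, smul_inv_smul]
  rw [h3, mul_smul, mul_smul, h.smul_eq_of_mem_closedCell ht]
  exact Set.mem_image_of_mem _ (hP _ _)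

lemma IsCellularAction.centerOf_smul [T2Space X] (h : IsCellularAction G X) (g : G) (x : X) :
    centerOf G (g • x) = g • centerOf G x :=
  h.chart_smul g x (P := fun _ _ => 0) fun _ _ => by simp

lemma IsCellularAction.pushOf_smul [T2Space X] (h : IsCellularAction G X) (g : G) (x : X) :
    pushOf G (g • x) = g • pushOf G x :=
  h.chart_smul g x (P := fun c y => ‖(charMap c).symm y‖⁻¹ • (charMap c).symm y)
    fun _ _ => normalize_mem _

lemma IsCellularAction.norm_coord_smul (h : IsCellularAction G X) (g : G) (x : X) :
    ‖coord G (g • x)‖ = ‖coord G x‖ := by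
  obtain ⟨h1, t, ht, h2⟩ := h.exists_shift g x
  have h4 : (cellShift G (cellOf x))⁻¹ • x ∈ interiorOf (cellRep G (cellOf x)) := by
    rw [← Set.mem_smul_set_iff_inv_smul_mem, cellShift_smul]
    exact mem_interiorOf_cellOf x
  have h3 : (g * cellShift G (cellOf x) * t)⁻¹ • g • x = (cellShift G (cellOf x))⁻¹ • x := by
    rw [inv_smul_eq_iff, mul_smul, h.fixes t _ _ ht _ h4, mul_smul, smul_inv_smul]
  rw [coord, coord, h1, h2, h3]

variable (G) in
lemma chart_image_ball (c : AnyCell X) :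
    chart G c '' Metric.ball 0 1 = interiorOf c := by
  rw [← cellShift_smul G c, ← Set.image_smul, interiorOf, openCell, Set.image_image]
  rfl

lemma IsCellularAction.closedCell_eq [T2Space X] (h : IsCellularAction G X) (c : AnyCell X) :
    closedCell c.1 c.2 = cellShift G c • closedCell (cellRep G c).1 (cellRep G c).2 := by
  have : ContinuousConstSMul G X := ⟨h.continuous_smul⟩
  rw [← closure_openCell_eq_closedCell, ← closure_openCell_eq_closedCell, ← closure_smul]
  exact congrArg closure (cellShift_smul G c).symm

lemma IsCellularAction.chart_image_closedBall [T2Space X] (h : IsCellularAction G X)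
    (c : AnyCell X) : chart G c '' Metric.closedBall 0 1 = closedCell c.1 c.2 := by
  rw [h.closedCell_eq c, ← Set.image_smul, closedCell, Set.image_image]
  rfl

lemma IsCellularAction.chart_image_sphere [T2Space X] (h : IsCellularAction G X)
    (c : AnyCell X) : chart G c '' Metric.sphere 0 1 = cellFrontier c.1 c.2 := by
  rw [cellFrontier_eq c, ← cellShift_smul G c, h.closedCell_eq c, ← Set.smul_set_sdiff,
    ← cellFrontier_eq, ← Set.image_smul, cellFrontier, Set.image_image]
  rfl

lemma IsCellularAction.continuousOn_chart (h : IsCellularAction G X) (c : AnyCell X) :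
    ContinuousOn (chart G c) (Metric.closedBall 0 1) :=
  (h.continuous_smul _).comp_continuousOn (continuousOn (C := (Set.univ : Set X)) _ _)

/-- The coordinates of a point of a chart. -/
lemma chart_spec (c : AnyCell X) {v : Fin (cellRep G c).1 → ℝ} (hv : v ∈ Metric.ball 0 1) :
    ‖coord G (chart G c v)‖ = ‖v‖ ∧ centerOf G (chart G c v) = chart G c 0 ∧
      pushOf G (chart G c v) = chart G c (‖v‖⁻¹ • v) := by
  have h1 : cellOf (chart G c v) = c :=
    cellOf_eq (chart_image_ball G c ▸ Set.mem_image_of_mem _ hv)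
  have h2 : (charMap (cellRep G c)).symm ((cellShift G c)⁻¹ • chart G c v) = v := by
    rw [chart, inv_smul_smul]
    exact PartialEquiv.left_inv _ (by rw [charMap, source_eq]; exact hv)
  have h3 : ∀ (c' : AnyCell X) (x : X), c' = cellOf x → ‖coord G x‖ =
      ‖(charMap (cellRep G c')).symm ((cellShift G c')⁻¹ • x)‖ ∧ centerOf G x = chart G c' 0 ∧
      pushOf G x = chart G c' (‖(charMap (cellRep G c')).symm ((cellShift G c')⁻¹ • x)‖⁻¹ •
        (charMap (cellRep G c')).symm ((cellShift G c')⁻¹ • x)) := by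
    rintro c' x rfl
    exact ⟨rfl, rfl, rfl⟩
  obtain ⟨h4, h5, h6⟩ := h3 _ _ h1.symm
  rw [h2] at h4 h6
  exact ⟨h4, h5, h6⟩

lemma exists_eq_chart (G : Type u) [Group G] [MulAction G X] {x : X} {c : AnyCell X}
    (hx : x ∈ interiorOf c) :
    ∃ v ∈ Metric.ball (0 : Fin (cellRep G c).1 → ℝ) 1, x = chart G c v := by
  rw [← chart_image_ball G c] at hx
  obtain ⟨v, hv, rfl⟩ := hx
  exact ⟨v, hv, rfl⟩

lemma cellOf_centerOf (x : X) : cellOf (centerOf G x) = cellOf x :=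
  cellOf_eq (by
    rw [← chart_image_ball G]
    exact Set.mem_image_of_mem _ (by simp))

lemma IsCellularAction.pushOf_mem [T2Space X] (h : IsCellularAction G X) {x : X}
    (hx : 0 < ‖coord G x‖) : pushOf G x ∈ cellFrontier (cellOf x).1 (cellOf x).2 := by
  rw [← h.chart_image_sphere]
  exact Set.mem_image_of_mem _ (normalize_mem_sphere hx)

/-- A point is near a center, if it lies in the inner half of the cell of the center, or its
projection to the boundary of its cell is near the center. -/
inductive IsNear (G : Type u) [Group G] [MulAction G X] : X → X → Prop
  | center (x : X) : ‖coord G x‖ ≤ 1 / 2 → IsNear G x (centerOf G x)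
  | push (x q : X) : 1 / 2 ≤ ‖coord G x‖ → IsNear G (pushOf G x) q → IsNear G x q

lemma IsNear.cases {x q : X} (h : IsNear G x q) :
    (‖coord G x‖ ≤ 1 / 2 ∧ q = centerOf G x) ∨
      (1 / 2 ≤ ‖coord G x‖ ∧ IsNear G (pushOf G x) q) := by
  cases h with
  | center _ h => exact Or.inl ⟨h, rfl⟩
  | push _ _ h h' => exact Or.inr ⟨h, h'⟩

lemma IsCellularAction.cellOf_le_of_isNear [T2Space X] (h : IsCellularAction G X) {x q : X}
    (hq : IsNear G x q) : (cellOf q).1 ≤ (cellOf x).1 := by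
  induction hq with
  | center x _ => rw [cellOf_centerOf]
  | push x q hx _ ih => exact ih.trans (cellOf_fst_lt (h.pushOf_mem (by linarith))).le

/-- Each push strictly lowers the dimension of the cell, so the successive pushes of `x` meet at
most one cell of each dimension. -/
lemma IsCellularAction.eq_of_isNear [T2Space X] (h : IsCellularAction G X) {x q q' : X}
    (hq : IsNear G x q) (hq' : IsNear G x q') (hqq : (cellOf q).1 = (cellOf q').1) : q = q' := by
  induction hq with
  | center x hx =>
    rcases hq'.cases with h1 | h1
    · exact h1.2.symm
    · have h2 := cellOf_fst_lt (h.pushOf_mem (x := x) (by linarith))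
      have h3 := h.cellOf_le_of_isNear h1.2
      rw [cellOf_centerOf] at hqq
      lia
  | push x q hx hq ih =>
    rcases hq'.cases with h1 | h1
    · have h2 := cellOf_fst_lt (h.pushOf_mem (x := x) (by linarith))
      have h3 := h.cellOf_le_of_isNear hq
      rw [h1.2, cellOf_centerOf] at hqq
      lia
    · exact ih h1.2 hqq

/-- Closedness is tested on closed cells by induction on dimension. In a chart the set consists of
its part in the frontier, the radial extension of that part to the outer shell, and the inner
half-ball if its center is in `A`. Counting norm `1 / 2` on both sides keeps these pieces compact.
-/
lemma IsCellularAction.isClosed_near [T2Space X] (h : IsCellularAction G X) (A : Set X) :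
    IsClosed {x | ∃ q ∈ A, IsNear G x q} := by
  set S : Set X := {x | ∃ q ∈ A, IsNear G x q} with hS
  rw [CWComplex.closed (Set.univ : Set X) S (Set.subset_univ _)]
  intro n
  induction n using Nat.case_strong_induction_on with
  | hz =>
    intro j
    rw [closedCell_zero_eq_singleton]
    exact (Set.finite_singleton _).inter_of_right _ |>.isClosed
  | hi n ih =>
    intro j
    obtain ⟨c, hc⟩ : ∃ c : AnyCell X, c = ⟨n + 1, j⟩ := ⟨_, rfl⟩
    have hfr : IsClosed (S ∩ cellFrontier c.1 c.2) := by
      rw [hc]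
      exact CWComplex.isClosed_inter_cellFrontier_succ_of_le_isClosed_inter_closedCell ih j
    let B₁ : Set (Fin (cellRep G c).1 → ℝ) := {v | ‖v‖ ≤ 1 / 2 ∧ chart G c 0 ∈ A}
    let f : (Fin (cellRep G c).1 → ℝ) → X := fun v => chart G c (‖v‖⁻¹ • v)
    let K : Set (Fin (cellRep G c).1 → ℝ) := Metric.closedBall 0 1 ∩ {v | 1 / 2 ≤ ‖v‖}
    let B₂ : Set (Fin (cellRep G c).1 → ℝ) := K ∩ f ⁻¹' (S ∩ cellFrontier c.1 c.2)
    have hK : IsClosed K :=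
      Metric.isClosed_closedBall.inter (isClosed_le continuous_const continuous_norm)
    have hf : ContinuousOn f K := by
      refine (h.continuousOn_chart c).comp ?_ fun v _ => normalize_mem v
      refine (continuous_norm.continuousOn.inv₀ fun v hv => ?_).smul continuousOn_id
      have : 1 / 2 ≤ ‖v‖ := hv.2
      exact ne_of_gt (by linarith)
    have himg : ∀ B : Set (Fin (cellRep G c).1 → ℝ), IsClosed B → B ⊆ Metric.closedBall 0 1 →
        IsClosed (chart G c '' B) := fun B hB hB' =>
      (((isCompact_closedBall _ _).of_isClosed_subset hB hB').image_of_continuousOn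
        ((h.continuousOn_chart c).mono hB')).isClosed
    have hB₁ : IsClosed B₁ := by
      by_cases h0 : chart G c 0 ∈ A
      · simpa [B₁, h0] using isClosed_le continuous_norm continuous_const
      · simp [B₁, h0]
    have key : S ∩ closedCell c.1 c.2 =
        (S ∩ cellFrontier c.1 c.2) ∪ (chart G c '' B₁ ∪ chart G c '' B₂) := by
      apply Set.Subset.antisymm
      · rintro x ⟨⟨q, hqA, hq⟩, hx⟩
        rw [← cellFrontier_union_openCell_eq_closedCell] at hx
        rcases hx with hx | hx
        · exact Or.inl ⟨⟨q, hqA, hq⟩, hx⟩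
        · obtain ⟨v, hv, rfl⟩ := exists_eq_chart G hx
          obtain ⟨h1, h2, h3⟩ := chart_spec (G := G) c hv
          rcases hq.cases with h4 | h4
          · rw [h1, h2] at h4
            exact Or.inr (Or.inl ⟨v, ⟨h4.1, h4.2 ▸ hqA⟩, rfl⟩)
          · rw [h1, h3] at h4
            refine Or.inr (Or.inr ⟨v, ⟨⟨Metric.ball_subset_closedBall hv, h4.1⟩,
              ⟨q, hqA, h4.2⟩, ?_⟩, rfl⟩)
            rw [← h.chart_image_sphere]
            exact Set.mem_image_of_mem _ (normalize_mem_sphere (by linarith [h4.1]))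
      · rintro x (hx | ⟨v, ⟨hv, hv'⟩, rfl⟩ | ⟨v, ⟨hv, hv'⟩, rfl⟩)
        · exact ⟨hx.1, cellFrontier_subset_closedCell _ _ hx.2⟩
        · have hvb : v ∈ Metric.ball (0 : Fin (cellRep G c).1 → ℝ) 1 := by
            rw [mem_ball_zero_iff]; linarith
          obtain ⟨h1, h2, h3⟩ := chart_spec (G := G) c hvb
          refine ⟨⟨_, hv', h2 ▸ IsNear.center _ (by rw [h1]; exact hv)⟩, ?_⟩
          rw [← h.chart_image_closedBall]
          exact Set.mem_image_of_mem _ (Metric.ball_subset_closedBall hvb)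
        · refine ⟨?_, by rw [← h.chart_image_closedBall]; exact Set.mem_image_of_mem _ hv.1⟩
          have h4 : 1 / 2 ≤ ‖v‖ := hv.2
          obtain ⟨⟨q, hqA, hq⟩, -⟩ := hv'
          by_cases hvb : v ∈ Metric.ball (0 : Fin (cellRep G c).1 → ℝ) 1
          · obtain ⟨h1, h2, h3⟩ := chart_spec (G := G) c hvb
            exact ⟨q, hqA, IsNear.push _ _ (by rw [h1]; exact h4) (by rw [h3]; exact hq)⟩
          -- On the unit sphere the radial projection is the identity, so the point already belongs
          -- to the frontier part.
          · have h5 : ‖v‖ = 1 := le_antisymm (by simpa using hv.1) (by simpa using hvb)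
            refine ⟨q, hqA, ?_⟩
            simpa [f, h5] using hq
    have h6 : IsClosed (S ∩ closedCell c.1 c.2) := by
      rw [key]
      refine hfr.union ((himg B₁ hB₁ fun v hv => ?_).union
        (himg B₂ (hf.preimage_isClosed_of_isClosed hK hfr) fun v hv => hv.1.1))
      have := hv.1
      rw [mem_closedBall_zero_iff]
      linarith
    rw [hc] at h6
    exact h6

variable (G) in
/-- A center near the given point, provided the dimension of its cell is at most the number of
steps. -/
noncomputable def nearCenter : ℕ → X → X
  | 0, x => centerOf G x
  | n + 1, x => open Classical in
    if ‖coord G x‖ ≤ 1 / 2 then centerOf G x else nearCenter n (pushOf G x)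

lemma IsCellularAction.nearCenter_smul [T2Space X] (h : IsCellularAction G X) (n : ℕ) (g : G)
    (x : X) : nearCenter G n (g • x) = g • nearCenter G n x := by
  induction n generalizing x with
  | zero => exact h.centerOf_smul g x
  | succ n ih =>
    rw [nearCenter, nearCenter, h.norm_coord_smul, h.centerOf_smul, h.pushOf_smul, ih]
    split_ifs <;> rfl

/-- In dimension zero a push would land in a cell of negative dimension, so only the center remains.
-/
lemma IsCellularAction.isNear_nearCenter [T2Space X] (h : IsCellularAction G X) (n : ℕ) (x : X)
    (hx : (cellOf x).1 ≤ n) : IsNear G x (nearCenter G n x) := by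
  induction n generalizing x with
  | zero =>
    refine IsNear.center x ?_
    by_contra h1
    have := cellOf_fst_lt (h.pushOf_mem (x := x) (by linarith))
    lia
  | succ n ih =>
    rw [nearCenter]
    split_ifs with h1
    · exact IsNear.center x h1
    · have := cellOf_fst_lt (h.pushOf_mem (x := x) (by linarith))
      exact IsNear.push _ _ (by linarith) (ih _ (by lia))

/-- The cellular actions on finite dimensional CW-complexes have equivariant retractions onto
centers of cells that locally depend only on the dimension. -/
theorem IsCellularAction.exists_coloring [T2Space X] [FiniteDimensional (Set.univ : Set X)]
    (h : IsCellularAction G X) : ∃ (π : X → X) (col : X → ℕ) (d : ℕ),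
      (∀ (g : G) x, π (g • x) = g • π x) ∧ (∀ (g : G) x, col (g • x) = col x) ∧
      (∀ x, col x ≤ d) ∧ ∀ x, ∃ U, IsOpen U ∧ x ∈ U ∧
        ∀ y ∈ U, ∀ z ∈ U, col (π y) = col (π z) → π y = π z := by
  obtain ⟨d, hd⟩ := Filter.eventually_atTop.1
    (FiniteDimensional.eventually_isEmpty_cell (C := (Set.univ : Set X)) (D := ∅))
  have hd' : ∀ x : X, (cellOf x).1 ≤ d := by
    intro x
    by_contra hx
    exact (hd _ (not_le.1 hx).le).false (cellOf x).2
  refine ⟨nearCenter G d, fun x => (cellOf x).1, d, h.nearCenter_smul d,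
    fun g x => (h.cellOf_smul g x).1, hd', fun x => ?_⟩
  -- This neighbourhood of `x` consists of the points all of whose near centers are also near `x`,
  -- and near `x` there is at most one center in each dimension.
  refine ⟨{y | ∃ q ∈ {q | ¬ IsNear G x q}, IsNear G y q}ᶜ, (h.isClosed_near _).isOpen_compl,
    fun ⟨q, hq, hq'⟩ => hq hq', fun y hy z hz hyz => ?_⟩
  have h1 : ∀ y ∈ {y | ∃ q ∈ {q | ¬ IsNear G x q}, IsNear G y q}ᶜ,
      IsNear G x (nearCenter G d y) := fun y hy => by
    by_contra hne
    exact hy ⟨_, hne, h.isNear_nearCenter d y (hd' y)⟩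
  exact h.eq_of_isNear (h1 y hy) (h1 z hz) hyz

end CellularActions

open CategoryTheory

/-! ### Closure properties of the class of groups satisfying Moore's conjecture -/

section Closure

variable {k : Type u} [CommRing k] {G : Type u} [Group G]

/-- The section makes the cosyzygy a `k`-linear summand of a product of copies of `V`. -/
lemma injective_cosyzygy {V : Type u} [AddCommGroup V] [Module k V] {ρ : Representation k G V}
    (hV : Module.Injective k V) {H : Subgroup G} (hH : HasMean ρ H) :
    Module.Injective k (Cosyzygy k G V) where
  out X Y _ _ _ _ f hf q := by
    obtain ⟨σ, hσ, -⟩ := hH.hasSection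
    obtain ⟨h, hh⟩ := (inferInstance : Module.Injective k (G → V)).out f hf (σ ∘ₗ q)
    exact ⟨(constFun k G V).mkQ ∘ₗ h, fun x => by rw [LinearMap.comp_apply, hh]; exact hσ _⟩

/-- A representation of finite injective dimension has a mean if it has one over a subgroup of
finite index. -/
theorem hasMean_of_hasInjectiveDimensionLE (H : Subgroup G) [H.FiniteIndex] (n : ℕ) :
    ∀ {P V : Type u} [AddCommGroup P] [Module (MonoidAlgebra k G) P] [AddCommGroup V]
      [Module k V] {ρ : Representation k G V} {e : P ≃+ V}, Realizes ρ e →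
      Module.Injective k V → HasMean ρ H →
      HasInjectiveDimensionLE (ModuleCat.of (MonoidAlgebra k G) P) n → HasMean ρ ⊤ := by
  induction n with
  | zero =>
    intro P V _ _ _ _ ρ e he _ _ hn
    have h1 : Injective (ModuleCat.of (MonoidAlgebra k G) P) :=
      injective_iff_hasInjectiveDimensionLT_one.2 hn
    obtain ⟨r, hr1, hr2⟩ := exists_mean_of_injective he ((moduleInjective_iff _).1 h1) G
    exact ⟨r, hr1, fun g _ => hr2 g⟩
  | succ n ih =>
    intro P V _ _ _ _ ρ e he hV hH hn
    let i : P →ₗ[MonoidAlgebra k G] (funRep ρ G).asModule := linearOfSingle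
      { toFun := fun p => (funRep ρ G).asModuleEquiv.symm fun _ => e p
        map_zero' := by simp only [map_zero]; exact map_zero _
        map_add' := fun p q => by simp only [map_add]; exact map_add _ _ _ }
      (fun g c p => by
        change (funRep ρ G).asModuleEquiv.symm _ = _ • (funRep ρ G).asModuleEquiv.symm _
        have := (realizes_asModule (funRep ρ G)).symm_apply g c fun _ => e p
        refine Eq.trans (congrArg _ ?_) this
        ext x
        exact congrFun (f := fun _ => e (MonoidAlgebra.single g c • p))
          (g := fun _ => c • ρ g (e p)) (funext fun _ => he g c p) x)
    let p : (funRep ρ G).asModule →ₗ[MonoidAlgebra k G] (cosyzygyRep ρ).asModule := linearOfSingle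
      { toFun := fun f => (cosyzygyRep ρ).asModuleEquiv.symm
          ((constFun k G V).mkQ ((funRep ρ G).asModuleEquiv f))
        map_zero' := by simp
        map_add' := fun f f' => by simp }
      (fun g c f => by
        change (cosyzygyRep ρ).asModuleEquiv.symm _ = _ • (cosyzygyRep ρ).asModuleEquiv.symm _
        have := (realizes_asModule (cosyzygyRep ρ)).symm_apply g c
          ((constFun k G V).mkQ ((funRep ρ G).asModuleEquiv f))
        refine Eq.trans (congrArg _ ?_) this
        have h1 : (funRep ρ G).asModuleEquiv (MonoidAlgebra.single g c • f) = _ :=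
          realizes_asModule (funRep ρ G) g c f
        rw [h1, map_smul]
        rfl)
    have hi : Function.Injective i := fun x y hxy => e.injective (congrFun (show
      (fun _ : G => e x) = fun _ => e y from (funRep ρ G).asModuleEquiv.symm.injective hxy) 1)
    have hp : Function.Surjective p := fun w => by
      obtain ⟨f, hf⟩ := (constFun k G V).mkQ_surjective ((cosyzygyRep ρ).asModuleEquiv w)
      exact ⟨(funRep ρ G).asModuleEquiv.symm f, by
        change (cosyzygyRep ρ).asModuleEquiv.symm ((constFun k G V).mkQ _) = w
        rw [LinearEquiv.apply_symm_apply, hf, LinearEquiv.symm_apply_apply]⟩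
    have hex : Function.Exact i p := by
      intro f
      have h1 : p f = 0 ↔ (funRep ρ G).asModuleEquiv f ∈ constFun k G V := by
        change (cosyzygyRep ρ).asModuleEquiv.symm ((constFun k G V).mkQ _) = 0 ↔ _
        rw [LinearEquiv.map_eq_zero_iff, Submodule.mkQ_apply, Submodule.Quotient.mk_eq_zero]
      rw [h1]
      constructor
      · rintro ⟨v, hv⟩
        refine ⟨e.symm v, ?_⟩
        change (funRep ρ G).asModuleEquiv.symm (fun _ => e (e.symm v)) = f
        rw [LinearEquiv.symm_apply_eq, ← hv]
        ext x
        simp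
      · rintro ⟨q, rfl⟩
        exact ⟨e q, rfl⟩
    let S : ShortComplex (ModuleCat.{u} (MonoidAlgebra k G)) :=
      ModuleCat.shortComplexOfCompEqZero i p hex.linearMap_comp_eq_zero
    have hS : S.ShortExact := ModuleCat.shortComplex_shortExact S hex hi hp
    have h2 : Injective S.X₂ := (moduleInjective_iff _).2
      (injective_of_hasMean (realizes_asModule (funRep ρ G)) inferInstance (hasMean_funRep ρ))
    -- The middle term is injective, so the cosyzygy has smaller injective dimension. Higman's
    -- criterion brings its mean back to `V`.
    have h3 : HasInjectiveDimensionLE S.X₃ n := (hS.hasInjectiveDimensionLT_X₃_iff n h2).2 hn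
    exact HasMean.of_cosyzygy H hH
      (ih (realizes_asModule (cosyzygyRep ρ)) (injective_cosyzygy hV hH) hH.cosyzygy h3)

/-- Both alternatives concern only the powers of `g`, which lie in `S` together with `g`. -/
lemma MooreCondition.subgroupOf {H : Subgroup G} (h : MooreCondition k H) (S : Subgroup G) :
    MooreCondition k (H.subgroupOf S) := by
  intro g hg
  rcases h g (fun h => hg (Subgroup.mem_subgroupOf.2 h)) with h | ⟨h1, h2⟩
  · left
    obtain ⟨⟨x, hx⟩, hx1⟩ := Subgroup.ne_bot_iff_exists_ne_one.1 h
    replace hx1 : x ≠ 1 := fun h => hx1 (Subtype.ext h)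
    obtain ⟨⟨n, hn⟩, hxH⟩ := Subgroup.mem_inf.1 hx
    change (g : G) ^ n = x at hn
    subst hn
    intro hbot
    have hmem : g ^ n ∈ Subgroup.zpowers g ⊓ H.subgroupOf S := by
      refine Subgroup.mem_inf.2 ⟨⟨n, rfl⟩, Subgroup.mem_subgroupOf.2 ?_⟩
      rw [SubgroupClass.coe_zpow]
      exact hxH
    rw [hbot, Subgroup.mem_bot] at hmem
    exact hx1 (by exact_mod_cast congrArg Subtype.val hmem)
  · right
    exact ⟨Submonoid.isOfFinOrder_coe.1 h1, by rwa [Subgroup.orderOf_coe] at h2⟩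

/-- Modules that satisfy the assumptions of Moore's conjecture are injective over the subgroups
that satisfy Moore's conjecture. -/
lemma MooreInj.injective_res {S : Subgroup G} (hS : MooreInj k S) {H : Subgroup G}
    (hfin : H.FiniteIndex) (hmoore : MooreCondition k H)
    {M : ModuleCat.{u} (MonoidAlgebra k G)} (hM : Injective (res H M)) :
    Injective (res S M) :=
  hS (H.subgroupOf S) inferInstance (hmoore.subgroupOf S) _ (injective_res_res hM)

lemma mooreInj_of_hasMean (h : ∀ H : Subgroup G, H.FiniteIndex → MooreCondition k H →
    ∀ M : ModuleCat.{u} (MonoidAlgebra k G), Injective (res H M) → HasMean (repOf M) ⊤) :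
    MooreInj k G := fun H hfin hmoore M hM =>
  injective_of_hasMean_repOf (injective_base_of_injective_res hM) (h H hfin hmoore M hM)

/-- Moore's conjecture passes from the isotropy groups to a group acting cellularly on a finite
dimensional contractible CW-complex. -/
lemma MooreInj.of_actsWithIsotropy {p : Subgroup G → Prop} (hG : ActsWithIsotropy G p)
    (hp : ∀ K, p K → MooreInj k K) : MooreInj k G := by
  refine mooreInj_of_hasMean fun H hfin hmoore M hM => ?_
  obtain ⟨X, _, _, _, _, _, _, hX, hiso⟩ := hG
  obtain ⟨π, col, d, hπ, hcol, hd, hloc⟩ := hX.exists_coloring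
  exact hasMean_of_coloring (repOf M) hX.continuous_smul π hπ col hcol d hd hloc H
    (hasMean_of_injective_res hM)
    fun x => hasMean_of_injective_res ((hp _ (hiso x)).injective_res hfin hmoore hM)

lemma MooreInj.of_hStage (α : Ordinal.{u}) : ∀ (G : Type u) [Group G],
    HStage (MooreInj k) α G → MooreInj k G := by
  induction α using WellFoundedLT.induction with
  | ind α ih =>
    intro G _ hG
    rw [HStage] at hG
    rcases hG with ⟨-, hG⟩ | ⟨-, hG⟩
    · exact hG
    · exact MooreInj.of_actsWithIsotropy hG fun K ⟨β, hβ, hK⟩ => ih β hβ K hK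

/-- A finitely generated subgroup inherits its mean from an `H`-closure subgroup containing it,
where Moore's conjecture is known by transfinite induction. -/
lemma MooreInj.of_LH (hG : LH (MooreInj k) G) : MooreInj k G := by
  refine mooreInj_of_hasMean fun H hfin hmoore M hM => ?_
  refine hasMean_of_fg (repOf M) H (hasMean_of_injective_res hM) fun F hF => ?_
  obtain ⟨K, hFK, α, hK⟩ := hG F hF
  exact (hasMean_of_injective_res
    ((MooreInj.of_hStage α K hK).injective_res hfin hmoore hM)).mono hFK

/-- The restrictions to all Moore subgroups are injective, so the bound `0` yields finite injective
dimension, which the finite-index subgroup reduces to zero. -/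
lemma MooreInj.of_phiInj (hG : PhiInj k (MooreInj k) G) : MooreInj k G := by
  refine mooreInj_of_hasMean fun H hfin hmoore M hM => ?_
  obtain ⟨n, hn⟩ := (hG M).2 ⟨0, fun K hK =>
    injective_iff_hasInjectiveDimensionLT_one.1 (hK.injective_res hfin hmoore hM)⟩
  exact hasMean_of_hasInjectiveDimensionLE H n (realizes_repOf M)
    (injective_base_of_injective_res hM) (hasMean_of_injective_res hM) hn

end Closure

end GroupMod

theorem theorem5p5 (k : Type u) [CommRing k] (G : Type u) [Group G] (H : Subgroup G)
    (hfin : H.FiniteIndex) (hmoore : GroupMod.MooreCondition k H)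
    (M : ModuleCat.{u} (MonoidAlgebra k G))
    (hM : CategoryTheory.Injective (GroupMod.res H M)) :
    (∀ S : Subgroup G, GroupMod.LH (GroupMod.MooreInj k) S →
      CategoryTheory.Injective (GroupMod.res S M)) ∧
    (∀ S : Subgroup G, GroupMod.PhiInj k (GroupMod.MooreInj k) S →
      CategoryTheory.Injective (GroupMod.res S M)) :=
  ⟨fun _ hS => (GroupMod.MooreInj.of_LH hS).injective_res hfin hmoore hM,
    fun _ hS => (GroupMod.MooreInj.of_phiInj hS).injective_res hfin hmoore hM⟩
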